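/- Let $d\ge 1$, let $\ell\ge 2$ be even, let $S\in\{\tfrac12,1,\tfrac32,\dots\}$ and $\Lambda_\ell=\{0,\dots,\ell-1\}^d$. For $x\in\Lambda_\ell$ let $S_x^{(1)},S_x^{(2)},S_x^{(3)}$ be the spin-$S$ operators at $x$ acting on $\bigotimes_{x\in\Lambda_\ell}\mathbb C^{2S+1}$. Let $J^{(1)},J^{(2)},J^{(3)}$ be real numbers with $$J^{(3)}=1\ge J^{(1)}\ge -J^{(2)}\ge 0 ,$$ let $J^{(i)}_x=J^{(i)}$ if $x\in\mathbb Z^d$ has $\|x\|_1=1$ and $J^{(i)}_x=0$ otherwise, let $J^{(i)}_{x,\mathrm{per}}=\sum_{z\in\mathbb Z^d}J^{(i)}_{x+\ell z}$, and let $$H=-\sum_{i=1}^3\ \sum_{x,y\in\Lambda_\ell}J^{(i)}_{x-y,\mathrm{per}}\,S_x^{(i)}S_y^{(i)},\qquad \langle A\rangle_\beta=\frac{\operatorname{Tr}(A\,e^{-\beta H})}{\operatorname{Tr}e^{-\beta H}}\quad(0<\beta<\infty),\qquad \langle A\rangle_\infty=\lim_{\beta\to\infty}\langle A\rangle_\beta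 .$$ Let $e_1=(1,0,\dots,0)$ and, for $0<\beta\le\infty$, $$\alpha_\ell(\beta)=J^{(1)}\langle S_0^{(1)}S_{e_1}^{(1)}\rangle_\beta+J^{(2)}\langle S_0^{(2)}S_{e_1}^{(2)}\rangle_\beta .$$ Let $\Lambda_\ell^*=\frac{2\pi}{\ell}\{-\frac\ell2+1,\dots,\frac\ell2\}^d$, $\varepsilon(k)=2\sum_{i=1}^d(1-\cos k_i)$, let $k+\pi$ denote $(k_1+\pi,\dots,k_d+\pi)$, let $(\cdot)_+$ be the positive part, and let $$I_\ell^{(d)}=\frac1{\ell^d}\sum_{k\in\Lambda_\ell^*\setminus\{0\}}\sqrt{\frac{\varepsilon(k+\pi)}{\varepsilon(k)}},\qquad \tilde I_\ell^{(d)}=\frac1{\ell^d}\sum_{k\in\Lambda_\ell^*\setminus\{0\}}\sqrt{\frac{\varepsilon(k+\pi)}{\varepsilon(k)}}\Bigl(\frac1d\sum_{i=1}^d\cos k_i\Bigr)_+ .$$ Then for every $0<\beta\le\infty$ (with $\frac1\beta=0$ if $\beta=\infty$; the limits defining the quantities at $\beta=\infty$ exist) we have $\alpha_\ell(\beta)\ge0$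 and $$\frac1{\ell^d}\sum_{x\in\Lambda_\ell}\langle S_0^{(3)}S_x^{(3)}\rangle_\beta\ \ge\ \tfrac13S(S+1)-\tfrac12\Bigl(I_\ell^{(d)}+\tfrac{\sqrt2}{\ell^d}\Bigr)\sqrt{\alpha_\ell(\beta)}-\frac1{2\beta\ell^d}\sum_{k\in\Lambda_\ell^*\setminus\{0\}}\frac1{\varepsilon(k)} ,$$ and, if $J^{(1)}>0$, also $$\frac1{\ell^d}\sum_{x\in\Lambda_\ell}\langle S_0^{(3)}S_x^{(3)}\rangle_\beta\ \ge\ \sqrt{\alpha_\ell(\beta)}\Bigl[\frac{\sqrt{\alpha_\ell(\beta)}}{1-J^{(2)}/J^{(1)}}-\tfrac12\tilde I_\ell^{(d)}\Bigr]-\frac1{2\beta\ell^d}\sum_{k\in\Lambda_\ell^*\setminus\{0\}}\frac1{\varepsilon(k)}\Bigl(\frac1d\sum_{i=1}^d\cos k_i\Bigr)_+ .$$ -/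

import Mathlib

noncomputable section

namespace SpinLRO

open Real

/-! ### Single-spin operators

`N = 2S` is twice the spin, so that a single spin lives on `ℂ ^ (N + 1)`; the basis vector with
index `j : Fin (N + 1)` is `|a⟩` with `a = j - S ∈ {-S, …, S}`. -/

/-- The spin value `S = N / 2`. -/
def spinValue (N : ℕ) : ℝ := (N : ℝ) / 2

/-- The value `a = j - S` of the third spin component in the basis state with index `j`. -/
def magn (N : ℕ) (j : Fin (N + 1)) : ℝ := (j : ℕ) - spinValue N

/-- Raising operator, `S⁺ |a⟩ = √(S(S+1) - a(a+1)) |a+1⟩`. -/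
def spinPlus (N : ℕ) : Matrix (Fin (N + 1)) (Fin (N + 1)) ℂ :=
  Matrix.of fun i j =>
    if (i : ℕ) = (j : ℕ) + 1 then
      ((√(spinValue N * (spinValue N + 1) - magn N j * (magn N j + 1)) : ℝ) : ℂ)
    else 0

/-- Lowering operator, `S⁻ |a⟩ = √(S(S+1) - (a-1)a) |a-1⟩`. -/
def spinMinus (N : ℕ) : Matrix (Fin (N + 1)) (Fin (N + 1)) ℂ :=
  Matrix.of fun i j =>
    if (j : ℕ) = (i : ℕ) + 1 then
      ((√(spinValue N * (spinValue N + 1) - (magn N j - 1) * magn N j) : ℝ) : ℂ)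
    else 0

/-- The spin matrices `S⁽¹⁾ = (S⁺ + S⁻)/2`, `S⁽²⁾ = (S⁺ - S⁻)/(2i)`, `S⁽³⁾ |a⟩ = a |a⟩`;
the components 1, 2, 3 are indexed by `0, 1, 2 : Fin 3`. -/
def spinMatrix (N : ℕ) : Fin 3 → Matrix (Fin (N + 1)) (Fin (N + 1)) ℂ :=
  ![(1 / 2 : ℂ) • (spinPlus N + spinMinus N),
    (1 / (2 * Complex.I)) • (spinPlus N - spinMinus N),
    Matrix.diagonal fun j => ((magn N j : ℝ) : ℂ)]

/-! ### The lattice system -/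

/-- The box `Λ_ℓ = {0, …, ℓ - 1}^d`. -/
abbrev Box (d ℓ : ℕ) : Type := Fin d → Fin ℓ

/-- Classical configurations on the box; they index the standard basis of `⨂_{x ∈ Λ_ℓ} ℂ^(N+1)`. -/
abbrev Config (N d ℓ : ℕ) : Type := Box d ℓ → Fin (N + 1)

/-- Operators on `⨂_{x ∈ Λ_ℓ} ℂ^(N+1)`, as matrices in the standard product basis. -/
abbrev Op (N d ℓ : ℕ) : Type := Matrix (Config N d ℓ) (Config N d ℓ) ℂ

/-- The operator `S_x⁽ⁱ⁾ = S⁽ⁱ⁾ ⊗ Id_{Λ_ℓ ∖ {x}}`. -/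
def spinAt (N d ℓ : ℕ) (i : Fin 3) (x : Box d ℓ) : Op N d ℓ :=
  Matrix.of fun σ τ => if ∀ y, y ≠ x → σ y = τ y then spinMatrix N i (σ x) (τ x) else 0

/-- Nearest-neighbour coupling on `ℤ^d`: equal to `J` if `‖x‖₁ = 1`, and to `0` otherwise. -/
def nnCoupling (d : ℕ) (J : ℝ) (x : Fin d → ℤ) : ℝ :=
  if ∑ i, |x i| = 1 then J else 0

/-- The periodised coupling `J_{x,per} = ∑_{z ∈ ℤ^d} J_{x + ℓ z}`. -/
def periodised {d : ℕ} (ℓ : ℕ) (J : (Fin d → ℤ) → ℝ) (x : Fin d → ℤ) : ℝ :=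
  ∑' z : Fin d → ℤ, J (x + (ℓ : ℤ) • z)

/-- The difference `x - y ∈ ℤ^d` of two sites of the box. -/
def siteDiff {d ℓ : ℕ} (x y : Box d ℓ) : Fin d → ℤ := fun i => ((x i : ℕ) : ℤ) - ((y i : ℕ) : ℤ)

/-- The periodic nearest-neighbour Hamiltonian without external field,
`H = - ∑_i ∑_{x,y ∈ Λ_ℓ} J⁽ⁱ⁾_{x-y,per} S_x⁽ⁱ⁾ S_y⁽ⁱ⁾` (sum over ordered pairs). -/
def hamiltonian (N d ℓ : ℕ) (J : Fin 3 → ℝ) : Op N d ℓ :=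
  -∑ i : Fin 3, ∑ x : Box d ℓ, ∑ y : Box d ℓ,
    ((periodised ℓ (nnCoupling d (J i)) (siteDiff x y) : ℝ) : ℂ) •
      (spinAt N d ℓ i x * spinAt N d ℓ i y)

/-- The Gibbs operator `exp(-β H)`. -/
def gibbsOp (N d ℓ : ℕ) (J : Fin 3 → ℝ) (β : ℝ) : Op N d ℓ :=
  NormedSpace.exp (((-β : ℝ) : ℂ) • hamiltonian N d ℓ J)

/-- The equilibrium state `⟨A⟩ = Tr[A exp(-β H)] / Tr[exp(-β H)]`. -/
def expectation (N d ℓ : ℕ) (J : Fin 3 → ℝ) (β : ℝ) (A : Op N d ℓ) : ℂ :=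
  (A * gibbsOp N d ℓ J β).trace / (gibbsOp N d ℓ J β).trace

/-- The two-point function `⟨S_0⁽ⁱ⁾ S_x⁽ⁱ⁾⟩`. It is a real number, since `S_0⁽ⁱ⁾ S_x⁽ⁱ⁾` and `H`
are Hermitian; taking the real part only makes it a term of type `ℝ`. -/
def corr (N d ℓ : ℕ) [NeZero ℓ] (J : Fin 3 → ℝ) (β : ℝ) (i : Fin 3) (x : Box d ℓ) : ℝ :=
  (expectation N d ℓ J β (spinAt N d ℓ i 0 * spinAt N d ℓ i x)).re

/-- The order parameter `ℓ^{-d} ∑_{x ∈ Λ_ℓ} ⟨S_0⁽³⁾ S_x⁽³⁾⟩`. -/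
def orderParameter (N d ℓ : ℕ) [NeZero ℓ] (J : Fin 3 → ℝ) (β : ℝ) : ℝ :=
  1 / (ℓ : ℝ) ^ d * ∑ x : Box d ℓ, corr N d ℓ J β 2 x

/-- The first unit vector `e₁ = (1, 0, …, 0)` as a site of the box. -/
def e₁ (d ℓ : ℕ) [NeZero d] [NeZero ℓ] : Box d ℓ := Pi.single 0 1

/-- `α_ℓ(β) = J⁽¹⁾ ⟨S_0⁽¹⁾ S_{e₁}⁽¹⁾⟩ + J⁽²⁾ ⟨S_0⁽²⁾ S_{e₁}⁽²⁾⟩`. -/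
def alpha (N d ℓ : ℕ) [NeZero d] [NeZero ℓ] (J : Fin 3 → ℝ) (β : ℝ) : ℝ :=
  J 0 * corr N d ℓ J β 0 (e₁ d ℓ) + J 1 * corr N d ℓ J β 1 (e₁ d ℓ)

/-! ### Fourier space -/

/-- `{-ℓ/2 + 1, …, ℓ/2}^d ∖ {0}`, the labels of the nonzero elements of `Λ_ℓ^*`. -/
def dualIndex (d ℓ : ℕ) : Finset (Fin d → ℤ) :=
  (Fintype.piFinset fun _ => Finset.Icc (-((ℓ : ℤ) / 2) + 1) ((ℓ : ℤ) / 2)).erase 0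

/-- The element `k = (2π/ℓ) n` of `Λ_ℓ^*` with label `n`. -/
def momentum {d : ℕ} (ℓ : ℕ) (n : Fin d → ℤ) : Fin d → ℝ := fun i => 2 * π / ℓ * n i

/-- The sum `∑_{k ∈ Λ_ℓ^* ∖ {0}} f(k)`. -/
def sumDual (d ℓ : ℕ) (f : (Fin d → ℝ) → ℝ) : ℝ :=
  ∑ n ∈ dualIndex d ℓ, f (momentum ℓ n)

/-- `ε(k) = 2 ∑_i (1 - cos k_i)`. -/
def eps {d : ℕ} (k : Fin d → ℝ) : ℝ := 2 * ∑ i, (1 - cos (k i))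

/-- The positive part `((1/d) ∑_i cos k_i)₊`. -/
def cosAvgPos {d : ℕ} (k : Fin d → ℝ) : ℝ := max (1 / (d : ℝ) * ∑ i, cos (k i)) 0

/-- `I_ℓ^{(d)} = ℓ^{-d} ∑_{k ≠ 0} √(ε(k+π)/ε(k))`. -/
def latticeI (d ℓ : ℕ) : ℝ :=
  1 / (ℓ : ℝ) ^ d * sumDual d ℓ fun k => √(eps (fun i => k i + π) / eps k)

/-- `Ĩ_ℓ^{(d)} = ℓ^{-d} ∑_{k ≠ 0} √(ε(k+π)/ε(k)) ((1/d) ∑_i cos k_i)₊`. -/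
def latticeITilde (d ℓ : ℕ) : ℝ :=
  1 / (ℓ : ℝ) ^ d * sumDual d ℓ fun k => √(eps (fun i => k i + π) / eps k) * cosAvgPos k

end SpinLRO

end

open Filter Topology SpinLRO

/-! Reflection positivity for the nearest-neighbour spin system on the torus, in the form of an
infrared bound, gives both inequalities.

The exponent is `K = -βH = ∑_{x,y} w_{xy} ∑_i J_i S_x⁽ⁱ⁾ S_y⁽ⁱ⁾`, where `w_{xy}` is `β`
times the number of bonds between `x` and `y` (`spinEnergy`, `bondWeight`). Since `J₁, -J₂, J₃`
are nonnegative and `S⁽¹⁾`, `i S⁽²⁾`, `S⁽³⁾` have real entries, the coupling across a reflection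
plane has the form `∑ C ⊗ C` with real `C`; Cauchy-Schwarz over words (`sq_trace_exp_le`) gives
reflection positivity. Completing the square in an external field `h` coupled to `S⁽³⁾` and
reflecting a maximiser whose non-constant bonds have the least total weight gives Gaussian
domination (`fieldZ_le_zero`). Its second derivative at `h = 0` bounds the Duhamel two-point
function of a Fourier mode of `S⁽³⁾` by `1 / (2βε(k))` (`duhamel_mode_le`), and the Falk-Bruch
inequality (`falk_bruch`) turns this into `infrared_bound`: with
`c = J₁⟨S_0⁽²⁾S_{e₁}⁽²⁾⟩ + J₂⟨S_0⁽¹⁾S_{e₁}⁽¹⁾⟩`, the Fourier transform of `⟨S_0⁽³⁾S_x⁽³⁾⟩` lies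
for `k ≠ 0` between `0` and `1 / (2βε(k)) + ½ √(2 ∑_i (α - c cos k_i) / ε(k))`; the numerator
under the root comes from the double commutator of the mode with `H`.

Correlation inequalities supply the rest. In the basis of `S⁽³⁾` the matrix `e^{-βH}` has
nonnegative entries when `J₁ ≥ |J₂|`, hence `|⟨S⁽²⁾S⁽²⁾⟩| ≤ ⟨S⁽¹⁾S⁽¹⁾⟩`; permuting the axes by
rotations of the spins, `|⟨S⁽¹⁾S⁽¹⁾⟩| ≤ ⟨S⁽³⁾S⁽³⁾⟩`. So `|c| ≤ α`, `⟨(S_0⁽³⁾)²⟩ ≥ S(S+1)/3`, and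
`⟨S_0⁽³⁾S_{e₁}⁽³⁾⟩ ≥ α / (1 - J₂/J₁)`.

The value at `x = 0` (respectively `x = e₁`) of the two-point function is the order parameter,
which is the `k = 0` mode, plus `ℓ^{-d}` times the sum over `k ≠ 0` of the transform
(respectively, of the transform times `d⁻¹ ∑_i cos k_i`). Inserting the infrared bound gives the two
claims: in the second one `α - c cos k_i` may be replaced by `α (1 + cos k_i)` after summation over
`i`, because only momenta with `∑_i cos k_i > 0` count; in the first one the terms at `k` and `k + π`
are estimated together (`sum_sqrt_le`). At `β = ∞` the states converge because
`Tr(A e^{-βH}) / Tr e^{-βH}` is a ratio of exponential sums, and the inequalities pass to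
the limit. -/

namespace SpinLRO
open scoped Matrix.Norms.Operator Kronecker
open Matrix NormedSpace

/-! ### Duhamel's formula and the second variation of the partition function -/

section duhamel
variable {n : Type*} [Fintype n] [DecidableEq n]

/-- Duhamel's formula in a Banach algebra, tested against a continuous functional. -/
theorem apply_mul_exp_add_sub {𝔸 : Type*} [NormedRing 𝔸] [NormedAlgebra ℝ 𝔸] [CompleteSpace 𝔸]
    (T : 𝔸 →L[ℝ] ℝ) (C X B : 𝔸) (t : ℝ) :
    T (C * exp (X + t • B)) - T (C * exp X) =
      t * ∫ s in (0 : ℝ)..1, T (C * exp ((1 - s) • X) * B * exp (s • (X + t • B))) := by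
  set Y := X + t • B with hY
  have hd : ∀ s : ℝ, HasDerivAt (fun s : ℝ => C * exp ((1 - s) • X) * exp (s • Y))
      (C * exp ((1 - s) • X) * (t • B) * exp (s • Y)) s := by
    intro s
    have h1 : HasDerivAt (fun s : ℝ => exp ((1 - s) • X)) (-(exp ((1 - s) • X) * X)) s := by
      have h := (hasDerivAt_exp_smul_const (𝕂 := ℝ) X (1 - s)).scomp s
        ((hasDerivAt_id s).const_sub 1)
      simpa [Function.comp_def] using h
    have h2 : HasDerivAt (fun s : ℝ => exp (s • Y)) (Y * exp (s • Y)) s :=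
      hasDerivAt_exp_smul_const' (𝕂 := ℝ) Y s
    refine ((h1.const_mul C).mul h2).congr_deriv ?_
    have : t • B = Y - X := by rw [hY]; abel
    rw [this]
    noncomm_ring
  have hd' : ∀ s : ℝ, HasDerivAt (fun s : ℝ => T (C * exp ((1 - s) • X) * exp (s • Y)))
      (t * T (C * exp ((1 - s) • X) * B * exp (s • Y))) s := by
    intro s
    refine (T.hasFDerivAt.comp_hasDerivAt s (hd s)).congr_deriv ?_
    rw [mul_smul_comm, smul_mul_assoc, map_smul, smul_eq_mul]
  have hcont : Continuous fun s : ℝ => t * T (C * exp ((1 - s) • X) * B * exp (s • Y)) := by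
    let _ : NormedAlgebra ℚ 𝔸 := NormedAlgebra.restrictScalars ℚ ℝ 𝔸
    have he : Continuous (exp : 𝔸 → 𝔸) := exp_continuous
    have h1 : Continuous fun s : ℝ => exp ((1 - s) • X) := he.comp (by fun_prop)
    have h2 : Continuous fun s : ℝ => exp (s • Y) := he.comp (by fun_prop)
    have h3 : Continuous fun s : ℝ => C * exp ((1 - s) • X) * B * exp (s • Y) := by fun_prop
    exact continuous_const.mul (T.continuous.comp h3)
  have := intervalIntegral.integral_eq_sub_of_hasDerivAt (a := 0) (b := 1)
    (fun s _ => hd' s) (hcont.intervalIntegrable _ _)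
  rw [intervalIntegral.integral_const_mul] at this
  rw [this]
  simp

theorem trace_mul_exp_add_sub (C X B : Matrix n n ℂ) (t : ℝ) :
    (C * exp (X + t • B)).trace.re - (C * exp X).trace.re =
      t * ∫ s in (0 : ℝ)..1, (C * exp ((1 - s) • X) * B * exp (s • (X + t • B))).trace.re :=
  apply_mul_exp_add_sub (LinearMap.toContinuousLinearMap
    (Complex.reLm.comp ((traceLinearMap n ℂ ℂ).restrictScalars ℝ))) C X B t

theorem hasDerivAt_trace_mul_exp_zero (C X B : Matrix n n ℂ) :
    HasDerivAt (fun t : ℝ => (C * exp (X + t • B)).trace.re)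
      (∫ s in (0 : ℝ)..1, (C * exp ((1 - s) • X) * B * exp (s • X)).trace.re) 0 := by
  let F : ℝ → ℝ := fun t =>
    ∫ s in (0 : ℝ)..1, (C * exp ((1 - s) • X) * B * exp (s • (X + t • B))).trace.re
  have hF : Continuous F := by
    refine intervalIntegral.continuous_parametric_intervalIntegral_of_continuous' ?_ 0 1
    have he : Continuous (exp : Matrix n n ℂ → Matrix n n ℂ) := exp_continuous
    have h1 : Continuous fun p : ℝ × ℝ => exp ((1 - p.2) • X) := he.comp (by fun_prop)
    have h2 : Continuous fun p : ℝ × ℝ => exp (p.2 • (X + p.1 • B)) := he.comp (by fun_prop)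
    have h3 : Continuous fun p : ℝ × ℝ => C * exp ((1 - p.2) • X) * B *
      exp (p.2 • (X + p.1 • B)) := by fun_prop
    exact Complex.continuous_re.comp (Continuous.matrix_trace h3)
  rw [hasDerivAt_iff_tendsto_slope_zero]
  have h0 : Tendsto F (𝓝[≠] 0) (𝓝 (F 0)) := (hF.tendsto 0).mono_left nhdsWithin_le_nhds
  have hF0 : F 0 = ∫ s in (0 : ℝ)..1, (C * exp ((1 - s) • X) * B * exp (s • X)).trace.re := by
    simp [F]
  rw [← hF0]
  refine h0.congr' ?_
  filter_upwards [self_mem_nhdsWithin] with t ht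
  have ht' : t ≠ 0 := ht
  have := trace_mul_exp_add_sub C X B t
  simp only [zero_add, zero_smul, add_zero, smul_eq_mul]
  rw [this, ← mul_assoc, inv_mul_cancel₀ ht', one_mul]

theorem hasDerivAt_trace_exp (X B : Matrix n n ℂ) (t : ℝ) :
    HasDerivAt (fun t : ℝ => (exp (X + t • B)).trace.re) ((B * exp (X + t • B)).trace.re) t := by
  have h := hasDerivAt_trace_mul_exp_zero 1 (X + t • B) B
  have hc : ∀ s : ℝ, ((1 : Matrix n n ℂ) * exp ((1 - s) • (X + t • B)) * B *
      exp (s • (X + t • B))).trace.re = (B * exp (X + t • B)).trace.re := by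
    intro s
    have : exp (X + t • B) = exp (s • (X + t • B)) * exp ((1 - s) • (X + t • B)) := by
      rw [← Matrix.exp_add_of_commute, ← add_smul]
      · simp
      · exact ((Commute.refl _).smul_left _).smul_right _
    rw [one_mul, this, ← mul_assoc B, Matrix.trace_mul_comm, ← mul_assoc, Matrix.trace_mul_comm,
      mul_assoc]
  rw [intervalIntegral.integral_congr fun s _ => hc s] at h
  simp only [intervalIntegral.integral_const, sub_zero, one_smul, one_mul] at h
  have h' := HasDerivAt.comp_sub_const (f := fun u : ℝ => (exp (X + t • B + u • B)).trace.re) t t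
    (by rw [sub_self]; exact h)
  refine h'.congr_of_eventuallyEq (Eventually.of_forall fun u => ?_)
  simp only
  rw [add_assoc, ← add_smul, add_sub_cancel]

theorem second_deriv_nonneg_of_isMin {f f' : ℝ → ℝ} {c : ℝ} (hf : ∀ t, HasDerivAt f (f' t) t)
    (hf' : HasDerivAt f' c 0) (hmin : ∀ t, f 0 ≤ f t) : 0 ≤ c := by
  have hd : deriv f = f' := funext fun t => (hf t).deriv
  have hdd : deriv (deriv f) 0 = c := by rw [hd]; exact hf'.deriv
  have hlm : IsLocalMin f 0 := Eventually.of_forall hmin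
  by_contra! hc
  have hmax : IsLocalMax f 0 := by
    refine isLocalMax_of_deriv_deriv_neg (by rw [hdd]; exact hc) hlm.deriv_eq_zero
      (hf 0).continuousAt
  have heq : f =ᶠ[𝓝 0] fun _ => f 0 := by
    filter_upwards [hmax] with t ht using le_antisymm ht (hmin t)
  have h2 : deriv (deriv f) 0 = 0 := by
    have := heq.deriv.deriv_eq
    simpa using this
  rw [hdd] at h2
  exact hc.ne h2

/-- The Duhamel two-point function `∫₀¹ Tr (A e^{(1-s)K} A e^{sK}) ds`, not normalised by the
partition function. -/
noncomputable def duhamel (K A : Matrix n n ℂ) : ℝ :=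
  ∫ s in (0 : ℝ)..1, (A * exp ((1 - s) • K) * A * exp (s • K)).trace.re

/-- Gaussian domination bounds the Duhamel two-point function: compare second derivatives at
`t = 0`. -/
theorem duhamel_le_of_gaussian_domination (K A : Matrix n n ℂ) (q : ℝ)
    (h : ∀ t : ℝ, (exp (K + t • A)).trace.re ≤ Real.exp (q * t ^ 2 / 2) * (exp K).trace.re) :
    duhamel K A ≤ q * (exp K).trace.re := by
  set Z := (exp K).trace.re with hZ
  have h1 : ∀ t : ℝ, HasDerivAt
      (fun t : ℝ => Real.exp (q * t ^ 2 / 2) * Z - (exp (K + t • A)).trace.re)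
      (Real.exp (q * t ^ 2 / 2) * (q * t) * Z - (A * exp (K + t • A)).trace.re) t := by
    intro t
    refine HasDerivAt.sub ?_ (hasDerivAt_trace_exp K A t)
    refine HasDerivAt.mul_const ?_ Z
    have : HasDerivAt (fun t : ℝ => q * t ^ 2 / 2) (q * t) t := by
      have := ((hasDerivAt_pow 2 t).const_mul q).div_const 2
      refine this.congr_deriv ?_
      simp; ring
    exact this.exp
  have h2 : HasDerivAt
      (fun t : ℝ => Real.exp (q * t ^ 2 / 2) * (q * t) * Z - (A * exp (K + t • A)).trace.re)
      (q * Z - duhamel K A) 0 := by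
    refine HasDerivAt.sub ?_ (hasDerivAt_trace_mul_exp_zero A K A)
    refine HasDerivAt.mul_const ?_ Z
    have e1 : HasDerivAt (fun t : ℝ => q * t ^ 2 / 2) (q * 0) 0 := by
      have := ((hasDerivAt_pow 2 (0 : ℝ)).const_mul q).div_const 2
      refine this.congr_deriv ?_
      simp
    have e2 : HasDerivAt (fun t : ℝ => q * t) q 0 := by
      simpa using (hasDerivAt_id (0 : ℝ)).const_mul q
    refine (e1.exp.mul e2).congr_deriv ?_
    simp
  have := second_deriv_nonneg_of_isMin h1 h2 (fun t => by simpa [← hZ] using h t)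
  linarith

/-! ### The inequality of Falk and Bruch -/

/-- The minimum of two positive numbers is below their logarithmic mean, written as an integral. -/
theorem min_exp_le_integral (a b : ℝ) :
    min (Real.exp a) (Real.exp b) ≤ ∫ s in (0 : ℝ)..1, Real.exp ((1 - s) * b + s * a) := by
  have hc : Continuous fun s : ℝ => Real.exp ((1 - s) * b + s * a) := by fun_prop
  have := intervalIntegral.integral_mono_on (a := (0 : ℝ)) (b := 1)
    (f := fun _ => min (Real.exp a) (Real.exp b)) (μ := MeasureTheory.volume) zero_le_one
    (by simp) (hc.intervalIntegrable 0 1) (fun s hs => by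
      rcases le_total a b with hab | hab
      · rw [min_eq_left (Real.exp_le_exp.2 hab)]
        exact Real.exp_le_exp.2 (by nlinarith [hs.1, hs.2])
      · rw [min_eq_right (Real.exp_le_exp.2 hab)]
        exact Real.exp_le_exp.2 (by nlinarith [hs.1, hs.2]))
  simpa using this

theorem sub_mul_integral_exp (a b : ℝ) :
    (a - b) * ∫ s in (0 : ℝ)..1, Real.exp ((1 - s) * b + s * a) = Real.exp a - Real.exp b := by
  have hd : ∀ s : ℝ, HasDerivAt (fun s : ℝ => Real.exp ((1 - s) * b + s * a))
      ((a - b) * Real.exp ((1 - s) * b + s * a)) s := by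
    intro s
    have h1 : HasDerivAt (fun s : ℝ => (1 - s) * b + s * a) (a - b) s := by
      have := (((hasDerivAt_id s).const_sub 1).mul_const b).add ((hasDerivAt_id s).mul_const a)
      refine this.congr_deriv ?_
      ring
    exact h1.exp.congr_deriv (mul_comm _ _)
  have hc : Continuous fun s : ℝ => (a - b) * Real.exp ((1 - s) * b + s * a) := by fun_prop
  have := intervalIntegral.integral_eq_sub_of_hasDerivAt (a := 0) (b := 1)
    (fun s _ => hd s) (hc.intervalIntegrable _ _)
  rw [intervalIntegral.integral_const_mul] at this
  simpa using this

theorem exp_smul_diagonal (κ : n → ℝ) (s : ℝ) :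
    exp (s • (diagonal fun i => (κ i : ℂ)) : Matrix n n ℂ) =
      diagonal fun i => ((Real.exp (s * κ i) : ℝ) : ℂ) := by
  rw [← diagonal_smul, Matrix.exp_diagonal]
  congr 1
  funext i
  rw [Pi.coe_exp]
  simp [← Complex.exp_eq_exp_ℂ]

theorem exp_diagonal_ofReal (κ : n → ℝ) :
    exp (diagonal fun i => (κ i : ℂ) : Matrix n n ℂ) =
      diagonal fun i => ((Real.exp (κ i) : ℝ) : ℂ) := by
  simpa using exp_smul_diagonal κ 1

theorem trace_four_diagonal {A : Matrix n n ℂ} (hA : A.IsHermitian) (u v : n → ℝ) :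
    (A * diagonal (fun i => (u i : ℂ)) * A * diagonal (fun i => (v i : ℂ))).trace.re =
      ∑ i, ∑ j, ‖A i j‖ ^ 2 * (u j * v i) := by
  simp only [Matrix.trace, Matrix.diag, Matrix.mul_diagonal]
  rw [Complex.re_sum]
  refine Finset.sum_congr rfl fun i _ => ?_
  rw [Matrix.mul_apply, Finset.sum_mul, Complex.re_sum]
  refine Finset.sum_congr rfl fun j _ => ?_
  rw [Matrix.mul_diagonal, ← hA.apply j i]
  have : A i j * (u j : ℂ) * star (A i j) * (v i : ℂ) =
      ((‖A i j‖ ^ 2 * (u j * v i) : ℝ) : ℂ) := by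
    have := Complex.mul_conj' (A i j)
    push_cast
    rw [← this]
    simp only [Complex.star_def]
    ring
  rw [this, Complex.ofReal_re]

/-- The Falk-Bruch inequality in the eigenbasis of `K`. It follows from
`(p + q) / 2 = min p q + |p - q| / 2` with `p, q` two Boltzmann weights: `min p q` is below their
logarithmic mean, and Cauchy-Schwarz applies to `|p - q|`. -/
theorem falk_bruch_diagonal (κ : n → ℝ) {A : Matrix n n ℂ} (hA : A.IsHermitian) :
    let K : Matrix n n ℂ := diagonal fun i => (κ i : ℂ)
    0 ≤ duhamel K A ∧ 0 ≤ ((A * A * K + K * A * A - 2 • (A * K * A)) * exp K).trace.re ∧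
    (A * A * exp K).trace.re ≤ duhamel K A +
      1 / 2 * √(duhamel K A * ((A * A * K + K * A * A - 2 • (A * K * A)) * exp K).trace.re) := by
  intro K
  let p : n → ℝ := fun i => Real.exp (κ i)
  let m : n → n → ℝ := fun i j => ∫ s in (0 : ℝ)..1, Real.exp ((1 - s) * κ j + s * κ i)
  let a : n → n → ℝ := fun i j => ‖A i j‖ ^ 2
  have ha : ∀ i j, 0 ≤ a i j := fun i j => sq_nonneg _
  have hsymm : ∀ i j, a i j = a j i := fun i j => by
    simp only [a]; rw [← hA.apply i j]; simp
  have hm : ∀ i j, min (p i) (p j) ≤ m i j := fun i j => min_exp_le_integral _ _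
  have hm0 : ∀ i j, 0 ≤ m i j := fun i j =>
    (le_min (Real.exp_pos _).le (Real.exp_pos _).le).trans (hm i j)
  have hmp : ∀ i j, (κ i - κ j) * m i j = p i - p j := fun i j => sub_mul_integral_exp _ _
  have hD : duhamel K A = ∑ i, ∑ j, a i j * m i j := by
    have h1 : ∀ s : ℝ, (A * exp ((1 - s) • K) * A * exp (s • K)).trace.re =
        ∑ i, ∑ j, a i j * Real.exp ((1 - s) * κ j + s * κ i) := by
      intro s
      rw [exp_smul_diagonal, exp_smul_diagonal, trace_four_diagonal hA]
      simp [Real.exp_add, a]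
    have hc : ∀ i j, Continuous fun s : ℝ => a i j * Real.exp ((1 - s) * κ j + s * κ i) :=
      fun i j => by fun_prop
    unfold duhamel
    simp only [h1]
    rw [intervalIntegral.integral_finsetSum fun i _ =>
      (continuous_finsetSum _ fun j _ => hc i j).intervalIntegrable 0 1]
    refine Finset.sum_congr rfl fun i _ => ?_
    rw [intervalIntegral.integral_finsetSum fun j _ => (hc i j).intervalIntegrable 0 1]
    exact Finset.sum_congr rfl fun j _ => intervalIntegral.integral_const_mul _ _
  have hK : exp K = diagonal fun i => ((p i : ℝ) : ℂ) := exp_diagonal_ofReal κ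
  have hswap : ∀ f : n → n → ℝ, ∑ i, ∑ j, a i j * f i j = ∑ i, ∑ j, a i j * f j i := fun f => by
    rw [Finset.sum_comm]
    exact Finset.sum_congr rfl fun i _ => Finset.sum_congr rfl fun j _ => by rw [hsymm j i]
  have hE : (A * A * exp K).trace.re = ∑ i, ∑ j, a i j * ((p i + p j) / 2) := by
    have h1 := trace_four_diagonal hA (fun _ => 1) p
    have h2 : ∑ i, ∑ j, a i j * p i = ∑ i, ∑ j, a i j * p j := hswap fun i _ => p i
    rw [hK]
    simp only [Complex.ofReal_one, diagonal_one, mul_one, one_mul] at h1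
    rw [h1]
    have : ∑ i, ∑ j, a i j * ((p i + p j) / 2) =
        1 / 2 * (∑ i, ∑ j, a i j * p i) + 1 / 2 * ∑ i, ∑ j, a i j * p j := by
      simp only [Finset.mul_sum, ← Finset.sum_add_distrib]
      exact Finset.sum_congr rfl fun i _ => Finset.sum_congr rfl fun j _ => by ring
    rw [this, ← h2]
    simp only [a]; ring
  have hC : ((A * A * K + K * A * A - 2 • (A * K * A)) * exp K).trace.re =
      ∑ i, ∑ j, a i j * ((κ i - κ j) * (p i - p j)) := by
    have e1 : (A * A * K * exp K).trace.re = ∑ i, ∑ j, a i j * (κ i * p i) := by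
      have h1 := trace_four_diagonal hA (fun _ => 1) (fun i => κ i * p i)
      simp only [Complex.ofReal_one, diagonal_one, mul_one, one_mul] at h1
      rw [hK, mul_assoc (A * A), diagonal_mul_diagonal]
      simpa [a] using h1
    have e2 : (K * A * A * exp K).trace.re = (A * A * K * exp K).trace.re := by
      have : K * exp K = exp K * K := by
        rw [hK]; simp only [K, diagonal_mul_diagonal]; congr 1; funext i; ring
      rw [mul_assoc K, mul_assoc K, Matrix.trace_mul_comm]
      simp only [mul_assoc, this]
    have e3 : (A * K * A * exp K).trace.re = ∑ i, ∑ j, a i j * (κ j * p i) := by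
      rw [hK]; exact trace_four_diagonal hA _ _
    have e4 : ((A * A * K + K * A * A - 2 • (A * K * A)) * exp K).trace.re =
        2 * (A * A * K * exp K).trace.re - 2 * (A * K * A * exp K).trace.re := by
      rw [sub_mul, add_mul, trace_sub, trace_add, Complex.sub_re, Complex.add_re, e2,
        smul_mul_assoc, trace_smul]
      simp; ring
    rw [e4, e1, e3]
    have h2 : ∑ i, ∑ j, a i j * (κ i * p i) = ∑ i, ∑ j, a i j * (κ j * p j) :=
      hswap fun i _ => κ i * p i
    have h3 : ∑ i, ∑ j, a i j * (κ j * p i) = ∑ i, ∑ j, a i j * (κ i * p j) :=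
      hswap fun i j => κ j * p i
    have : ∑ i, ∑ j, a i j * ((κ i - κ j) * (p i - p j)) =
        (∑ i, ∑ j, a i j * (κ i * p i)) + (∑ i, ∑ j, a i j * (κ j * p j))
        - (∑ i, ∑ j, a i j * (κ j * p i)) - ∑ i, ∑ j, a i j * (κ i * p j) := by
      simp only [← Finset.sum_add_distrib, ← Finset.sum_sub_distrib]
      exact Finset.sum_congr rfl fun i _ => Finset.sum_congr rfl fun j _ => by ring
    rw [this, ← h2, ← h3]
    ring
  rw [hE, hC, hD]
  have hsum : ∑ i, ∑ j, a i j * ((p i + p j) / 2) ≤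
      ∑ i, ∑ j, a i j * m i j + 1 / 2 * ∑ i, ∑ j, a i j * |p i - p j| := by
    simp only [Finset.mul_sum, ← Finset.sum_add_distrib]
    refine Finset.sum_le_sum fun i _ => Finset.sum_le_sum fun j _ => ?_
    have h1 : (p i + p j) / 2 ≤ m i j + 1 / 2 * |p i - p j| := by
      have := hm i j
      rcases le_total (p i) (p j) with h | h
      · rw [min_eq_left h] at this; rw [abs_of_nonpos (by linarith)]; linarith
      · rw [min_eq_right h] at this; rw [abs_of_nonneg (by linarith)]; linarith
    nlinarith [mul_le_mul_of_nonneg_left h1 (ha i j)]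
  have hnn : ∀ i j, 0 ≤ a i j * ((κ i - κ j) * (p i - p j)) := fun i j => by
    rw [← hmp, ← mul_assoc (κ i - κ j)]
    exact mul_nonneg (ha i j) (mul_nonneg (mul_self_nonneg _) (hm0 i j))
  have hcs : ∑ i, ∑ j, a i j * |p i - p j| ≤
      √((∑ i, ∑ j, a i j * m i j) * ∑ i, ∑ j, a i j * ((κ i - κ j) * (p i - p j))) := by
    refine Real.le_sqrt_of_sq_le ?_
    simp only [← Finset.sum_product']
    refine Finset.sum_sq_le_sum_mul_sum_of_sq_le_mul _ (fun x _ => mul_nonneg (ha _ _) (hm0 _ _))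
      (fun x _ => hnn _ _) (fun x _ => ?_)
    refine le_of_eq ?_
    rw [mul_pow, sq_abs, ← hmp]; ring
  exact ⟨Finset.sum_nonneg fun i _ => Finset.sum_nonneg fun j _ => mul_nonneg (ha i j) (hm0 i j),
    Finset.sum_nonneg fun i _ => Finset.sum_nonneg fun j _ => hnn i j, by linarith⟩

theorem exp_conj_of_mul_eq_one {U V : Matrix n n ℂ} (h : V * U = 1) (X : Matrix n n ℂ) :
    exp (U * X * V) = U * exp X * V := by
  have h' : U * V = 1 := mul_eq_one_comm.1 h
  exact Matrix.exp_units_conj (⟨U, V, h', h⟩ : (Matrix n n ℂ)ˣ) X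

theorem exists_diagonalization {K : Matrix n n ℂ} (hK : K.IsHermitian) :
    ∃ (U V : Matrix n n ℂ) (κ : n → ℝ), V * U = 1 ∧ V = Uᴴ ∧
      K = U * diagonal (fun i => (κ i : ℂ)) * V := by
  refine ⟨hK.eigenvectorUnitary, star (hK.eigenvectorUnitary : Matrix n n ℂ), hK.eigenvalues,
    Unitary.coe_star_mul_self _, rfl, ?_⟩
  have := hK.spectral_theorem
  rw [Unitary.conjStarAlgAut_apply] at this
  exact this

/-- The Falk-Bruch inequality: the thermal expectation of `A²` is bounded by the Duhamel function of
`A` and the expectation of the double commutator `[A, [A, K]]`. Neither side is normalised by the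
partition function. -/
theorem falk_bruch {K A : Matrix n n ℂ} (hK : K.IsHermitian) (hA : A.IsHermitian) :
    0 ≤ duhamel K A ∧ 0 ≤ ((A * A * K + K * A * A - 2 • (A * K * A)) * exp K).trace.re ∧
    (A * A * exp K).trace.re ≤ duhamel K A +
      1 / 2 * √(duhamel K A * ((A * A * K + K * A * A - 2 • (A * K * A)) * exp K).trace.re) := by
  obtain ⟨U, V, κ, hVU, hV, rfl⟩ := exists_diagonalization hK
  have hUV : U * V = 1 := mul_eq_one_comm.1 hVU
  set D : Matrix n n ℂ := diagonal fun i => (κ i : ℂ) with hD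
  obtain ⟨B, hB, rfl⟩ : ∃ B : Matrix n n ℂ, B.IsHermitian ∧ A = U * B * V := by
    refine ⟨V * A * U, ?_, ?_⟩
    · rw [Matrix.IsHermitian, conjTranspose_mul, conjTranspose_mul, hA.eq, hV,
        conjTranspose_conjTranspose, mul_assoc]
    · simp only [mul_assoc, hUV, mul_one]
      rw [← mul_assoc, hUV, one_mul]
  have hm : ∀ X Y : Matrix n n ℂ, U * X * V * (U * Y * V) = U * (X * Y) * V := fun X Y => by
    simp only [mul_assoc]; rw [← mul_assoc V U, hVU, one_mul]
  have ht : ∀ X : Matrix n n ℂ, (U * X * V).trace = X.trace := fun X => by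
    rw [Matrix.trace_mul_comm, ← mul_assoc, hVU, one_mul]
  have he : ∀ s : ℝ, exp (s • (U * D * V)) = U * exp (s • D) * V := fun s => by
    rw [← exp_conj_of_mul_eq_one hVU]; simp
  have hdu : duhamel (U * D * V) (U * B * V) = duhamel D B := by
    unfold duhamel
    simp only [he, hm, ht]
  have hs : U * (B * B * D) * V + U * (D * B * B) * V - 2 • (U * (B * D * B) * V) =
      U * (B * B * D + D * B * B - 2 • (B * D * B)) * V := by
    simp only [mul_sub, mul_add, sub_mul, add_mul, mul_smul_comm, smul_mul_assoc]
  rw [hdu, exp_conj_of_mul_eq_one hVU]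
  simp only [hm]
  rw [hs, hm, ht, ht]
  exact falk_bruch_diagonal κ hB

/-! ### Positivity and the limit of zero temperature -/

theorem trace_mul_exp_diagonalization {K : Matrix n n ℂ} (hK : K.IsHermitian) (A : Matrix n n ℂ) :
    ∃ (κ : n → ℝ) (c : n → ℂ), ∀ b : ℝ,
      (A * exp (b • K)).trace = ∑ i, c i * ((Real.exp (b * κ i) : ℝ) : ℂ) ∧
      (exp (b • K)).trace = ∑ i, ((Real.exp (b * κ i) : ℝ) : ℂ) := by
  obtain ⟨U, V, κ, hVU, hV, rfl⟩ := exists_diagonalization hK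
  set D : Matrix n n ℂ := diagonal fun i => (κ i : ℂ) with hD
  refine ⟨κ, fun i => (V * A * U) i i, fun b => ?_⟩
  have he : exp (b • (U * D * V)) = U * exp (b • D) * V := by
    rw [← exp_conj_of_mul_eq_one hVU]; simp
  rw [he, exp_smul_diagonal]
  constructor
  · rw [Matrix.trace_mul_comm, mul_assoc, mul_assoc, Matrix.trace_mul_comm, mul_assoc,
      Matrix.trace_mul_comm]
    simp [Matrix.trace]
  · rw [Matrix.trace_mul_comm, ← mul_assoc, hVU, one_mul]
    simp [Matrix.trace]

theorem trace_exp_pos [Nonempty n] {K : Matrix n n ℂ} (hK : K.IsHermitian) :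
    0 < (exp K).trace.re ∧ (exp K).trace.im = 0 := by
  obtain ⟨κ, c, h⟩ := trace_mul_exp_diagonalization hK 1
  have := (h 1).2
  rw [one_smul] at this
  rw [this, ← Complex.ofReal_sum]
  refine ⟨?_, Complex.ofReal_im _⟩
  rw [Complex.ofReal_re]
  exact Finset.sum_pos (fun i _ => Real.exp_pos _) Finset.univ_nonempty

/-- Thermal expectations converge at zero temperature: in an eigenbasis of `K` numerator and
denominator are sums of exponentials `e^{bκ}`, and the largest eigenvalue dominates. -/
theorem exists_tendsto_trace_ratio [Nonempty n] {K : Matrix n n ℂ} (hK : K.IsHermitian)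
    (A : Matrix n n ℂ) :
    ∃ L : ℂ, Tendsto (fun b : ℝ => (A * exp (b • K)).trace / (exp (b • K)).trace) atTop (𝓝 L) := by
  classical
  obtain ⟨κ, c, h⟩ := trace_mul_exp_diagonalization hK A
  obtain ⟨i₀, hi₀⟩ := Finite.exists_max κ
  -- after division by the largest weight every weight tends to `1` or to `0`
  let w : n → ℂ := fun i => if κ i = κ i₀ then 1 else 0
  have hw : ∀ i, Tendsto (fun b : ℝ => ((Real.exp (b * (κ i - κ i₀)) : ℝ) : ℂ)) atTop
      (𝓝 (w i)) := by
    intro i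
    by_cases hi : κ i = κ i₀
    · simp [w, hi]
    · have hlt : κ i - κ i₀ < 0 := sub_neg.2 (lt_of_le_of_ne (hi₀ i) hi)
      have : Tendsto (fun b : ℝ => Real.exp (b * (κ i - κ i₀))) atTop (𝓝 0) :=
        Real.tendsto_exp_atBot.comp (tendsto_id.atTop_mul_const_of_neg hlt)
      simp only [w, hi, if_false]
      exact_mod_cast (Complex.continuous_ofReal.tendsto 0).comp this
  have h0 : ∑ i, w i ≠ 0 := by
    simp only [w, Finset.sum_boole]
    exact_mod_cast (Finset.card_pos.2 ⟨i₀, by simp⟩).ne'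
  refine ⟨(∑ i, c i * w i) / ∑ i, w i, ?_⟩
  refine ((tendsto_finsetSum _ fun i _ => (hw i).const_mul (c i)).div
    (tendsto_finsetSum _ fun i _ => hw i) h0).congr fun b => ?_
  have hne : ((Real.exp (b * κ i₀) : ℝ) : ℂ) ≠ 0 := by exact_mod_cast (Real.exp_pos _).ne'
  have hexp : ∀ i, ((Real.exp (b * κ i) : ℝ) : ℂ) =
      ((Real.exp (b * κ i₀) : ℝ) : ℂ) * ((Real.exp (b * (κ i - κ i₀)) : ℝ) : ℂ) := fun i => by
    rw [← Complex.ofReal_mul, ← Real.exp_add]; congr 2; ring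
  have h1 : ∑ i, c i * ((Real.exp (b * κ i) : ℝ) : ℂ) = ((Real.exp (b * κ i₀) : ℝ) : ℂ) *
      ∑ i, c i * ((Real.exp (b * (κ i - κ i₀)) : ℝ) : ℂ) := by
    rw [Finset.mul_sum]
    exact Finset.sum_congr rfl fun i _ => by rw [hexp]; ring
  have h2 : ∑ i, ((Real.exp (b * κ i) : ℝ) : ℂ) = ((Real.exp (b * κ i₀) : ℝ) : ℂ) *
      ∑ i, ((Real.exp (b * (κ i - κ i₀)) : ℝ) : ℂ) := by
    rw [Finset.mul_sum]
    exact Finset.sum_congr rfl fun i _ => hexp i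
  rw [(h b).1, (h b).2, h1, h2, mul_div_mul_left _ _ hne]
  rfl

end duhamel

/-! ### A product formula for the exponential -/

theorem norm_pow_sub_pow_le {𝔸 : Type*} [NormedRing 𝔸] [NormOneClass 𝔸] {X Y : 𝔸} {c : ℝ}
    (hc : 1 ≤ c) (hX : ‖X‖ ≤ c) (hY : ‖Y‖ ≤ c) (k : ℕ) :
    ‖X ^ k - Y ^ k‖ ≤ k * c ^ k * ‖X - Y‖ := by
  have hc0 : 0 ≤ c := zero_le_one.trans hc
  induction k with
  | zero => simp
  | succ k ih =>
    have e : X ^ (k + 1) - Y ^ (k + 1) = X ^ k * (X - Y) + (X ^ k - Y ^ k) * Y := by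
      rw [pow_succ, pow_succ]; noncomm_ring
    have h1 : ‖X ^ k * (X - Y)‖ ≤ c ^ (k + 1) * ‖X - Y‖ := by
      refine (norm_mul_le _ _).trans (mul_le_mul_of_nonneg_right ?_ (norm_nonneg _))
      exact ((norm_pow_le X k).trans (pow_le_pow_left₀ (norm_nonneg _) hX k)).trans
        (pow_le_pow_right₀ hc k.le_succ)
    have h2 : ‖(X ^ k - Y ^ k) * Y‖ ≤ k * c ^ (k + 1) * ‖X - Y‖ := by
      refine (norm_mul_le _ _).trans ?_
      calc ‖X ^ k - Y ^ k‖ * ‖Y‖ ≤ (k * c ^ k * ‖X - Y‖) * c := by gcongr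
        _ = k * c ^ (k + 1) * ‖X - Y‖ := by ring
    rw [e]
    refine (norm_add_le _ _).trans ((add_le_add h1 h2).trans (le_of_eq ?_))
    push_cast; ring

/-- `(1 + M_k / k) ^ k → exp M` whenever `M_k → M`, in a Banach algebra. -/
theorem tendsto_one_add_smul_pow_exp {𝔸 : Type*} [NormedRing 𝔸] [NormOneClass 𝔸] [NormedAlgebra ℝ 𝔸]
    [CompleteSpace 𝔸] {F : ℕ → 𝔸} {M : 𝔸} (hF : Tendsto F atTop (𝓝 M)) :
    Tendsto (fun k : ℕ => (1 + (k : ℝ)⁻¹ • F k) ^ k) atTop (𝓝 (exp M)) := by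
  let _ : NormedAlgebra ℚ 𝔸 := NormedAlgebra.restrictScalars ℚ ℝ 𝔸
  have hderiv : Tendsto (fun k : ℕ => (k : ℝ) • (exp ((k : ℝ)⁻¹ • M) - 1)) atTop (𝓝 M) := by
    have h := (hasDerivAt_exp_smul_const (𝕂 := ℝ) M (0 : ℝ))
    rw [hasDerivAt_iff_tendsto_slope_zero] at h
    have hk : Tendsto (fun k : ℕ => (k : ℝ)⁻¹) atTop (𝓝[≠] 0) :=
      (tendsto_inv_atTop_nhdsGT_zero.comp tendsto_natCast_atTop_atTop).mono_right
        (nhdsWithin_mono _ fun x hx => ne_of_gt hx)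
    refine (by simpa using h.comp hk : Tendsto _ _ (𝓝 M)).congr fun k => ?_
    simp
  set G : ℕ → 𝔸 := fun k => (k : ℝ) • (exp ((k : ℝ)⁻¹ • M) - 1) with hG
  obtain ⟨Q, hQ0, hQ⟩ : ∃ Q : ℝ, 0 ≤ Q ∧ ∀ᶠ k in atTop, ‖F k‖ ≤ Q ∧ ‖G k‖ ≤ Q := by
    refine ⟨‖M‖ + 1, by positivity, ?_⟩
    filter_upwards [hF.norm.eventually (gt_mem_nhds (lt_add_one ‖M‖)),
      hderiv.norm.eventually (gt_mem_nhds (lt_add_one ‖M‖))] with k hk hk' using ⟨hk.le, hk'.le⟩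
  have hbound : ∀ᶠ k : ℕ in atTop, ‖(1 + (k : ℝ)⁻¹ • F k) ^ k - exp M‖ ≤
      Real.exp Q * ‖F k - G k‖ := by
    filter_upwards [hQ, eventually_gt_atTop 0] with k hk hk0
    have hkpos : (0 : ℝ) < k := by exact_mod_cast hk0
    have hE : exp M = (exp ((k : ℝ)⁻¹ • M)) ^ k := by
      rw [← NormedSpace.exp_nsmul, ← Nat.cast_smul_eq_nsmul ℝ, smul_smul, mul_inv_cancel₀ hkpos.ne',
        one_smul]
    have hEG : exp ((k : ℝ)⁻¹ • M) = 1 + (k : ℝ)⁻¹ • G k := by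
      rw [hG, smul_smul, inv_mul_cancel₀ hkpos.ne', one_smul, add_sub_cancel]
    have hc : (1 : ℝ) ≤ Real.exp ((k : ℝ)⁻¹ * Q) := Real.one_le_exp (by positivity)
    have hle : ∀ x : 𝔸, ‖x‖ ≤ Q → ‖1 + (k : ℝ)⁻¹ • x‖ ≤ Real.exp ((k : ℝ)⁻¹ * Q) := by
      intro x hx
      refine (norm_add_le _ _).trans ?_
      rw [norm_one, norm_smul, Real.norm_of_nonneg (by positivity), add_comm]
      refine le_trans ?_ (Real.add_one_le_exp _)
      gcongr
    have hX := hle _ hk.1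
    have hY : ‖exp ((k : ℝ)⁻¹ • M)‖ ≤ Real.exp ((k : ℝ)⁻¹ * Q) := by
      rw [hEG]; exact hle _ hk.2
    rw [hE]
    refine (norm_pow_sub_pow_le hc hX hY k).trans (le_of_eq ?_)
    have e1 : Real.exp ((k : ℝ)⁻¹ * Q) ^ k = Real.exp Q := by
      rw [← Real.exp_nat_mul, ← mul_assoc, mul_inv_cancel₀ hkpos.ne', one_mul]
    have e2 : 1 + (k : ℝ)⁻¹ • F k - exp ((k : ℝ)⁻¹ • M) = (k : ℝ)⁻¹ • (F k - G k) := by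
      rw [hEG, smul_sub]; abel
    rw [e1, e2, norm_smul, Real.norm_of_nonneg (by positivity)]
    field_simp
  rw [tendsto_iff_norm_sub_tendsto_zero]
  refine squeeze_zero' (Eventually.of_forall fun _ => norm_nonneg _) hbound ?_
  have := ((hF.sub hderiv).norm).const_mul (Real.exp Q)
  simpa using this

/-! ### Reflection positivity for matrices with real entries -/

/-- The complex matrices with real entries, as a real subalgebra. -/
noncomputable def realMatrices (n : Type*) [Fintype n] [DecidableEq n] :
    Subalgebra ℝ (Matrix n n ℂ) :=
  (Complex.ofRealAm.mapMatrix : Matrix n n ℝ →ₐ[ℝ] Matrix n n ℂ).range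

section
variable {n : Type*} [Fintype n] [DecidableEq n] {ι : Type*}

theorem mem_realMatrices_iff {M : Matrix n n ℂ} :
    M ∈ realMatrices n ↔ ∀ i j, (M i j).im = 0 := by
  constructor
  · rintro ⟨R, rfl⟩ i j
    simp
  · intro h
    refine ⟨M.map Complex.re, ?_⟩
    ext i j
    simp [Complex.ext_iff, h i j]

theorem trace_im_eq_zero {M : Matrix n n ℂ} (h : M ∈ realMatrices n) : M.trace.im = 0 := by
  rw [Matrix.trace, Complex.im_sum]
  exact Finset.sum_eq_zero fun i _ => mem_realMatrices_iff.1 h i i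

/-- The ordered product `C (w 0) * C (w 1) * ⋯` along the word `w`. -/
noncomputable def wordProd (C : ι → Matrix n n ℂ) {k : ℕ} (w : Fin k → ι) : Matrix n n ℂ :=
  (List.ofFn fun j => C (w j)).prod

theorem wordProd_mem {C : ι → Matrix n n ℂ} (hC : ∀ i, C i ∈ realMatrices n) {k : ℕ}
    (w : Fin k → ι) : wordProd C w ∈ realMatrices n := by
  refine Subalgebra.list_prod_mem _ fun x hx => ?_
  obtain ⟨j, rfl⟩ := (List.mem_ofFn' _ _).1 hx
  exact hC _

variable [Fintype ι]

theorem sum_kronecker_pow (C D : ι → Matrix n n ℂ) (k : ℕ) :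
    (∑ i, C i ⊗ₖ D i) ^ k = ∑ w : Fin k → ι, wordProd C w ⊗ₖ wordProd D w := by
  induction k with
  | zero => simp [wordProd]
  | succ k ih =>
    rw [pow_succ', ih, Finset.sum_mul_sum, ← Finset.sum_product',
      ← (Fin.consEquiv fun _ : Fin (k + 1) => ι).sum_comp]
    refine Finset.sum_congr (by rfl) fun p _ => ?_
    rw [← Matrix.mul_kronecker_mul]
    simp [wordProd, List.ofFn_succ, Fin.consEquiv]

/-- A trace of a power of `∑ C_i ⊗ D_i` is a sum of products of a trace on the left and one on the
right, so that the Cauchy-Schwarz inequality applies. -/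
theorem sq_trace_sum_kronecker_pow_le {C D : ι → Matrix n n ℂ} (hC : ∀ i, C i ∈ realMatrices n)
    (hD : ∀ i, D i ∈ realMatrices n) (k : ℕ) :
    ((∑ i, C i ⊗ₖ D i) ^ k).trace.re ^ 2 ≤
      ((∑ i, C i ⊗ₖ C i) ^ k).trace.re * ((∑ i, D i ⊗ₖ D i) ^ k).trace.re := by
  have h : ∀ {C D : ι → Matrix n n ℂ}, (∀ i, C i ∈ realMatrices n) →
      ((∑ i, C i ⊗ₖ D i) ^ k).trace.re =
        ∑ w : Fin k → ι, (wordProd C w).trace.re * (wordProd D w).trace.re := by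
    intro C D hC
    rw [sum_kronecker_pow, Matrix.trace_sum, Complex.re_sum]
    refine Finset.sum_congr rfl fun w _ => ?_
    rw [Matrix.trace_kronecker, Complex.mul_re, trace_im_eq_zero (wordProd_mem hC w)]
    simp
  rw [h hC, h hC, h hD]
  have := Finset.sum_mul_sq_le_sq_mul_sq Finset.univ (fun w : Fin k → ι => (wordProd C w).trace.re)
    (fun w => (wordProd D w).trace.re)
  simpa [sq] using this

/-- **Reflection positivity.** The coupling between the two factors is a sum of terms `C_i ⊗ D_i`,
with plus signs and real matrices. -/
theorem sq_trace_exp_le [Nonempty n] {A B : Matrix n n ℂ} {C D : ι → Matrix n n ℂ}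
    (hA : A ∈ realMatrices n) (hB : B ∈ realMatrices n)
    (hC : ∀ i, C i ∈ realMatrices n) (hD : ∀ i, D i ∈ realMatrices n) :
    (exp (A ⊗ₖ 1 + 1 ⊗ₖ B + ∑ i, C i ⊗ₖ D i)).trace.re ^ 2 ≤
      (exp (A ⊗ₖ 1 + 1 ⊗ₖ A + ∑ i, C i ⊗ₖ C i)).trace.re *
      (exp (B ⊗ₖ 1 + 1 ⊗ₖ B + ∑ i, D i ⊗ₖ D i)).trace.re := by
  -- the approximant `(1 + A / k) ⊗ (1 + B / k) + ∑ C_i ⊗ D_i / k` of `1 + M / k` is a sum of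
  -- tensor products without terms acting on one factor only
  let E : ℕ → Matrix n n ℂ → (ι → Matrix n n ℂ) → Option ι → Matrix n n ℂ := fun k A C o =>
    o.elim (1 + (k : ℝ)⁻¹ • A) fun i => √((k : ℝ)⁻¹) • C i
  have hE : ∀ {A : Matrix n n ℂ} {C : ι → Matrix n n ℂ}, A ∈ realMatrices n →
      (∀ i, C i ∈ realMatrices n) → ∀ k o, E k A C o ∈ realMatrices n := by
    intro A C hA hC k o
    cases o with
    | none => exact add_mem (one_mem _) (Subalgebra.smul_mem _ hA _)
    | some i => exact Subalgebra.smul_mem _ (hC i) _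
  have hlim : ∀ (A B : Matrix n n ℂ) (C D : ι → Matrix n n ℂ),
      Tendsto (fun k : ℕ => ((∑ o, E k A C o ⊗ₖ E k B D o) ^ k).trace.re) atTop
        (𝓝 (exp (A ⊗ₖ 1 + 1 ⊗ₖ B + ∑ i, C i ⊗ₖ D i)).trace.re) := by
    intro A B C D
    have hF : Tendsto (fun k : ℕ => (A ⊗ₖ 1 + 1 ⊗ₖ B + ∑ i, C i ⊗ₖ D i) + (k : ℝ)⁻¹ • (A ⊗ₖ B))
        atTop (𝓝 (A ⊗ₖ 1 + 1 ⊗ₖ B + ∑ i, C i ⊗ₖ D i)) := by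
      have := (tendsto_inv_atTop_zero.comp (tendsto_natCast_atTop_atTop (R := ℝ))).smul_const
        (A ⊗ₖ B)
      simpa using this.const_add (A ⊗ₖ 1 + 1 ⊗ₖ B + ∑ i, C i ⊗ₖ D i)
    have h := tendsto_one_add_smul_pow_exp hF
    have hcont : Continuous fun M : Matrix (n × n) (n × n) ℂ => M.trace.re :=
      Complex.continuous_re.comp (Continuous.matrix_trace continuous_id)
    refine ((hcont.tendsto _).comp h).congr fun k => ?_
    simp only [Function.comp_apply]
    congr 4
    rw [Fintype.sum_option]
    have hs : √((k : ℝ)⁻¹) * √((k : ℝ)⁻¹) = (k : ℝ)⁻¹ := Real.mul_self_sqrt (by positivity)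
    simp only [E, Option.elim, Matrix.smul_kronecker, Matrix.kronecker_smul, smul_smul, hs,
      Matrix.add_kronecker, Matrix.kronecker_add, Matrix.one_kronecker_one, smul_add,
      Finset.smul_sum]
    abel
  refine le_of_tendsto_of_tendsto' ((hlim A B C D).pow 2) ((hlim A A C C).mul (hlim B B D D))
    fun k => ?_
  exact sq_trace_sum_kronecker_pow_le (hE hA hC k) (hE hB hD k) k

end

/-! ### Operators acting on a single tensor factor -/

section siteOp
variable {V q : Type*} [Fintype V] [DecidableEq V] [DecidableEq q]

/-- The operator `M ⊗ Id` on `⨂_{x ∈ V} ℂ^q` that acts as `M` on the factor at `x`. -/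
def siteMatrix (x : V) (M : Matrix q q ℂ) : Matrix (V → q) (V → q) ℂ :=
  Matrix.of fun σ τ => if ∀ y, y ≠ x → σ y = τ y then M (σ x) (τ x) else 0

theorem siteMatrix_update (x : V) (M : Matrix q q ℂ) (σ : V → q) (a : q) :
    siteMatrix x M σ (Function.update σ x a) = M (σ x) a := by
  have : ∀ y, y ≠ x → σ y = Function.update σ x a y := fun y hy => by
    rw [Function.update_of_ne hy]
  simp only [siteMatrix, of_apply]
  rw [if_pos this, Function.update_self]

variable [Fintype q]

theorem siteMatrix_mul_apply (x : V) (M : Matrix q q ℂ) (X : Matrix (V → q) (V → q) ℂ)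
    (σ τ : V → q) :
    (siteMatrix x M * X) σ τ = ∑ a, M (σ x) a * X (Function.update σ x a) τ := by
  rw [Matrix.mul_apply]
  symm
  refine Fintype.sum_of_injective (fun a => Function.update σ x a)
    (Function.update_injective σ x) _ _ (fun ρ hρ => ?_) (fun a => ?_)
  · simp only [siteMatrix, of_apply]
    rw [if_neg, zero_mul]
    intro h
    exact hρ ⟨ρ x, funext fun y => by
      by_cases hy : y = x
      · subst hy; simp
      · simp [Function.update_of_ne hy, h y hy]⟩
  · rw [siteMatrix_update]

/-- `siteMatrix x` as an algebra homomorphism. -/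
def siteOp (x : V) : Matrix q q ℂ →ₐ[ℂ] Matrix (V → q) (V → q) ℂ :=
  AlgHom.ofLinearMap
    { toFun := siteMatrix x
      map_add' := fun M M' => by
        ext σ τ; simp only [siteMatrix, of_apply, Matrix.add_apply]; split_ifs <;> simp
      map_smul' := fun c M => by
        ext σ τ; simp only [siteMatrix, of_apply, Matrix.smul_apply, RingHom.id_apply]
        split_ifs <;> simp }
    (by
      ext σ τ
      simp only [LinearMap.coe_mk, AddHom.coe_mk, siteMatrix, of_apply, Matrix.one_apply]
      by_cases h : σ = τ
      · subst h; simp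
      · by_cases h' : ∀ y, y ≠ x → σ y = τ y
        · have : σ x ≠ τ x := fun hx => h (funext fun y => by
            by_cases hy : y = x
            · subst hy; exact hx
            · exact h' y hy)
          simp [h, this]
        · simp [h, h'])
    (fun M M' => by
      ext σ τ
      simp only [LinearMap.coe_mk, AddHom.coe_mk]
      rw [siteMatrix_mul_apply]
      have : ∀ a, (∀ y, y ≠ x → Function.update σ x a y = τ y) ↔ ∀ y, y ≠ x → σ y = τ y :=
        fun a => forall₂_congr fun y hy => by rw [Function.update_of_ne hy]
      simp only [siteMatrix, of_apply, this, Function.update_self]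
      split_ifs
      · rw [Matrix.mul_apply]
      · simp)

theorem siteOp_apply (x : V) (M : Matrix q q ℂ) (σ τ : V → q) :
    siteOp x M σ τ = if ∀ y, y ≠ x → σ y = τ y then M (σ x) (τ x) else 0 := rfl

theorem siteOp_mul_apply (x : V) (M : Matrix q q ℂ) (X : Matrix (V → q) (V → q) ℂ) (σ τ : V → q) :
    (siteOp x M * X) σ τ = ∑ a, M (σ x) a * X (Function.update σ x a) τ :=
  siteMatrix_mul_apply x M X σ τ

theorem siteOp_conjTranspose (x : V) (M : Matrix q q ℂ) : (siteOp x M)ᴴ = siteOp x Mᴴ := by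
  ext σ τ
  rw [conjTranspose_apply, siteOp_apply, siteOp_apply, conjTranspose_apply]
  simp only [eq_comm (a := τ _)]
  split_ifs <;> simp

theorem siteOp_mem_realMatrices (x : V) {M : Matrix q q ℂ} (hM : M ∈ realMatrices q) :
    siteOp x M ∈ realMatrices (V → q) := by
  rw [mem_realMatrices_iff] at hM ⊢
  intro σ τ
  rw [siteOp_apply]
  split_ifs
  · exact hM _ _
  · rfl

theorem siteOp_mul_siteOp_apply {x y : V} (hxy : x ≠ y) (M M' : Matrix q q ℂ) (σ τ : V → q) :
    (siteOp x M * siteOp y M') σ τ =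
      if ∀ z, z ≠ x → z ≠ y → σ z = τ z then M (σ x) (τ x) * M' (σ y) (τ y) else 0 := by
  rw [siteOp_mul_apply]
  simp only [siteOp_apply, Function.update_of_ne hxy.symm]
  split_ifs with h
  · rw [Finset.sum_eq_single (τ x)]
    · rw [if_pos]
      intro z hz
      by_cases hzx : z = x
      · subst hzx; simp
      · rw [Function.update_of_ne hzx]; exact h z hzx hz
    · intro a _ ha
      rw [if_neg, mul_zero]
      intro h'
      exact ha (by simpa using h' x hxy)
    · simp
  · refine Finset.sum_eq_zero fun a _ => ?_
    rw [if_neg, mul_zero]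
    intro h'
    exact h fun z hzx hzy => by simpa [Function.update_of_ne hzx] using h' z hzy

theorem siteOp_commute {x y : V} (hxy : x ≠ y) (M M' : Matrix q q ℂ) :
    Commute (siteOp x M) (siteOp y M') := by
  ext σ τ
  rw [siteOp_mul_siteOp_apply hxy, siteOp_mul_siteOp_apply hxy.symm]
  congr 1
  · exact propext ⟨fun h z h1 h2 => h z h2 h1, fun h z h1 h2 => h z h2 h1⟩
  · rw [mul_comm]

/-! ### Relabelling and splitting of the sites -/

/-- The algebra isomorphism induced by a relabelling of the basis. -/
def relabel {m n : Type*} [Fintype m] [Fintype n] [DecidableEq m] [DecidableEq n] (e : m ≃ n) :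
    Matrix m m ℂ ≃ₐ[ℂ] Matrix n n ℂ := reindexAlgEquiv ℂ ℂ e

theorem relabel_apply {m n : Type*} [Fintype m] [Fintype n] [DecidableEq m] [DecidableEq n]
    (e : m ≃ n) (M : Matrix m m ℂ) (i j : n) : relabel e M i j = M (e.symm i) (e.symm j) := rfl

theorem trace_relabel {m n : Type*} [Fintype m] [Fintype n] [DecidableEq m] [DecidableEq n]
    (e : m ≃ n) (M : Matrix m m ℂ) : (relabel e M).trace = M.trace := by
  simp only [Matrix.trace, Matrix.diag, relabel_apply]
  exact e.symm.sum_comp fun i => M i i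

theorem exp_relabel {m n : Type*} [Fintype m] [Fintype n] [DecidableEq m] [DecidableEq n]
    (e : m ≃ n) (M : Matrix m m ℂ) : exp (relabel e M) = relabel e (exp M) := by
  have : Continuous (relabel e) := by
    refine continuous_matrix fun i j => ?_
    simp only [relabel_apply]
    exact continuous_id.matrix_elem _ _
  exact (map_exp (relabel e) this M).symm

/-- The relabelling of configurations induced by a relabelling of the sites. -/
def sitePerm {V' : Type*} (q : Type*) (π : V ≃ V') : (V → q) ≃ (V' → q) :=
  Equiv.arrowCongr π (Equiv.refl q)

theorem relabel_sitePerm_siteOp {V' : Type*} [Fintype V'] [DecidableEq V'] (π : V ≃ V') (x : V)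
    (M : Matrix q q ℂ) : relabel (sitePerm q π) (siteOp x M) = siteOp (π x) M := by
  ext σ τ
  rw [relabel_apply, siteOp_apply, siteOp_apply]
  have : ∀ σ : V' → q, ∀ y, (sitePerm q π).symm σ y = σ (π y) := fun σ y => rfl
  simp only [this]
  congr 1
  refine propext ⟨fun h y hy => ?_, fun h y hy => h _ fun h' => hy (π.injective h')⟩
  have := h (π.symm y) fun h' => hy (by rw [← h', π.apply_symm_apply])
  simpa using this

/-- `X ↦ X ⊗ 1` as an algebra homomorphism. -/
def kronLeft {n : Type*} [Fintype n] [DecidableEq n] :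
    Matrix n n ℂ →ₐ[ℂ] Matrix (n × n) (n × n) ℂ :=
  AlgHom.ofLinearMap
    { toFun := fun X => X ⊗ₖ 1
      map_add' := fun X Y => add_kronecker X Y 1
      map_smul' := fun a X => smul_kronecker a X 1 }
    one_kronecker_one (fun X Y => by
      simp only [LinearMap.coe_mk, AddHom.coe_mk]
      rw [← mul_kronecker_mul, mul_one])

/-- `X ↦ 1 ⊗ X` as an algebra homomorphism. -/
def kronRight {n : Type*} [Fintype n] [DecidableEq n] :
    Matrix n n ℂ →ₐ[ℂ] Matrix (n × n) (n × n) ℂ :=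
  AlgHom.ofLinearMap
    { toFun := fun X => 1 ⊗ₖ X
      map_add' := fun X Y => kronecker_add 1 X Y
      map_smul' := fun a X => kronecker_smul a 1 X }
    one_kronecker_one (fun X Y => by
      simp only [LinearMap.coe_mk, AddHom.coe_mk]
      rw [← mul_kronecker_mul, mul_one])

section kron
variable {n : Type*} [Fintype n] [DecidableEq n]

theorem kronLeft_mul_kronRight (X Y : Matrix n n ℂ) : kronLeft X * kronRight Y = X ⊗ₖ Y := by
  change (X ⊗ₖ 1) * (1 ⊗ₖ Y) = _
  rw [← mul_kronecker_mul, mul_one, one_mul]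

theorem kronRight_mul_kronLeft (X Y : Matrix n n ℂ) : kronRight Y * kronLeft X = X ⊗ₖ Y := by
  change (1 ⊗ₖ Y) * (X ⊗ₖ 1) = _
  rw [← mul_kronecker_mul, mul_one, one_mul]

theorem kronLeft_real_smul (a : ℝ) (X : Matrix n n ℂ) : kronLeft (a • X) = a • kronLeft X :=
  smul_kronecker a X 1

theorem kronRight_real_smul (a : ℝ) (X : Matrix n n ℂ) : kronRight (a • X) = a • kronRight X :=
  kronecker_smul a 1 X

end kron

theorem relabel_sum_inl (x : V) (M : Matrix q q ℂ) :
    relabel (Equiv.sumArrowEquivProdArrow V V q) (siteOp (Sum.inl x) M) =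
      kronLeft (siteOp x M) := by
  change _ = siteOp x M ⊗ₖ 1
  ext ⟨σ, σ'⟩ ⟨τ, τ'⟩
  rw [relabel_apply, kronecker_apply, siteOp_apply, siteOp_apply]
  by_cases h : σ' = τ'
  · subst h
    simp [Equiv.sumArrowEquivProdArrow]
  · have h' : ∃ y, σ' y ≠ τ' y := by by_contra! h'; exact h (funext h')
    simp [Equiv.sumArrowEquivProdArrow, h, h']

theorem relabel_sum_inr (x : V) (M : Matrix q q ℂ) :
    relabel (Equiv.sumArrowEquivProdArrow V V q) (siteOp (Sum.inr x) M) =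
      kronRight (siteOp x M) := by
  change _ = 1 ⊗ₖ siteOp x M
  ext ⟨σ, σ'⟩ ⟨τ, τ'⟩
  rw [relabel_apply, kronecker_apply, siteOp_apply, siteOp_apply]
  by_cases h : σ = τ
  · subst h
    simp [Equiv.sumArrowEquivProdArrow]
  · have h' : ∃ y, σ y ≠ τ y := by by_contra! h'; exact h (funext h')
    simp [Equiv.sumArrowEquivProdArrow, h, h']

end siteOp

/-! ### The system in an external field, and its reflections -/

section field
variable {q : Type*} [Fintype q] [DecidableEq q]

/-- The local matrix `r i`, with the third component shifted by the field `h`. -/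
noncomputable def shifted (r : Fin 3 → Matrix q q ℂ) (h : ℝ) (i : Fin 3) : Matrix q q ℂ :=
  r i + (if i = 2 then h else 0) • 1

/-- The exponent `-β H(h)` of the Gibbs operator in the field `h`: with `T_x = r₃ + h_x` at `x`,
`∑_{x,y} w_{xy} (c₁ r₁ₓ r₁ᵧ + c₂ r₂ₓ r₂ᵧ + c₃ T_x T_y) - W ∑_x (T_x² - r₃ₓ²)`. When `c₃ = 1` and
`W = ∑_y w_{xy}` for all `x`, the field enters through `-½ ∑ w_{xy} (T_x - T_y)²` only. -/
noncomputable def fieldEnergy {V : Type*} [Fintype V] [DecidableEq V] (w : V → V → ℝ) (W : ℝ)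
    (c : Fin 3 → ℝ) (r : Fin 3 → Matrix q q ℂ) (h : V → ℝ) : Matrix (V → q) (V → q) ℂ :=
  ∑ x, ∑ y, w x y • ∑ i, c i • (siteOp x (shifted r (h x) i) * siteOp y (shifted r (h y) i))
    - W • ∑ x, siteOp x (shifted r (h x) 2 ^ 2 - r 2 ^ 2)

/-- The partition function in the field `h`. -/
noncomputable def fieldZ {V : Type*} [Fintype V] [DecidableEq V] (w : V → V → ℝ) (W : ℝ)
    (c : Fin 3 → ℝ) (r : Fin 3 → Matrix q q ℂ) (h : V → ℝ) : ℝ :=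
  (exp (fieldEnergy w W c r h)).trace.re

variable {W : ℝ} {c : Fin 3 → ℝ} {r : Fin 3 → Matrix q q ℂ}

theorem shifted_mem (hr : ∀ i, r i ∈ realMatrices q) (h : ℝ) (i : Fin 3) :
    shifted r h i ∈ realMatrices q :=
  add_mem (hr i) (Subalgebra.smul_mem _ (one_mem _) _)

theorem fieldEnergy_mem {V : Type*} [Fintype V] [DecidableEq V] (w : V → V → ℝ)
    (hr : ∀ i, r i ∈ realMatrices q) (h : V → ℝ) :
    fieldEnergy w W c r h ∈ realMatrices (V → q) := by
  refine sub_mem (sum_mem fun x _ => sum_mem fun y _ => Subalgebra.smul_mem _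
    (sum_mem fun i _ => Subalgebra.smul_mem _ (mul_mem ?_ ?_) _) _)
    (Subalgebra.smul_mem _ (sum_mem fun x _ => ?_) _)
  · exact siteOp_mem_realMatrices _ (shifted_mem hr _ _)
  · exact siteOp_mem_realMatrices _ (shifted_mem hr _ _)
  · exact siteOp_mem_realMatrices _ (sub_mem (pow_mem (shifted_mem hr _ _) _) (pow_mem (hr 2) _))

theorem relabel_real_smul {m n : Type*} [Fintype m] [Fintype n] [DecidableEq m] [DecidableEq n]
    (e : m ≃ n) (a : ℝ) (M : Matrix m m ℂ) : relabel e (a • M) = a • relabel e M := rfl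

theorem fieldZ_relabel {V V' : Type*} [Fintype V] [DecidableEq V] [Fintype V'] [DecidableEq V']
    (π : V ≃ V') (w : V' → V' → ℝ) (h : V' → ℝ) :
    fieldZ (fun x y => w (π x) (π y)) W c r (h ∘ π) = fieldZ w W c r h := by
  have : fieldEnergy w W c r h =
      relabel (sitePerm q π) (fieldEnergy (fun x y => w (π x) (π y)) W c r (h ∘ π)) := by
    simp only [fieldEnergy, map_sub (relabel _), map_sum, relabel_real_smul, map_mul,
      relabel_sitePerm_siteOp,
      Function.comp_apply]
    rw [← π.sum_comp]
    congr 2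
    · exact funext fun x => (π.sum_comp _).symm
    · exact (π.sum_comp fun x => siteOp x (shifted r (h x) 2 ^ 2 - r 2 ^ 2)).symm
  rw [fieldZ, fieldZ, this, exp_relabel, trace_relabel]

/-- Reflection positivity: for two copies of `V` coupled site by site with weights `v`, the
partition function in a field is below the geometric mean of those of its two symmetrised fields. -/
theorem sq_fieldZ_sum_le {V : Type*} [Fintype V] [DecidableEq V] [Nonempty q]
    (hc : ∀ i, 0 ≤ c i) (hr : ∀ i, r i ∈ realMatrices q)
    {w : V ⊕ V → V ⊕ V → ℝ} {v : V → ℝ} (hv : ∀ a, 0 ≤ v a)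
    (h1 : ∀ a b, w (.inl a) (.inl b) = w (.inr a) (.inr b))
    (h2 : ∀ a b, w (.inl a) (.inr b) = if a = b then v a else 0)
    (h3 : ∀ a b, w (.inr a) (.inl b) = if a = b then v a else 0) (f g : V → ℝ) :
    fieldZ w W c r (Sum.elim f g) ^ 2 ≤
      fieldZ w W c r (Sum.elim f f) * fieldZ w W c r (Sum.elim g g) := by
  let u : V → V → ℝ := fun a b => w (.inl a) (.inl b)
  let A : (V → ℝ) → Matrix (V → q) (V → q) ℂ := fun f => fieldEnergy u W c r f
  let C : (V → ℝ) → V × Fin 3 → Matrix (V → q) (V → q) ℂ := fun f p =>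
    √(2 * v p.1 * c p.2) • siteOp p.1 (shifted r (f p.1) p.2)
  have key : ∀ f g : V → ℝ, fieldZ w W c r (Sum.elim f g) =
      (exp (A f ⊗ₖ 1 + 1 ⊗ₖ A g + ∑ p, C f p ⊗ₖ C g p)).trace.re := by
    intro f g
    rw [fieldZ, ← trace_relabel (Equiv.sumArrowEquivProdArrow V V q), ← exp_relabel]
    congr 3
    have hC : ∑ p, C f p ⊗ₖ C g p = ∑ x, (2 * v x) • ∑ i, c i •
        (siteOp x (shifted r (f x) i) ⊗ₖ siteOp x (shifted r (g x) i)) := by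
      rw [Fintype.sum_prod_type]
      refine Finset.sum_congr rfl fun x _ => ?_
      rw [Finset.smul_sum]
      refine Finset.sum_congr rfl fun i _ => ?_
      simp only [C, Matrix.smul_kronecker, Matrix.kronecker_smul, smul_smul]
      rw [Real.mul_self_sqrt (mul_nonneg (mul_nonneg zero_le_two (hv x)) (hc i))]
    change _ = kronLeft (A f) + kronRight (A g) + _
    rw [hC]
    simp only [A, fieldEnergy, map_sub (relabel _), map_add (relabel _),
      map_sub kronLeft, map_sub kronRight, map_sum, relabel_real_smul, map_mul,
      kronLeft_real_smul, kronRight_real_smul, Fintype.sum_sum_type,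
      Sum.elim_inl, Sum.elim_inr, relabel_sum_inl, relabel_sum_inr, kronLeft_mul_kronRight,
      kronRight_mul_kronLeft, h2, h3, ← h1, ite_smul, zero_smul, Finset.sum_ite_eq,
      Finset.mem_univ, if_true, Finset.sum_add_distrib, two_mul, add_smul, smul_add, u]
    abel
  rw [key, key, key]
  exact sq_trace_exp_le (fieldEnergy_mem _ hr _) (fieldEnergy_mem _ hr _)
    (fun p => Subalgebra.smul_mem _ (siteOp_mem_realMatrices _ (shifted_mem hr _ _)) _)
    (fun p => Subalgebra.smul_mem _ (siteOp_mem_realMatrices _ (shifted_mem hr _ _)) _)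

end field

/-! ### Gaussian domination -/

section domination
variable {q : Type*} [Fintype q] [DecidableEq q] {Λ : Type*} [Fintype Λ] [DecidableEq Λ]

/-- The lattice Laplacian `(L h)_x = W h_x - ∑_y w_{xy} h_y`. -/
def laplacian (w : Λ → Λ → ℝ) (W : ℝ) (h : Λ → ℝ) (x : Λ) : ℝ := W * h x - ∑ y, w x y * h y

variable {w : Λ → Λ → ℝ} {W : ℝ} {c : Fin 3 → ℝ} {r : Fin 3 → Matrix q q ℂ}

theorem siteOp_real_smul (x : Λ) (a : ℝ) (M : Matrix q q ℂ) : siteOp x (a • M) = a • siteOp x M :=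
  (siteOp x).map_smul_of_tower a M

/-- Completing the square in the field. -/
theorem fieldEnergy_eq (hw : ∀ x y, w x y = w y x) (hc : c 2 = 1) (h : Λ → ℝ) :
    fieldEnergy w W c r h = fieldEnergy w W c r 0
      + ∑ x, (-2 * laplacian w W h x) • siteOp x (r 2)
      + (-∑ x, h x * laplacian w W h x) • (1 : Matrix (Λ → q) (Λ → q) ℂ) := by
  have e1 : ∀ x, siteOp x (shifted r (h x) 2 ^ 2 - r 2 ^ 2) =
      (2 * h x) • siteOp x (r 2) + (h x * h x) • (1 : Matrix (Λ → q) (Λ → q) ℂ) := by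
    intro x
    have : shifted r (h x) 2 ^ 2 - r 2 ^ 2 = (2 * h x) • r 2 + (h x * h x) • 1 := by
      simp only [shifted, if_true, pow_two, mul_add, add_mul, mul_smul_comm, smul_mul_assoc,
        mul_one, one_mul, smul_add, smul_smul, two_mul, add_smul]
      abel
    rw [this, map_add, siteOp_real_smul, siteOp_real_smul, map_one]
  have e0 : ∀ x : Λ, siteOp x (shifted r ((0 : Λ → ℝ) x) 2 ^ 2 - r 2 ^ 2) = 0 := by
    intro x; simp [shifted]
  have e2 : ∀ x y : Λ, ∑ i, c i • (siteOp x (shifted r (h x) i) * siteOp y (shifted r (h y) i)) =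
      ∑ i, c i • (siteOp x (shifted r ((0 : Λ → ℝ) x) i) * siteOp y (shifted r ((0 : Λ → ℝ) y) i)) +
      (h y • siteOp x (r 2) + h x • siteOp y (r 2) +
        (h x * h y) • (1 : Matrix (Λ → q) (Λ → q) ℂ)) := by
    intro x y
    simp only [Fin.sum_univ_three, shifted, hc, Pi.zero_apply, map_add, siteOp_real_smul, map_one,
      mul_add, add_mul, mul_smul_comm, smul_mul_assoc, mul_one, one_mul, smul_add, smul_smul,
      one_smul, if_true, zero_smul, add_zero, show (0 : Fin 3) ≠ 2 by decide,
      show (1 : Fin 3) ≠ 2 by decide, if_false, mul_zero, mul_comm (h y)]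
    abel
  unfold fieldEnergy
  simp only [e0, e1, e2, smul_add, Finset.sum_add_distrib, Finset.sum_const_zero, smul_zero,
    sub_zero, smul_smul, Finset.smul_sum]
  have e3 : ∑ x, ∑ y, (w x y * h x) • siteOp y (r 2) =
      ∑ x, ∑ y, (w x y * h y) • siteOp x (r 2) := by
    rw [Finset.sum_comm]
    exact Finset.sum_congr rfl fun x _ => Finset.sum_congr rfl fun y _ => by rw [hw]
  rw [e3]
  have e4 : ∑ x, (-2 * laplacian w W h x) • siteOp x (r 2) =
      (∑ x, ∑ y, (w x y * h y) • siteOp x (r 2)) + (∑ x, ∑ y, (w x y * h y) • siteOp x (r 2))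
        - ∑ x, (W * (2 * h x)) • siteOp x (r 2) := by
    rw [← Finset.sum_add_distrib, ← Finset.sum_sub_distrib]
    refine Finset.sum_congr rfl fun x _ => ?_
    rw [← Finset.sum_smul, ← add_smul, ← sub_smul, laplacian]
    congr 1; ring
  have e5 : (-∑ x, h x * laplacian w W h x) • (1 : Matrix (Λ → q) (Λ → q) ℂ) =
      ∑ x, ∑ y, (w x y * (h x * h y)) • (1 : Matrix (Λ → q) (Λ → q) ℂ) -
        ∑ x, (W * (h x * h x)) • (1 : Matrix (Λ → q) (Λ → q) ℂ) := by
    simp only [← Finset.sum_smul, ← sub_smul]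
    congr 1
    rw [← Finset.sum_sub_distrib, ← Finset.sum_neg_distrib]
    refine Finset.sum_congr rfl fun x _ => ?_
    rw [laplacian, mul_sub, Finset.mul_sum, neg_sub]
    congr 1
    · exact Finset.sum_congr rfl fun y _ => by ring
    · ring
  rw [e4, e5]
  abel

theorem exp_add_real_smul_one {n : Type*} [Fintype n] [DecidableEq n] (X : Matrix n n ℂ) (a : ℝ) :
    exp (X + a • (1 : Matrix n n ℂ)) = Real.exp a • exp X := by
  rw [Matrix.exp_add_of_commute _ _ ((Commute.one_right X).smul_right a)]
  have : (a • (1 : Matrix n n ℂ)) = diagonal fun _ => (a : ℂ) := by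
    ext i j; by_cases h : i = j <;> simp [h]
  rw [this, exp_diagonal_ofReal]
  have : (diagonal fun _ => ((Real.exp a : ℝ) : ℂ) : Matrix n n ℂ) = Real.exp a • 1 := by
    ext i j; by_cases h : i = j <;> simp [h]
  rw [this, mul_smul_comm, mul_one]

theorem fieldZ_eq (hw : ∀ x y, w x y = w y x) (hc : c 2 = 1) (h : Λ → ℝ) :
    fieldZ w W c r h = Real.exp (-∑ x, h x * laplacian w W h x) *
      (exp (fieldEnergy w W c r 0
        + ∑ x, (-2 * laplacian w W h x) • siteOp x (r 2))).trace.re := by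
  rw [fieldZ, fieldEnergy_eq hw hc, exp_add_real_smul_one, Matrix.trace_smul, Complex.real_smul,
    Complex.re_ofReal_mul]

theorem fieldEnergy_isHermitian (hw : ∀ x y, w x y = w y x)
    (hr : ∀ i, (r i)ᴴ = r i ∨ (i ≠ 2 ∧ (r i)ᴴ = -r i)) (h : Λ → ℝ) :
    (fieldEnergy w W c r h).IsHermitian := by
  have h1 : ∀ i : Fin 3, (∀ a, (shifted r a i)ᴴ = shifted r a i) ∨
      (i ≠ 2 ∧ ∀ a, (shifted r a i)ᴴ = -shifted r a i) := by
    intro i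
    rcases hr i with h | ⟨hi, h⟩
    · left
      intro a
      rw [shifted, conjTranspose_add, h, conjTranspose_smul, conjTranspose_one, star_trivial]
    · right; simp [shifted, h, hi]
  have h2 : ∀ (i : Fin 3) (x y : Λ),
      (siteOp x (shifted r (h x) i) * siteOp y (shifted r (h y) i))ᴴ =
        siteOp y (shifted r (h y) i) * siteOp x (shifted r (h x) i) := by
    intro i x y
    rw [conjTranspose_mul, siteOp_conjTranspose, siteOp_conjTranspose]
    rcases h1 i with h' | ⟨hi, h'⟩
    · simp only [h']
    · simp only [h', map_neg, neg_mul_neg]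
  have h3 : ∀ a, (shifted r a 2)ᴴ = shifted r a 2 := (h1 2).resolve_right fun h => h.1 rfl
  have h4 : (r 2)ᴴ = r 2 := by simpa [shifted] using h3 0
  rw [Matrix.IsHermitian, fieldEnergy, conjTranspose_sub, conjTranspose_smul, conjTranspose_sum,
    conjTranspose_sum]
  congr 1
  · simp only [conjTranspose_sum, conjTranspose_smul, h2, star_trivial]
    rw [Finset.sum_comm]
    exact Finset.sum_congr rfl fun x _ => Finset.sum_congr rfl fun y _ => by rw [hw]
  · simp only [siteOp_conjTranspose, conjTranspose_sub, conjTranspose_pow, h3, h4, star_trivial]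

/-- The bond `{x, y}` crosses the plane of a reflection of `Λ` that preserves `w` and across which
every site is coupled at most to its own mirror image. The two halves are copies of `V`. -/
def ReflectsBond (w : Λ → Λ → ℝ) (x y : Λ) : Prop :=
  ∃ (V : Type) (_ : Fintype V) (_ : DecidableEq V) (e : V ⊕ V ≃ Λ) (v : V → ℝ),
    (∀ a b, w (e (.inl a)) (e (.inl b)) = w (e (.inr a)) (e (.inr b))) ∧
    (∀ a b, w (e (.inl a)) (e (.inr b)) = if a = b then v a else 0) ∧
    ∃ z, (x = e (.inl z) ∧ y = e (.inr z)) ∨ (y = e (.inl z) ∧ x = e (.inr z))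

/-- The total weight of the bonds along which `h` is not constant. -/
noncomputable def roughness (w : Λ → Λ → ℝ) (h : Λ → ℝ) : ℝ :=
  ∑ x, ∑ y, if h x = h y then 0 else w x y

/-- Reflecting either half of a field onto the other one does not decrease the partition function in
the geometric mean, and removes the roughness of the bonds that cross the plane. -/
theorem exists_reflected_fields [Nonempty q] (hw : ∀ x y, w x y = w y x) (hw0 : ∀ x y, 0 ≤ w x y)
    (hc : ∀ i, 0 ≤ c i) (hr : ∀ i, r i ∈ realMatrices q) {x y : Λ} (hxy : ReflectsBond w x y)
    (hpos : 0 < w x y) (h : Λ → ℝ) (hne : h x ≠ h y) :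
    ∃ h₁ h₂ : Λ → ℝ, (∀ z, h₁ z ∈ Set.range h) ∧ (∀ z, h₂ z ∈ Set.range h) ∧
      fieldZ w W c r h ^ 2 ≤ fieldZ w W c r h₁ * fieldZ w W c r h₂ ∧
      roughness w h₁ + roughness w h₂ < 2 * roughness w h := by
  obtain ⟨V, _, _, e, v, h1, h2, z, hz⟩ := hxy
  have h3 : ∀ a b, w (e (.inr a)) (e (.inl b)) = if a = b then v a else 0 := fun a b => by
    rw [hw, h2]; by_cases hab : a = b
    · subst hab; rfl
    · simp [hab, Ne.symm hab]
  have hv : ∀ a, 0 ≤ v a := fun a => by have := hw0 (e (.inl a)) (e (.inr a)); simpa [h2] using this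
  let f : V → ℝ := fun a => h (e (.inl a))
  let g : V → ℝ := fun a => h (e (.inr a))
  have hZ : ∀ k : Λ → ℝ, fieldZ w W c r k = fieldZ (fun a b => w (e a) (e b)) W c r (k ∘ e) :=
    fun k => (fieldZ_relabel e w k).symm
  have hR : ∀ k : Λ → ℝ, roughness w k =
      (∑ a, ∑ b, if k (e (.inl a)) = k (e (.inl b)) then 0 else w (e (.inl a)) (e (.inl b))) +
      (∑ a, ∑ b, if k (e (.inr a)) = k (e (.inr b)) then 0 else w (e (.inl a)) (e (.inl b))) +
      2 * ∑ a, if k (e (.inl a)) = k (e (.inr a)) then 0 else v a := by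
    intro k
    have hcross : ∀ a, (∑ b, if k (e (.inl a)) = k (e (.inr b)) then 0
        else w (e (.inl a)) (e (.inr b))) = if k (e (.inl a)) = k (e (.inr a)) then 0 else v a := by
      intro a
      rw [Finset.sum_eq_single a]
      · simp [h2]
      · intro b _ hb; simp [h2, Ne.symm hb]
      · simp
    have hcross' : ∀ a, (∑ b, if k (e (.inr a)) = k (e (.inl b)) then 0
        else w (e (.inr a)) (e (.inl b))) = if k (e (.inl a)) = k (e (.inr a)) then 0 else v a := by
      intro a
      rw [Finset.sum_eq_single a]
      · simp [h3, eq_comm]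
      · intro b _ hb; simp [h3, Ne.symm hb]
      · simp
    unfold roughness
    rw [← e.sum_comp]
    simp only [fun a => (e.sum_comp fun y => if k (e a) = k y then 0 else w (e a) y).symm,
      Fintype.sum_sum_type, Finset.sum_add_distrib, hcross, hcross', ← h1]
    ring
  refine ⟨Sum.elim f f ∘ e.symm, Sum.elim g g ∘ e.symm, fun a => ?_, fun a => ?_, ?_, ?_⟩
  · simp only [Function.comp_apply]; rcases e.symm a with b | b <;> exact ⟨_, rfl⟩
  · simp only [Function.comp_apply]; rcases e.symm a with b | b <;> exact ⟨_, rfl⟩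
  · rw [hZ, hZ (_ ∘ _), hZ (_ ∘ _)]
    have e1 : (h ∘ e : V ⊕ V → ℝ) = Sum.elim f g := by ext a; rcases a with a | a <;> rfl
    have e2 : ∀ k : V ⊕ V → ℝ, (k ∘ e.symm) ∘ e = k := fun k => by ext a; simp
    rw [e1, e2, e2]
    exact sq_fieldZ_sum_le hc hr hv h1 h2 h3 f g
  · rw [hR, hR, hR]
    have hlt : 0 < ∑ a, if h (e (.inl a)) = h (e (.inr a)) then 0 else v a := by
      refine Finset.sum_pos' (fun a _ => ?_) ⟨z, Finset.mem_univ _, ?_⟩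
      · split_ifs; exacts [le_rfl, hv a]
      · rcases hz with ⟨rfl, rfl⟩ | ⟨rfl, rfl⟩
        · rw [if_neg hne]; simpa [h2] using hpos
        · rw [if_neg (Ne.symm hne)]; simpa [h3] using hpos
    simp only [Function.comp_apply, Equiv.symm_apply_apply, Sum.elim_inl, Sum.elim_inr, if_true,
      Finset.sum_const_zero, f, g]
    linarith

/-- **Gaussian domination.** Among the fields with values in the range of `h`, a maximiser of the
partition function of least roughness is constant along bonds, since reflecting it would otherwise
produce a maximiser of smaller roughness. -/
theorem fieldZ_le_zero [Nonempty q] (hw : ∀ x y, w x y = w y x) (hw0 : ∀ x y, 0 ≤ w x y)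
    (hW : ∀ x, ∑ y, w x y = W) (hc : ∀ i, 0 ≤ c i) (hc2 : c 2 = 1)
    (hr : ∀ i, r i ∈ realMatrices q) (hr' : ∀ i, (r i)ᴴ = r i ∨ (i ≠ 2 ∧ (r i)ᴴ = -r i))
    (hrefl : ∀ x y, 0 < w x y → ReflectsBond w x y) (h : Λ → ℝ) :
    fieldZ w W c r h ≤ fieldZ w W c r 0 := by
  classical
  have hpos : ∀ k, 0 < fieldZ w W c r k := fun k =>
    (trace_exp_pos (fieldEnergy_isHermitian hw hr' k)).1
  let S : Finset (Λ → ℝ) := Fintype.piFinset fun _ => Finset.univ.image h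
  have hS : ∀ k, k ∈ S ↔ ∀ z, k z ∈ Set.range h := fun k => by simp [S]
  have hhS : h ∈ S := (hS h).2 fun z => ⟨z, rfl⟩
  obtain ⟨k₀, hk₀, hmax₀⟩ := S.exists_max_image (fieldZ w W c r) ⟨h, hhS⟩
  let S' := S.filter fun k => fieldZ w W c r k = fieldZ w W c r k₀
  obtain ⟨k, hk, hmin⟩ := S'.exists_min_image (roughness w) ⟨k₀, by simp [S', hk₀]⟩
  obtain ⟨hkS, hkZ⟩ := Finset.mem_filter.1 hk
  have hconst : ∀ x y, 0 < w x y → k x = k y := by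
    intro x y hxy
    by_contra hne
    obtain ⟨k₁, k₂, hr₁, hr₂, hZ, hR⟩ := exists_reflected_fields (W := W) hw hw0 hc hr
      (hrefl x y hxy) hxy k hne
    have hsub : ∀ k' : Λ → ℝ, (∀ z, k' z ∈ Set.range k) → k' ∈ S := fun k' hk' =>
      (hS k').2 fun z => by
        obtain ⟨a, ha⟩ := hk' z
        rw [← ha]; exact (hS k).1 hkS a
    have hm₁ := hmax₀ k₁ (hsub k₁ hr₁)
    have hm₂ := hmax₀ k₂ (hsub k₂ hr₂)
    rw [hkZ] at hZ
    have e₁ : fieldZ w W c r k₁ = fieldZ w W c r k₀ := by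
      nlinarith [hpos k₁, hpos k₂, hpos k₀]
    have e₂ : fieldZ w W c r k₂ = fieldZ w W c r k₀ := by
      nlinarith [hpos k₁, hpos k₂, hpos k₀]
    have g₁ := hmin k₁ (Finset.mem_filter.2 ⟨hsub k₁ hr₁, e₁⟩)
    have g₂ := hmin k₂ (Finset.mem_filter.2 ⟨hsub k₂ hr₂, e₂⟩)
    linarith
  have hL : ∀ x, laplacian w W k x = 0 := by
    intro x
    rw [laplacian, ← hW x, Finset.sum_mul, ← Finset.sum_sub_distrib]
    refine Finset.sum_eq_zero fun y _ => ?_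
    rcases (hw0 x y).eq_or_lt with h0 | h0
    · rw [← h0]; ring
    · rw [hconst x y h0]; ring
  have hk0 : fieldZ w W c r k = fieldZ w W c r 0 := by
    rw [fieldZ_eq hw hc2 k]
    simp [hL, fieldZ]
  rw [← hk0, hkZ]
  exact hmax₀ h hhS

/-- **Infrared bound** for the Fourier mode given by an eigenfunction `h` of the Laplacian. -/
theorem duhamel_le_of_laplacian_eq [Nonempty q] (hw : ∀ x y, w x y = w y x)
    (hw0 : ∀ x y, 0 ≤ w x y)
    (hW : ∀ x, ∑ y, w x y = W) (hc : ∀ i, 0 ≤ c i) (hc2 : c 2 = 1)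
    (hr : ∀ i, r i ∈ realMatrices q) (hr' : ∀ i, (r i)ᴴ = r i ∨ (i ≠ 2 ∧ (r i)ᴴ = -r i))
    (hrefl : ∀ x y, 0 < w x y → ReflectsBond w x y) {h : Λ → ℝ} {lam : ℝ} (hlam : 0 < lam)
    (hh : ∀ x, laplacian w W h x = lam * h x) :
    duhamel (fieldEnergy w W c r 0) (∑ x, h x • siteOp x (r 2)) ≤
      (∑ x, h x ^ 2) / (2 * lam) * (exp (fieldEnergy w W c r 0)).trace.re := by
  refine duhamel_le_of_gaussian_domination _ _ _ fun t => ?_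
  have hk : ∀ x, laplacian w W (fun x => -(t / (2 * lam)) * h x) x = -(t / 2) * h x := by
    intro x
    have : laplacian w W (fun x => -(t / (2 * lam)) * h x) x =
        -(t / (2 * lam)) * laplacian w W h x := by
      simp only [laplacian, mul_sub, Finset.mul_sum]
      congr 1
      · ring
      · exact Finset.sum_congr rfl fun y _ => by ring
    rw [this, hh]
    field_simp
  have := fieldZ_le_zero hw hw0 hW hc hc2 hr hr' hrefl fun x => -(t / (2 * lam)) * h x
  rw [fieldZ_eq hw hc2] at this
  simp only [hk] at this
  have e1 : ∑ x, (-2 * (-(t / 2) * h x)) • siteOp x (r 2) = t • ∑ x, h x • siteOp x (r 2) := by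
    rw [Finset.smul_sum]
    refine Finset.sum_congr rfl fun x _ => ?_
    rw [smul_smul]; congr 1; ring
  have e2 : ∑ x, -(t / (2 * lam)) * h x * (-(t / 2) * h x) =
      (∑ x, h x ^ 2) / (2 * lam) * t ^ 2 / 2 := by
    rw [Finset.sum_div, Finset.sum_mul, Finset.sum_div]
    refine Finset.sum_congr rfl fun x _ => ?_
    field_simp
  rw [e1, e2, Real.exp_neg] at this
  rwa [inv_mul_le_iff₀ (Real.exp_pos _)] at this

end domination

/-! ### The periodised nearest-neighbour coupling on the torus -/

section torus
variable {d ℓ : ℕ}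

theorem nnCoupling_eq_sum (J : ℝ) (v : Fin d → ℤ) :
    nnCoupling d J v = ∑ i, ((if v = Pi.single i 1 then J else 0) +
      if v = -Pi.single i 1 then J else 0) := by
  have hs : ∀ i : Fin d, ∑ j, |(Pi.single i 1 : Fin d → ℤ) j| = 1 := by
    intro i
    rw [Finset.sum_eq_single i] <;> simp +contextual
  have hs' : ∀ i : Fin d, ∑ j, |(-Pi.single i 1 : Fin d → ℤ) j| = 1 := by
    intro i
    simpa using hs i
  by_cases h : ∑ i, |v i| = 1
  · have hv : ∃ i, v = Pi.single i 1 ∨ v = -Pi.single i 1 := by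
      obtain ⟨i, hi⟩ : ∃ i, v i ≠ 0 := by
        by_contra! h0
        simp [h0] at h
      have hsum := Finset.add_sum_erase Finset.univ (fun j => |v j|) (Finset.mem_univ i)
      rw [h] at hsum
      have h1 : 1 ≤ |v i| := Int.one_le_abs hi
      have hnn : ∀ j ∈ Finset.univ.erase i, 0 ≤ |v j| := fun j _ => abs_nonneg _
      have h2 := Finset.sum_nonneg hnn
      have h3 : ∑ j ∈ Finset.univ.erase i, |v j| = 0 := by omega
      have h4 : |v i| = 1 := by omega
      have h5 : ∀ j, j ≠ i → v j = 0 := fun j hj => abs_eq_zero.1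
        ((Finset.sum_eq_zero_iff_of_nonneg hnn).1 h3 j (by simp [hj]))
      refine ⟨i, ?_⟩
      rcases (abs_eq zero_le_one).1 h4 with h6 | h6
      · left; ext j
        by_cases hj : j = i
        · subst hj; simp [h6]
        · simp [h5 j hj, hj]
      · right; ext j
        by_cases hj : j = i
        · subst hj; simp [h6]
        · simp [h5 j hj, hj]
    have hne : ∀ i j : Fin d, (Pi.single i 1 : Fin d → ℤ) ≠ -Pi.single j 1 := by
      intro i j h
      have := congrFun h i
      simp only [Pi.single_eq_same, Pi.neg_apply, Pi.single_apply] at this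
      split_ifs at this
      all_goals omega
    have hinj : ∀ i j : Fin d, (Pi.single i 1 : Fin d → ℤ) = Pi.single j 1 ↔ i = j := by
      intro i j
      refine ⟨fun h => ?_, fun h => by rw [h]⟩
      by_contra hij
      have := congrFun h i
      simp [hij] at this
    rw [nnCoupling, if_pos h]
    obtain ⟨i, rfl | rfl⟩ := hv
    · simp [hne, hinj]
    · simp [fun i j => (hne i j).symm, hinj]
  · rw [nnCoupling, if_neg h]
    refine (Finset.sum_eq_zero fun i _ => ?_).symm
    rw [if_neg, if_neg, add_zero]
    · rintro rfl; exact h (hs' i)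
    · rintro rfl; exact h (hs i)

open Classical in
theorem periodised_nnCoupling (hℓ : ℓ ≠ 0) (J : ℝ) (x : Fin d → ℤ) :
    periodised ℓ (nnCoupling d J) x = ∑ i,
      ((if ∃ z : Fin d → ℤ, x + (ℓ : ℤ) • z = Pi.single i 1 then J else 0) +
      if ∃ z : Fin d → ℤ, x + (ℓ : ℤ) • z = -Pi.single i 1 then J else 0) := by
  have key : ∀ u : Fin d → ℤ, HasSum (fun z : Fin d → ℤ => if x + (ℓ : ℤ) • z = u then J else 0)
      (if ∃ z : Fin d → ℤ, x + (ℓ : ℤ) • z = u then J else 0) := by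
    intro u
    by_cases h : ∃ z : Fin d → ℤ, x + (ℓ : ℤ) • z = u
    · rw [if_pos h]
      obtain ⟨z, hz⟩ := h
      have := hasSum_single (f := fun z : Fin d → ℤ => if x + (ℓ : ℤ) • z = u then J else 0) z
        (fun z' hz' => if_neg fun h => hz' ?_)
      · rwa [if_pos hz] at this
      · rw [← hz, add_right_inj] at h
        have hℓ' : (ℓ : ℤ) ≠ 0 := by exact_mod_cast hℓ
        exact smul_right_injective _ hℓ' h
    · rw [if_neg h]
      push Not at h
      simp only [h, if_false]
      exact hasSum_zero
  have := hasSum_sum fun (i : Fin d) (_ : i ∈ Finset.univ) =>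
    (key (Pi.single i 1)).add (key (-Pi.single i 1))
  rw [periodised, ← this.tsum_eq]
  exact tsum_congr fun z => nnCoupling_eq_sum J _

theorem eq_iff_dvd (a b : Fin ℓ) : a = b ↔ (ℓ : ℤ) ∣ 0 - ((a : ℕ) - (b : ℕ) : ℤ) := by
  have ha := a.2
  have hb := b.2
  constructor
  · rintro rfl; simp
  · rintro ⟨k, hk⟩
    have hk1 : k < 1 := by nlinarith
    have hk2 : -1 < k := by nlinarith
    have : k = 0 := by omega
    subst this
    rw [Fin.ext_iff]; omega

theorem siteDiff_swap (x y : Box d ℓ) : siteDiff x y = -siteDiff y x := by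
  ext i; simp [siteDiff]

variable [NeZero ℓ]

/-- The unit vector in direction `i`, as a site of the torus. -/
def unitSite (d ℓ : ℕ) [NeZero ℓ] (i : Fin d) : Box d ℓ := Pi.single i 1

/-- The multiplicity `∑_i ([x = y + e_i] + [y = x + e_i])` of the bond between `x` and `y`; it is
`2` for neighbours when `ℓ = 2`. -/
def bondWeight (x y : Box d ℓ) : ℝ :=
  ∑ i, ((if x = y + unitSite d ℓ i then 1 else 0) + if y = x + unitSite d ℓ i then 1 else 0)

theorem val_add_one (hℓ : 2 ≤ ℓ) (a : Fin ℓ) :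
    ((a + 1 : Fin ℓ) : ℕ) = if (a : ℕ) + 1 = ℓ then 0 else (a : ℕ) + 1 := by
  have h1 : ((1 : Fin ℓ) : ℕ) = 1 := by
    rw [Fin.val_one', Nat.mod_eq_of_lt hℓ]
  rw [Fin.val_add, h1]
  split_ifs with h
  · rw [h, Nat.mod_self]
  · exact Nat.mod_eq_of_lt (by have := a.2; omega)

theorem eq_add_one_iff_dvd (hℓ : 2 ≤ ℓ) (a b : Fin ℓ) :
    a = b + 1 ↔ (ℓ : ℤ) ∣ 1 - ((a : ℕ) - (b : ℕ) : ℤ) := by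
  rw [Fin.ext_iff, val_add_one hℓ]
  have ha := a.2
  have hb := b.2
  constructor
  · intro h
    split_ifs at h with h'
    · exact ⟨1, by omega⟩
    · exact ⟨0, by omega⟩
  · rintro ⟨k, hk⟩
    have hk1 : k ≤ 1 := by nlinarith
    have hk2 : 0 ≤ k := by nlinarith
    have : k = 0 ∨ k = 1 := by omega
    rcases this with rfl | rfl
    · split_ifs <;> omega
    · split_ifs <;> omega

theorem exists_siteDiff_iff (hℓ : 2 ≤ ℓ) (x y : Box d ℓ) (i : Fin d) :
    (∃ z : Fin d → ℤ, siteDiff x y + (ℓ : ℤ) • z = Pi.single i 1) ↔ x = y + unitSite d ℓ i := by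
  have h1 : (∃ z : Fin d → ℤ, siteDiff x y + (ℓ : ℤ) • z = Pi.single i 1) ↔
      ∀ j, (ℓ : ℤ) ∣ (Pi.single i 1 : Fin d → ℤ) j - ((x j : ℕ) - (y j : ℕ) : ℤ) := by
    constructor
    · rintro ⟨z, hz⟩ j
      refine ⟨z j, ?_⟩
      rw [← hz]; simp [siteDiff]
    · intro h
      choose z hz using h
      refine ⟨z, funext fun j => ?_⟩
      have := hz j
      simp only [siteDiff, Pi.add_apply, Pi.smul_apply, smul_eq_mul]
      omega
  rw [h1, funext_iff]
  refine forall_congr' fun j => ?_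
  by_cases hj : j = i
  · subst hj
    simp only [unitSite, Pi.add_apply, Pi.single_eq_same]
    exact (eq_add_one_iff_dvd hℓ _ _).symm
  · simp only [unitSite, Pi.add_apply, Pi.single_apply, if_neg hj, add_zero]
    exact (eq_iff_dvd _ _).symm

theorem exists_siteDiff_neg_iff (hℓ : 2 ≤ ℓ) (x y : Box d ℓ) (i : Fin d) :
    (∃ z : Fin d → ℤ, siteDiff x y + (ℓ : ℤ) • z = -Pi.single i 1) ↔ y = x + unitSite d ℓ i := by
  rw [← exists_siteDiff_iff hℓ y x i]
  constructor
  · rintro ⟨z, hz⟩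
    exact ⟨-z, by rw [siteDiff_swap, smul_neg, ← neg_add, hz, neg_neg]⟩
  · rintro ⟨z, hz⟩
    exact ⟨-z, by rw [siteDiff_swap, smul_neg, ← neg_add, hz]⟩

/-- On the torus the periodised coupling is `J` times the multiplicity of the bond; when `ℓ = 2`,
both bonds between two neighbours contribute. -/
theorem periodised_siteDiff (hℓ : 2 ≤ ℓ) (J : ℝ) (x y : Box d ℓ) :
    periodised ℓ (nnCoupling d J) (siteDiff x y) = bondWeight x y * J := by
  classical
  rw [periodised_nnCoupling (NeZero.ne ℓ), bondWeight, Finset.sum_mul]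
  refine Finset.sum_congr rfl fun i _ => ?_
  simp only [exists_siteDiff_iff hℓ, exists_siteDiff_neg_iff hℓ]
  split_ifs <;> ring

theorem bondWeight_comm (x y : Box d ℓ) : bondWeight x y = bondWeight y x :=
  Finset.sum_congr rfl fun _ _ => add_comm _ _

theorem bondWeight_nonneg (x y : Box d ℓ) : 0 ≤ bondWeight x y :=
  Finset.sum_nonneg fun i _ => by split_ifs <;> norm_num

theorem bondWeight_add_right (x y s : Box d ℓ) : bondWeight (x + s) (y + s) = bondWeight x y := by
  unfold bondWeight
  simp only [add_right_comm _ s, add_left_inj]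

theorem sum_bondWeight_mul (x : Box d ℓ) (f : Box d ℓ → ℝ) :
    ∑ y, bondWeight x y * f y =
      ∑ i, (f (x - unitSite d ℓ i) + f (x + unitSite d ℓ i)) := by
  unfold bondWeight
  simp only [Finset.sum_mul]
  rw [Finset.sum_comm]
  refine Finset.sum_congr rfl fun i _ => ?_
  simp only [add_mul, Finset.sum_add_distrib, ite_mul, one_mul, zero_mul]
  congr 1
  · simp only [← sub_eq_iff_eq_add (a := x), Finset.sum_ite_eq, Finset.mem_univ, if_true]
  · simp

theorem sum_bondWeight (x : Box d ℓ) : ∑ y, bondWeight x y = 2 * d := by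
  have := sum_bondWeight_mul x fun _ => 1
  simp only [mul_one] at this
  rw [this]
  simp; ring

theorem bondWeight_pos_iff (x y : Box d ℓ) : 0 < bondWeight x y ↔
    ∃ i, x = y + unitSite d ℓ i ∨ y = x + unitSite d ℓ i := by
  constructor
  · intro h
    by_contra! h'
    unfold bondWeight at h
    rw [Finset.sum_eq_zero] at h
    · exact lt_irrefl _ h
    · intro i _; simp [h' i]
  · rintro ⟨i, hi⟩
    refine Finset.sum_pos' (fun i _ => by split_ifs <;> norm_num) ⟨i, Finset.mem_univ _, ?_⟩
    rcases hi with hi | hi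
    · rw [if_pos hi]; split_ifs <;> norm_num
    · rw [if_pos hi]; split_ifs <;> norm_num

end torus

/-! ### Reflections of the torus -/

section reflection
variable {d ℓ : ℕ}

/-- The reflection `x_i ↦ ℓ - 1 - x_i`. -/
def mirror (i : Fin d) (x : Box d ℓ) : Box d ℓ := Function.update x i (Fin.rev (x i))

theorem mirror_mirror (i : Fin d) (x : Box d ℓ) : mirror i (mirror i x) = x := by
  simp [mirror]

theorem mirror_apply_of_ne {i j : Fin d} (h : j ≠ i) (x : Box d ℓ) : mirror i x j = x j :=
  Function.update_of_ne h _ _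

theorem mirror_apply_same (i : Fin d) (x : Box d ℓ) : mirror i x i = Fin.rev (x i) :=
  Function.update_self _ _ _

variable [NeZero ℓ]

theorem rev_add_one (hℓ : 2 ≤ ℓ) (a : Fin ℓ) : Fin.rev (a + 1) + 1 = Fin.rev a := by
  rw [Fin.ext_iff, val_add_one hℓ, Fin.val_rev, Fin.val_rev, val_add_one hℓ]
  have := a.2
  split_ifs <;> omega

theorem mirror_add_unitSite_of_ne {i j : Fin d} (h : j ≠ i) (x : Box d ℓ) :
    mirror i (x + unitSite d ℓ j) = mirror i x + unitSite d ℓ j := by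
  ext k : 1
  by_cases hk : k = i
  · subst hk
    simp [mirror_apply_same, unitSite, Ne.symm h]
  · simp [mirror_apply_of_ne hk]

theorem mirror_add_unitSite (hℓ : 2 ≤ ℓ) (i : Fin d) (x : Box d ℓ) :
    mirror i (x + unitSite d ℓ i) + unitSite d ℓ i = mirror i x := by
  ext k : 1
  by_cases hk : k = i
  · subst hk
    simp [mirror_apply_same, unitSite, rev_add_one hℓ]
  · simp [mirror_apply_of_ne hk, unitSite, hk]

theorem bondWeight_mirror (hℓ : 2 ≤ ℓ) (i : Fin d) (x y : Box d ℓ) :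
    bondWeight (mirror i x) (mirror i y) = bondWeight x y := by
  have hinj : Function.Injective (mirror i : Box d ℓ → Box d ℓ) :=
    Function.LeftInverse.injective (mirror_mirror i)
  have h1 : ∀ x y : Box d ℓ, mirror i x = mirror i y + unitSite d ℓ i ↔ y = x + unitSite d ℓ i := by
    intro x y
    rw [← mirror_add_unitSite hℓ i x, add_left_inj, hinj.eq_iff, eq_comm]
  have h2 : ∀ j, j ≠ i → ∀ x y : Box d ℓ,
      mirror i x = mirror i y + unitSite d ℓ j ↔ x = y + unitSite d ℓ j := by
    intro j hj x y
    rw [← mirror_add_unitSite_of_ne hj, hinj.eq_iff]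
  refine Finset.sum_congr rfl fun j _ => ?_
  by_cases hj : j = i
  · subst hj; simp only [h1]; exact add_comm _ _
  · simp only [h2 j hj]

/-- A bond between the two halves of the torus links a site with its mirror image. -/
theorem eq_of_bondWeight_mirror_ne_zero (heven : Even ℓ) (hℓ : 2 ≤ ℓ) (i : Fin d) {x y : Box d ℓ}
    (hx : (x i : ℕ) < ℓ / 2) (hy : (y i : ℕ) < ℓ / 2) (h : bondWeight x (mirror i y) ≠ 0) :
    x = y := by
  obtain ⟨m, hm⟩ := heven
  have hpos := (bondWeight_nonneg x (mirror i y)).lt_of_ne' h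
  obtain ⟨j, hj⟩ := (bondWeight_pos_iff _ _).1 hpos
  have hji : j = i := by
    by_contra hji
    have hij : i ≠ j := Ne.symm hji
    have : x i = Fin.rev (y i) := by
      rcases hj with hj | hj
      · have := congrFun hj i
        simpa [mirror_apply_same, unitSite, Pi.single_apply, hij] using this
      · have := congrFun hj i
        simpa [mirror_apply_same, unitSite, Pi.single_apply, hij] using this.symm
    rw [Fin.ext_iff, Fin.val_rev] at this
    omega
  subst hji
  have hother : ∀ k, k ≠ j → x k = y k := by
    intro k hk
    rcases hj with hj | hj
    · have := congrFun hj k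
      simpa [mirror_apply_of_ne hk, unitSite, Pi.single_apply, hk] using this
    · have := congrFun hj k
      simpa [mirror_apply_of_ne hk, unitSite, Pi.single_apply, hk] using this.symm
  have hsame : x j = y j := by
    rcases hj with hj | hj
    · have := congrFun hj j
      simp only [mirror_apply_same, unitSite, Pi.add_apply, Pi.single_eq_same] at this
      rw [Fin.ext_iff, val_add_one hℓ, Fin.val_rev] at this
      rw [Fin.ext_iff]
      split_ifs at this <;> omega
    · have := congrFun hj j
      simp only [mirror_apply_same, unitSite, Pi.add_apply, Pi.single_eq_same] at this
      rw [Fin.ext_iff, val_add_one hℓ, Fin.val_rev] at this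
      rw [Fin.ext_iff]
      split_ifs at this <;> omega
  ext k : 1
  by_cases hk : k = j
  · subst hk; exact hsame
  · exact hother k hk

/-- Every bond crosses the plane of a translate of the reflection `mirror i`. -/
theorem reflectsBond_torus (heven : Even ℓ) (hℓ : 2 ≤ ℓ) {b : ℝ} (hb : 0 < b) {x y : Box d ℓ}
    (hxy : 0 < b * bondWeight x y) :
    ReflectsBond (fun x y : Box d ℓ => b * bondWeight x y) x y := by
  have main : ∀ (i : Fin d) (y : Box d ℓ),
      ReflectsBond (fun x y : Box d ℓ => b * bondWeight x y) (y + unitSite d ℓ i) y := by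
    intro i y
    let V := {z : Box d ℓ // (z i : ℕ) < ℓ / 2}
    obtain ⟨m, hm⟩ := heven
    have hmir : ∀ z : Box d ℓ, ¬ (z i : ℕ) < ℓ / 2 ↔ (mirror i z i : ℕ) < ℓ / 2 := by
      intro z
      rw [mirror_apply_same, Fin.val_rev]
      have := (z i).2
      omega
    let F : V ⊕ V → Box d ℓ := Sum.elim (fun a => a.1) fun a => mirror i a.1
    have hF : Function.Bijective F := by
      constructor
      · rintro (a | a) (c | c) h
        · exact congrArg Sum.inl (Subtype.ext h)
        · exact absurd a.2 (by
            rw [show a.1 = mirror i c.1 from h, hmir, mirror_mirror]; exact c.2)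
        · exact absurd c.2 (by
            rw [show c.1 = mirror i a.1 from h.symm, hmir, mirror_mirror]; exact a.2)
        · refine congrArg Sum.inr (Subtype.ext ?_)
          rw [← mirror_mirror i a.1, show mirror i a.1 = mirror i c.1 from h, mirror_mirror]
      · intro z
        by_cases h : (z i : ℕ) < ℓ / 2
        · exact ⟨.inl ⟨z, h⟩, rfl⟩
        · exact ⟨.inr ⟨mirror i z, (hmir z).1 h⟩, mirror_mirror i z⟩
    let e₀ : V ⊕ V ≃ Box d ℓ := Equiv.ofBijective F hF
    let s : Box d ℓ := y + unitSite d ℓ i - Function.update y i 0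
    have hs : Function.update y i 0 + s = y + unitSite d ℓ i := by simp [s]
    have hs' : mirror i (Function.update y i 0) + s = y := by
      have h1 : mirror i (Function.update y i 0) + unitSite d ℓ i = Function.update y i 0 := by
        have := mirror_add_unitSite hℓ i (mirror i (Function.update y i 0))
        ext k : 1
        by_cases hk : k = i
        · subst hk
          simp only [Pi.add_apply, mirror_apply_same, unitSite, Pi.single_eq_same,
            Function.update_self]
          rw [Fin.ext_iff, val_add_one hℓ, Fin.val_rev]
          have h0 : ((0 : Fin ℓ) : ℕ) = 0 := rfl
          rw [h0, if_pos (by omega)]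
        · simp [mirror_apply_of_ne hk, unitSite, hk]
      have h2 : mirror i (Function.update y i 0) + s + unitSite d ℓ i = y + unitSite d ℓ i := by
        rw [add_right_comm, h1, hs]
      exact add_right_cancel h2
    refine ⟨V, inferInstance, inferInstance, e₀.trans (Equiv.addRight s),
      fun a => b * bondWeight a.1 (mirror i a.1), fun a c => ?_, fun a c => ?_,
      ⟨Function.update y i 0, ?_⟩, Or.inl ⟨?_, ?_⟩⟩
    · change b * bondWeight (a.1 + s) (c.1 + s) =
        b * bondWeight (mirror i a.1 + s) (mirror i c.1 + s)
      rw [bondWeight_add_right, bondWeight_add_right, bondWeight_mirror hℓ]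
    · change b * bondWeight (a.1 + s) (mirror i c.1 + s) = _
      rw [bondWeight_add_right]
      split_ifs with hac
      · rw [hac]
      · by_contra hne
        exact hac (Subtype.ext (eq_of_bondWeight_mirror_ne_zero ⟨m, hm⟩ hℓ i a.2 c.2
          fun h => hne (by rw [h, mul_zero])))
    · have h0 : ((0 : Fin ℓ) : ℕ) = 0 := rfl
      rw [Function.update_self, h0]; omega
    · exact hs.symm
    · exact hs'.symm
  obtain ⟨i, rfl | rfl⟩ := (bondWeight_pos_iff x y).1 (by
    by_contra h
    exact absurd hxy (by nlinarith [bondWeight_nonneg x y]))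
  · exact main i y
  · obtain ⟨V, i1, i2, e, v, h1, h2, z, hz⟩ := main i x
    exact ⟨V, i1, i2, e, v, h1, h2, z, hz.symm⟩

end reflection

/-! ### Algebra of the spin matrices -/

section spin
variable (N : ℕ)

theorem magn_succ {i j : Fin (N + 1)} (h : (i : ℕ) = j + 1) : magn N i = magn N j + 1 := by
  simp only [magn, h]; push_cast; ring

theorem ladder_nonneg (j : Fin (N + 1)) :
    0 ≤ spinValue N * (spinValue N + 1) - magn N j * (magn N j + 1) := by
  have h : ((j : ℕ) : ℝ) ≤ N := by exact_mod_cast Nat.lt_succ_iff.1 j.2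
  have h0 : (0 : ℝ) ≤ ((j : ℕ) : ℝ) := Nat.cast_nonneg _
  have : spinValue N * (spinValue N + 1) - magn N j * (magn N j + 1) =
      (N - (j : ℕ)) * ((j : ℕ) + 1) := by
    simp only [magn, spinValue]; ring
  rw [this]
  exact mul_nonneg (by linarith) (by linarith)

theorem spinMinus_eq : spinMinus N = (spinPlus N)ᴴ := by
  ext i j
  simp only [spinMinus, spinPlus, of_apply, conjTranspose_apply]
  split_ifs with h
  · rw [magn_succ N h]
    simp only [Complex.star_def, Complex.conj_ofReal]
    congr 3
    ring
  · simp

theorem spinPlus_mul_spinMinus : spinPlus N * spinMinus N = diagonal fun j =>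
    ((spinValue N * (spinValue N + 1) - (magn N j - 1) * magn N j : ℝ) : ℂ) := by
  ext i k
  rw [Matrix.mul_apply]
  simp only [spinPlus, spinMinus, of_apply]
  by_cases hik : i = k
  · subst hik
    rw [diagonal_apply_eq]
    rcases Nat.eq_zero_or_pos (i : ℕ) with hi | hi
    · rw [Finset.sum_eq_zero]
      · have : magn N i = -spinValue N := by simp [magn, hi]
        rw [this, eq_comm, Complex.ofReal_eq_zero]; ring
      · intro j _; rw [if_neg (by omega), zero_mul]
    · let j : Fin (N + 1) := ⟨i - 1, by have := i.2; omega⟩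
      have hj : (i : ℕ) = j + 1 := by simp only [j]; omega
      rw [Finset.sum_eq_single j]
      · rw [if_pos hj, if_pos hj, magn_succ N hj, ← Complex.ofReal_mul]
        have h1 := ladder_nonneg N j
        have : spinValue N * (spinValue N + 1) - (magn N j + 1 - 1) * (magn N j + 1) =
          spinValue N * (spinValue N + 1) - magn N j * (magn N j + 1) := by ring
        rw [this, Real.mul_self_sqrt h1]
      · intro b _ hb
        rw [if_neg (fun h => hb (Fin.ext (by omega))), zero_mul]
      · simp
  · rw [diagonal_apply_ne _ hik]
    refine Finset.sum_eq_zero fun j _ => ?_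
    by_cases h1 : (i : ℕ) = j + 1
    · rw [if_neg (fun h2 : (k : ℕ) = j + 1 => hik (Fin.ext (by omega))), mul_zero]
    · rw [if_neg h1, zero_mul]

theorem spinMinus_mul_spinPlus : spinMinus N * spinPlus N = diagonal fun j =>
    ((spinValue N * (spinValue N + 1) - magn N j * (magn N j + 1) : ℝ) : ℂ) := by
  ext i k
  rw [Matrix.mul_apply]
  simp only [spinPlus, spinMinus, of_apply]
  by_cases hik : i = k
  · subst hik
    rw [diagonal_apply_eq]
    rcases Nat.lt_or_ge (i : ℕ) N with hi | hi
    · let j : Fin (N + 1) := ⟨i + 1, by omega⟩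
      have hj : (j : ℕ) = i + 1 := rfl
      rw [Finset.sum_eq_single j]
      · rw [if_pos hj, if_pos hj, magn_succ N hj, ← Complex.ofReal_mul]
        have h1 := ladder_nonneg N i
        have : spinValue N * (spinValue N + 1) - (magn N i + 1 - 1) * (magn N i + 1) =
          spinValue N * (spinValue N + 1) - magn N i * (magn N i + 1) := by ring
        rw [this, Real.mul_self_sqrt h1]
      · intro b _ hb
        rw [if_neg (fun h => hb (Fin.ext (by omega))), zero_mul]
      · simp
    · rw [Finset.sum_eq_zero]
      · have hN : (i : ℕ) = N := by have := i.2; omega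
        have : magn N i = spinValue N := by simp only [magn, hN, spinValue]; ring
        rw [this, eq_comm, Complex.ofReal_eq_zero]; ring
      · intro j _; rw [if_neg (by have := j.2; omega), zero_mul]
  · rw [diagonal_apply_ne _ hik]
    refine Finset.sum_eq_zero fun j _ => ?_
    by_cases h1 : (j : ℕ) = i + 1
    · rw [if_neg (fun h2 : (j : ℕ) = k + 1 => hik (Fin.ext (by omega))), mul_zero]
    · rw [if_neg h1, zero_mul]

theorem spinMatrix_zero : spinMatrix N 0 = (1 / 2 : ℂ) • (spinPlus N + spinMinus N) := rfl

theorem spinMatrix_one : spinMatrix N 1 = (-Complex.I / 2) • (spinPlus N - spinMinus N) := by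
  have : (1 / (2 * Complex.I)) = -Complex.I / 2 := by
    field_simp; simp
  rw [← this]; rfl

theorem spinMatrix_two : spinMatrix N 2 = diagonal fun j => ((magn N j : ℝ) : ℂ) := rfl

theorem commutator_two_plus :
    spinMatrix N 2 * spinPlus N - spinPlus N * spinMatrix N 2 = spinPlus N := by
  ext i j
  rw [spinMatrix_two, Matrix.sub_apply, diagonal_mul, mul_diagonal]
  simp only [spinPlus, of_apply]
  split_ifs with h
  · rw [magn_succ N h]; push_cast; ring
  · simp

theorem commutator_two_minus :
    spinMatrix N 2 * spinMinus N - spinMinus N * spinMatrix N 2 = -spinMinus N := by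
  ext i j
  rw [spinMatrix_two, Matrix.sub_apply, diagonal_mul, mul_diagonal, Matrix.neg_apply]
  simp only [spinMinus, of_apply]
  split_ifs with h
  · rw [magn_succ N h]; push_cast; ring
  · simp

theorem commutator_plus_minus :
    spinPlus N * spinMinus N - spinMinus N * spinPlus N = (2 : ℂ) • spinMatrix N 2 := by
  rw [spinPlus_mul_spinMinus, spinMinus_mul_spinPlus, diagonal_sub, spinMatrix_two,
    ← diagonal_smul]
  congr 1
  funext j
  simp only [Pi.smul_apply, smul_eq_mul]
  push_cast; ring

/-- The spin commutation relations `[S⁽ᵃ⁾, S⁽ᵃ⁺¹⁾] = i S⁽ᵃ⁺²⁾`, with components modulo 3. -/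
theorem spin_commutator (a : Fin 3) :
    spinMatrix N a * spinMatrix N (a + 1) - spinMatrix N (a + 1) * spinMatrix N a =
      Complex.I • spinMatrix N (a + 2) := by
  have h1 := commutator_two_plus N
  have h2 := commutator_two_minus N
  have h3 := commutator_plus_minus N
  fin_cases a
  · change spinMatrix N 0 * spinMatrix N 1 - spinMatrix N 1 * spinMatrix N 0 =
      Complex.I • spinMatrix N 2
    have e : spinMatrix N 0 * spinMatrix N 1 - spinMatrix N 1 * spinMatrix N 0 =
      (Complex.I / 2) • (spinPlus N * spinMinus N - spinMinus N * spinPlus N) := by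
      rw [spinMatrix_zero, spinMatrix_one]
      simp only [smul_mul_assoc, mul_smul_comm, add_mul, mul_add, sub_mul, mul_sub]
      module
    rw [e, h3, smul_smul]
    congr 1; ring
  · change spinMatrix N 1 * spinMatrix N 2 - spinMatrix N 2 * spinMatrix N 1 =
      Complex.I • spinMatrix N 0
    have e : spinMatrix N 1 * spinMatrix N 2 - spinMatrix N 2 * spinMatrix N 1 =
      (Complex.I / 2) • ((spinMatrix N 2 * spinPlus N - spinPlus N * spinMatrix N 2) -
        (spinMatrix N 2 * spinMinus N - spinMinus N * spinMatrix N 2)) := by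
      rw [spinMatrix_one]
      simp only [smul_mul_assoc, mul_smul_comm, sub_mul, mul_sub]
      module
    rw [e, h1, h2, spinMatrix_zero]
    module
  · change spinMatrix N 2 * spinMatrix N 0 - spinMatrix N 0 * spinMatrix N 2 =
      Complex.I • spinMatrix N 1
    have e : spinMatrix N 2 * spinMatrix N 0 - spinMatrix N 0 * spinMatrix N 2 =
      (1 / 2 : ℂ) • ((spinMatrix N 2 * spinPlus N - spinPlus N * spinMatrix N 2) +
        (spinMatrix N 2 * spinMinus N - spinMinus N * spinMatrix N 2)) := by
      rw [spinMatrix_zero]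
      simp only [smul_mul_assoc, mul_smul_comm, add_mul, mul_add]
      module
    rw [e, h1, h2, spinMatrix_one, smul_smul]
    have : Complex.I * (-Complex.I / 2) = 1 / 2 := by
      have := Complex.I_mul_I
      linear_combination (-1 / 2 : ℂ) * this
    rw [this]
    module

theorem spin_casimir : ∑ a, spinMatrix N a * spinMatrix N a =
    ((spinValue N * (spinValue N + 1) : ℝ) : ℂ) • (1 : Matrix (Fin (N + 1)) (Fin (N + 1)) ℂ) := by
  have e : spinMatrix N 0 * spinMatrix N 0 + spinMatrix N 1 * spinMatrix N 1 =
      (1 / 2 : ℂ) • (spinPlus N * spinMinus N + spinMinus N * spinPlus N) := by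
    have hI : (-Complex.I / 2) * (-Complex.I / 2) = -1 / 4 := by
      have := Complex.I_mul_I
      linear_combination (1 / 4 : ℂ) * this
    rw [spinMatrix_zero, spinMatrix_one]
    simp only [smul_mul_smul_comm, hI, add_mul, mul_add, sub_mul, mul_sub]
    module
  rw [Fin.sum_univ_three, e, spinPlus_mul_spinMinus, spinMinus_mul_spinPlus, spinMatrix_two,
    diagonal_mul_diagonal, diagonal_add, ← diagonal_smul, diagonal_add, ← diagonal_one,
    ← diagonal_smul]
  congr 1
  funext j
  simp only [Pi.smul_apply, smul_eq_mul]
  push_cast; ring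

theorem spinMatrix_isHermitian (a : Fin 3) : (spinMatrix N a).IsHermitian := by
  have h1 : (spinPlus N)ᴴ = spinMinus N := (spinMinus_eq N).symm
  have h2 : (spinMinus N)ᴴ = spinPlus N := by rw [spinMinus_eq, conjTranspose_conjTranspose]
  unfold Matrix.IsHermitian
  fin_cases a
  · change (spinMatrix N 0)ᴴ = spinMatrix N 0
    rw [spinMatrix_zero, conjTranspose_smul, conjTranspose_add, h1, h2, add_comm (spinMinus N)]
    simp
  · change (spinMatrix N 1)ᴴ = spinMatrix N 1
    rw [spinMatrix_one, conjTranspose_smul, conjTranspose_sub, h1, h2]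
    simp only [Complex.star_def, map_div₀, map_neg, Complex.conj_I, Complex.conj_ofNat]
    module
  · change (spinMatrix N 2)ᴴ = spinMatrix N 2
    rw [spinMatrix_two, diagonal_conjTranspose]
    congr 1
    funext j
    simp

/-- The spin matrices, the second one multiplied by `i`, so that all entries are real. -/
noncomputable def realSpin : Fin 3 → Matrix (Fin (N + 1)) (Fin (N + 1)) ℂ :=
  ![spinMatrix N 0, Complex.I • spinMatrix N 1, spinMatrix N 2]

theorem realSpin_mem (a : Fin 3) : realSpin N a ∈ realMatrices (Fin (N + 1)) := by
  have h1 : spinPlus N ∈ realMatrices _ := by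
    rw [mem_realMatrices_iff]; intro i j
    simp only [spinPlus, of_apply]
    split_ifs <;> simp
  have h2 : spinMinus N ∈ realMatrices _ := by
    rw [mem_realMatrices_iff]; intro i j
    simp only [spinMinus, of_apply]
    split_ifs <;> simp
  fin_cases a
  · change (1 / 2 : ℂ) • (spinPlus N + spinMinus N) ∈ realMatrices _
    have := Subalgebra.smul_mem _ (add_mem h1 h2) (1 / 2 : ℝ)
    convert this using 1
    ext i j; simp [mul_add]
  · change Complex.I • spinMatrix N 1 ∈ realMatrices _
    have := Subalgebra.smul_mem _ (sub_mem h1 h2) (1 / 2 : ℝ)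
    convert this using 1
    have : Complex.I * (-Complex.I / 2) = 1 / 2 := by
      have := Complex.I_mul_I
      linear_combination (-1 / 2 : ℂ) * this
    rw [spinMatrix_one, smul_smul, this]
    ext i j; simp
  · change spinMatrix N 2 ∈ realMatrices _
    rw [mem_realMatrices_iff]; intro i j
    rw [spinMatrix_two, diagonal_apply]
    split_ifs <;> simp

theorem realSpin_conjTranspose (a : Fin 3) : (realSpin N a)ᴴ = realSpin N a ∨
    (a ≠ 2 ∧ (realSpin N a)ᴴ = -realSpin N a) := by
  fin_cases a
  · left; exact spinMatrix_isHermitian N 0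
  · right
    refine ⟨by decide, ?_⟩
    change (Complex.I • spinMatrix N 1)ᴴ = -(Complex.I • spinMatrix N 1)
    rw [conjTranspose_smul, (spinMatrix_isHermitian N 1).eq]
    simp
  · left; exact spinMatrix_isHermitian N 2

end spin

/-! ### Matrices with nonnegative entries -/

section nonneg
variable {n : Type*}

/-- All entries of `M` are nonnegative real numbers. -/
def EntriesNonneg (M : Matrix n n ℂ) : Prop := ∀ i j, 0 ≤ (M i j).re ∧ (M i j).im = 0

theorem EntriesNonneg.mul [Fintype n] {M M' : Matrix n n ℂ} (h : EntriesNonneg M)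
    (h' : EntriesNonneg M') : EntriesNonneg (M * M') := by
  intro i j
  rw [Matrix.mul_apply, Complex.re_sum, Complex.im_sum]
  refine ⟨Finset.sum_nonneg fun k _ => ?_, Finset.sum_eq_zero fun k _ => ?_⟩
  · rw [Complex.mul_re, (h i k).2, (h' k j).2]
    simpa using mul_nonneg (h i k).1 (h' k j).1
  · rw [Complex.mul_im, (h i k).2, (h' k j).2]; simp

theorem EntriesNonneg.add {M M' : Matrix n n ℂ} (h : EntriesNonneg M) (h' : EntriesNonneg M') :
    EntriesNonneg (M + M') := fun i j => by
  simpa [(h i j).2, (h' i j).2] using add_nonneg (h i j).1 (h' i j).1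

theorem EntriesNonneg.smul {M : Matrix n n ℂ} (h : EntriesNonneg M) {a : ℝ} (ha : 0 ≤ a) :
    EntriesNonneg (a • M) := fun i j => by
  simpa [(h i j).2] using mul_nonneg ha (h i j).1

theorem EntriesNonneg.one [DecidableEq n] : EntriesNonneg (1 : Matrix n n ℂ) := fun i j => by
  by_cases h : i = j <;> simp [h, Matrix.one_apply]

theorem EntriesNonneg.trace_mul_re [Fintype n] {M M' : Matrix n n ℂ} (h : EntriesNonneg M)
    (h' : EntriesNonneg M') : 0 ≤ (M * M').trace.re := by
  rw [Matrix.trace, Complex.re_sum]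
  exact Finset.sum_nonneg fun i _ => ((h.mul h') i i).1

variable [Fintype n] [DecidableEq n]

theorem EntriesNonneg.pow {M : Matrix n n ℂ} (h : EntriesNonneg M) (k : ℕ) :
    EntriesNonneg (M ^ k) := by
  induction k with
  | zero => rw [pow_zero]; exact EntriesNonneg.one
  | succ k ih => rw [pow_succ]; exact ih.mul h

/-- The exponential of a real matrix with nonnegative off-diagonal entries has nonnegative
entries. -/
theorem EntriesNonneg.exp [Nonempty n] {E : Matrix n n ℂ} (hre : E ∈ realMatrices n)
    (hoff : ∀ i j, i ≠ j → 0 ≤ (E i j).re) : EntriesNonneg (exp E) := by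
  have hlim := tendsto_one_add_smul_pow_exp (tendsto_const_nhds (x := E) (f := (atTop : Filter ℕ)))
  have hev : ∀ᶠ k : ℕ in atTop, EntriesNonneg ((1 + (k : ℝ)⁻¹ • E) ^ k) := by
    have hdiag : ∀ i, ∀ᶠ k : ℕ in atTop, 0 ≤ 1 + (k : ℝ)⁻¹ * (E i i).re := by
      intro i
      have : Tendsto (fun k : ℕ => 1 + (k : ℝ)⁻¹ * (E i i).re) atTop (𝓝 (1 + 0 * (E i i).re)) :=
        ((tendsto_inv_atTop_zero.comp tendsto_natCast_atTop_atTop).mul_const _).const_add _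
      rw [zero_mul, add_zero] at this
      exact (this.eventually (lt_mem_nhds zero_lt_one)).mono fun k hk => hk.le
    filter_upwards [eventually_all.2 hdiag] with k hk
    refine EntriesNonneg.pow (fun i j => ⟨?_, ?_⟩) k
    · by_cases hij : i = j
      · subst hij; simpa using hk i
      · simpa [Matrix.one_apply, hij] using
          mul_nonneg (inv_nonneg.2 (Nat.cast_nonneg (α := ℝ) k)) (hoff i j hij)
    · have := mem_realMatrices_iff.1 hre i j
      by_cases hij : i = j
      · subst hij; simp [this]
      · simp [hij, this]
  intro i j
  have hc : Tendsto (fun k : ℕ => ((1 + (k : ℝ)⁻¹ • E) ^ k) i j) atTop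
      (𝓝 (NormedSpace.exp E i j)) :=
    ((continuous_id.matrix_elem i j).tendsto _).comp hlim
  refine ⟨ge_of_tendsto ((Complex.continuous_re.tendsto _).comp hc)
    (hev.mono fun k hk => (hk i j).1), ?_⟩
  exact tendsto_nhds_unique ((Complex.continuous_im.tendsto _).comp hc)
    (tendsto_const_nhds.congr' (hev.mono fun k hk => (hk i j).2.symm))

end nonneg

/-! ### Correlation inequalities -/

section correlation
variable {Λ : Type*} [Fintype Λ] [DecidableEq Λ] (N : ℕ)

/-- The exponent `∑_{x,y} w_{xy} ∑_i J_i S_x⁽ⁱ⁾ S_y⁽ⁱ⁾` of the Gibbs operator, for spins on `Λ`. -/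
noncomputable def spinEnergy (w : Λ → Λ → ℝ) (J : Fin 3 → ℝ) :
    Matrix (Λ → Fin (N + 1)) (Λ → Fin (N + 1)) ℂ :=
  ∑ x, ∑ y, w x y • ∑ i, J i • (siteOp x (spinMatrix N i) * siteOp y (spinMatrix N i))

/-- The two-point function `Tr (S_x⁽ⁱ⁾ S_y⁽ⁱ⁾ e^{-βH})`, not normalised by the partition
function. -/
noncomputable def twoPoint (w : Λ → Λ → ℝ) (J : Fin 3 → ℝ) (i : Fin 3) (x y : Λ) : ℝ :=
  (siteOp x (spinMatrix N i) * siteOp y (spinMatrix N i) * exp (spinEnergy N w J)).trace.re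

variable {N}

theorem siteOp_entriesNonneg (x : Λ) {M : Matrix (Fin (N + 1)) (Fin (N + 1)) ℂ}
    (h : EntriesNonneg M) : EntriesNonneg (siteOp x M) := by
  intro σ τ
  rw [siteOp_apply]
  split_ifs
  · exact h _ _
  · simp

theorem spinPlus_entriesNonneg : EntriesNonneg (spinPlus N) := by
  intro i j
  simp only [spinPlus, of_apply]
  split_ifs <;> simp [Real.sqrt_nonneg]

theorem spinMinus_entriesNonneg : EntriesNonneg (spinMinus N) := by
  intro i j
  simp only [spinMinus, of_apply]
  split_ifs <;> simp [Real.sqrt_nonneg]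

/-- In terms of the ladder operators, `J₁ S⁽¹⁾S⁽¹⁾ + J₂ S⁽²⁾S⁽²⁾` has the coefficients
`(J₁ - J₂)/4` and `(J₁ + J₂)/4`. -/
theorem planar_coupling_eq (a b : ℝ) (x y : Λ) :
    a • (siteOp x (spinMatrix N 0) * siteOp y (spinMatrix N 0)) +
      b • (siteOp x (spinMatrix N 1) * siteOp y (spinMatrix N 1)) =
    ((a - b) / 4) • (siteOp x (spinPlus N) * siteOp y (spinPlus N) +
        siteOp x (spinMinus N) * siteOp y (spinMinus N)) +
      ((a + b) / 4) • (siteOp x (spinPlus N) * siteOp y (spinMinus N) +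
        siteOp x (spinMinus N) * siteOp y (spinPlus N)) := by
  have hI : (-Complex.I / 2) * (-Complex.I / 2) = ((-1 / 4 : ℝ) : ℂ) := by
    have := Complex.I_mul_I
    push_cast
    linear_combination (1 / 4 : ℂ) * this
  have h4 : (1 / 2 : ℂ) * (1 / 2) = ((1 / 4 : ℝ) : ℂ) := by push_cast; norm_num
  rw [spinMatrix_zero, spinMatrix_one]
  simp only [map_smul, map_add, map_sub, smul_mul_smul_comm, hI, h4, Complex.coe_smul, add_mul,
    mul_add, sub_mul, mul_sub]
  module

theorem planar_coupling_entriesNonneg {a b : ℝ} (hab : |b| ≤ a) (x y : Λ) :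
    EntriesNonneg (a • (siteOp x (spinMatrix N 0) * siteOp y (spinMatrix N 0)) +
      b • (siteOp x (spinMatrix N 1) * siteOp y (spinMatrix N 1))) := by
  rw [planar_coupling_eq]
  have h := abs_le.1 hab
  have p := fun x : Λ => siteOp_entriesNonneg x (spinPlus_entriesNonneg (N := N))
  have m := fun x : Λ => siteOp_entriesNonneg x (spinMinus_entriesNonneg (N := N))
  exact ((((p x).mul (p y)).add ((m x).mul (m y))).smul (by linarith)).add
    ((((p x).mul (m y)).add ((m x).mul (p y))).smul (by linarith))

theorem siteOp_spinMatrix_two (x : Λ) : siteOp x (spinMatrix N 2) =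
    diagonal fun σ : Λ → Fin (N + 1) => ((magn N (σ x) : ℝ) : ℂ) := by
  ext σ τ
  rw [siteOp_apply, spinMatrix_two, diagonal_apply, diagonal_apply]
  by_cases h : σ = τ
  · subst h; simp
  · rw [if_neg h]
    split_ifs with h1 h2
    · exact absurd (funext fun y => by
        by_cases hy : y = x
        · rw [hy]; exact h2
        · exact h1 y hy) h
    · rfl
    · rfl

/-- If `J₁ ≥ |J₂|`, the Gibbs operator has nonnegative entries in the basis in which `S⁽³⁾` is
diagonal. -/
theorem exp_spinEnergy_entriesNonneg {w : Λ → Λ → ℝ} (hw0 : ∀ x y, 0 ≤ w x y) {J : Fin 3 → ℝ}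
    (hJ : |J 1| ≤ J 0) : EntriesNonneg (exp (spinEnergy N w J)) := by
  have hE : spinEnergy N w J =
      (∑ x, ∑ y, w x y • (J 0 • (siteOp x (spinMatrix N 0) * siteOp y (spinMatrix N 0)) +
        J 1 • (siteOp x (spinMatrix N 1) * siteOp y (spinMatrix N 1)))) +
      ∑ x, ∑ y, (w x y * J 2) • (siteOp x (spinMatrix N 2) * siteOp y (spinMatrix N 2)) := by
    simp only [spinEnergy, Fin.sum_univ_three, smul_add, Finset.sum_add_distrib, smul_smul]
  set P := ∑ x, ∑ y, w x y • (J 0 • (siteOp x (spinMatrix N 0) * siteOp y (spinMatrix N 0)) +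
        J 1 • (siteOp x (spinMatrix N 1) * siteOp y (spinMatrix N 1))) with hP
  set D := ∑ x, ∑ y, (w x y * J 2) •
    (siteOp x (spinMatrix N 2) * siteOp y (spinMatrix N 2)) with hD
  have hPn : EntriesNonneg P := by
    intro σ τ
    simp only [hP, Matrix.sum_apply, Complex.re_sum, Complex.im_sum]
    have := fun x y => (planar_coupling_entriesNonneg (N := N) hJ x y).smul (hw0 x y) σ τ
    exact ⟨Finset.sum_nonneg fun x _ => Finset.sum_nonneg fun y _ => (this x y).1,
      Finset.sum_eq_zero fun x _ => Finset.sum_eq_zero fun y _ => (this x y).2⟩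
  have h2 := realSpin_mem N 2
  have hDr : D ∈ realMatrices _ := sum_mem fun x _ => sum_mem fun y _ =>
    Subalgebra.smul_mem _ (mul_mem (siteOp_mem_realMatrices x h2) (siteOp_mem_realMatrices y h2)) _
  have hDd : ∀ σ τ, σ ≠ τ → D σ τ = 0 := by
    intro σ τ hst
    simp [hD, Matrix.sum_apply, siteOp_spinMatrix_two, diagonal_mul_diagonal,
      diagonal_apply_ne _ hst]
  rw [hE]
  refine EntriesNonneg.exp (add_mem ?_ hDr) fun σ τ hst => ?_
  · rw [mem_realMatrices_iff]; exact fun σ τ => (hPn σ τ).2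
  · rw [Matrix.add_apply, hDd σ τ hst, add_zero]; exact (hPn σ τ).1

/-- If `J₁ ≥ |J₂|` then `|⟨S_x⁽²⁾ S_y⁽²⁾⟩| ≤ ⟨S_x⁽¹⁾ S_y⁽¹⁾⟩`. -/
theorem abs_twoPoint_one_le {w : Λ → Λ → ℝ} (hw0 : ∀ x y, 0 ≤ w x y) {J : Fin 3 → ℝ}
    (hJ : |J 1| ≤ J 0) (x y : Λ) : |twoPoint N w J 1 x y| ≤ twoPoint N w J 0 x y := by
  have h := exp_spinEnergy_entriesNonneg (N := N) hw0 hJ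
  have h1 := (planar_coupling_entriesNonneg (N := N) (a := 1) (b := 1) (by simp) x y).trace_mul_re h
  have h2 := (planar_coupling_entriesNonneg (N := N) (a := 1) (b := -1)
    (by simp) x y).trace_mul_re h
  simp only [one_smul, neg_smul, add_mul, neg_mul, trace_add, trace_neg, Complex.add_re,
    Complex.neg_re] at h1 h2
  rw [abs_le]
  unfold twoPoint
  constructor <;> linarith

/-! ### Rotations of the spins -/

/-- If `ad A` acts on `span (X, Y)` as the generator of rotations, conjugation by `exp (-π A / 2)`
is the rotation by a right angle. -/
theorem exp_conj_of_commutator {n : Type*} [Fintype n] [DecidableEq n] {A X Y : Matrix n n ℂ}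
    (h1 : A * X - X * A = -Y) (h2 : A * Y - Y * A = X) :
    exp (-(Real.pi / 2) • A) * Y * exp ((Real.pi / 2) • A) = -X := by
  let F : ℝ → Matrix n n ℂ := fun θ =>
    exp (-θ • A) * (Real.cos θ • X - Real.sin θ • Y) * exp (θ • A)
  have hd : ∀ θ : ℝ, HasDerivAt F 0 θ := by
    intro θ
    have d1 : HasDerivAt (fun θ : ℝ => exp (-θ • A)) (-(exp (-θ • A) * A)) θ := by
      have := (hasDerivAt_exp_smul_const (𝕂 := ℝ) A (-θ)).scomp θ (hasDerivAt_neg θ)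
      rw [neg_one_smul] at this
      exact this
    have d2 : HasDerivAt (fun θ : ℝ => exp (θ • A)) (A * exp (θ • A)) θ :=
      hasDerivAt_exp_smul_const' (𝕂 := ℝ) A θ
    have d3 : HasDerivAt (fun θ : ℝ => Real.cos θ • X - Real.sin θ • Y)
        (-Real.sin θ • X - Real.cos θ • Y) θ :=
      ((Real.hasDerivAt_cos θ).smul_const X).sub ((Real.hasDerivAt_sin θ).smul_const Y)
    refine ((d1.mul d3).mul d2).congr_deriv ?_
    have e : -(exp (-θ • A) * A) * (Real.cos θ • X - Real.sin θ • Y) +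
        exp (-θ • A) * (-Real.sin θ • X - Real.cos θ • Y) =
        -(exp (-θ • A) * (Real.cos θ • X - Real.sin θ • Y) * A) := by
      have hX : -Y = A * X - X * A := h1.symm
      have hY : X = A * Y - Y * A := h2.symm
      have : (-Real.sin θ • X - Real.cos θ • Y : Matrix n n ℂ) =
          A * (Real.cos θ • X - Real.sin θ • Y) - (Real.cos θ • X - Real.sin θ • Y) * A := by
        calc (-Real.sin θ • X - Real.cos θ • Y : Matrix n n ℂ)
            = Real.cos θ • (-Y) - Real.sin θ • X := by module
          _ = Real.cos θ • (A * X - X * A) - Real.sin θ • (A * Y - Y * A) := by rw [h1, h2]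
          _ = _ := by
            simp only [mul_sub, sub_mul, mul_smul_comm, smul_mul_assoc, smul_sub]
            abel
      rw [this]
      generalize Real.cos θ • X - Real.sin θ • Y = P
      noncomm_ring
    change (_ + _) * _ + exp (-θ • A) * (Real.cos θ • X - Real.sin θ • Y) * (A * exp (θ • A)) = 0
    rw [e]
    noncomm_ring
  have hconst := is_const_of_deriv_eq_zero (fun θ => (hd θ).differentiableAt)
    (fun θ => (hd θ).deriv) (Real.pi / 2) 0
  simp only [F, Real.cos_pi_div_two, Real.sin_pi_div_two, Real.cos_zero, Real.sin_zero, zero_smul,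
    one_smul, neg_zero, exp_zero, one_mul, mul_one, zero_sub, sub_zero, mul_neg, neg_mul] at hconst
  rw [← hconst, neg_neg]

/-- Rotating all spins by a right angle about one axis interchanges the couplings of the two other
axes. -/
theorem twoPoint_rotate (w : Λ → Λ → ℝ) (J J' : Fin 3 → ℝ) (a : Fin 3) (h0 : J' a = J a)
    (h1 : J' (a + 1) = J (a + 2)) (h2 : J' (a + 2) = J (a + 1)) (x y : Λ) :
    twoPoint N w J a x y = twoPoint N w J' a x y ∧
      twoPoint N w J (a + 1) x y = twoPoint N w J' (a + 2) x y ∧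
      twoPoint N w J (a + 2) x y = twoPoint N w J' (a + 1) x y := by
  let S : Fin 3 → Λ → Matrix (Λ → Fin (N + 1)) (Λ → Fin (N + 1)) ℂ :=
    fun i x => siteOp x (spinMatrix N i)
  let A : Matrix (Λ → Fin (N + 1)) (Λ → Fin (N + 1)) ℂ := Complex.I • ∑ x, S a x
  let U := exp (-(Real.pi / 2) • A)
  let V := exp ((Real.pi / 2) • A)
  have hVU : V * U = 1 := by
    rw [← Matrix.exp_add_of_commute _ _ (((Commute.refl A).smul_left _).smul_right _), ← add_smul]
    simp
  have hcomm : ∀ (M : Matrix (Fin (N + 1)) (Fin (N + 1)) ℂ) (x : Λ),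
      A * siteOp x M - siteOp x M * A =
        siteOp x (Complex.I • (spinMatrix N a * M - M * spinMatrix N a)) := by
    intro M x
    simp only [A, smul_mul_assoc, mul_smul_comm, Finset.sum_mul, Finset.mul_sum, ← smul_sub,
      ← Finset.sum_sub_distrib]
    rw [Finset.sum_eq_single x]
    · simp [S]
    · intro z _ hz
      rw [sub_eq_zero]; exact siteOp_commute hz _ _
    · simp
  have c1 : ∀ x, A * S (a + 1) x - S (a + 1) x * A = -S (a + 2) x := by
    intro x
    rw [hcomm, spin_commutator, smul_smul, Complex.I_mul_I, neg_one_smul, map_neg]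
  have c2 : ∀ x, A * S (a + 2) x - S (a + 2) x * A = S (a + 1) x := by
    intro x
    have h := spin_commutator N (a + 2)
    have e1 : a + 2 + 1 = a := by fin_cases a <;> rfl
    have e2 : a + 2 + 2 = a + 1 := by fin_cases a <;> rfl
    rw [e1, e2] at h
    rw [hcomm, ← neg_sub, h, smul_neg, smul_smul, Complex.I_mul_I, neg_one_smul, neg_neg]
  have r2 : ∀ x, U * S (a + 2) x * V = -S (a + 1) x := fun x => exp_conj_of_commutator (c1 x) (c2 x)
  have r1 : ∀ x, U * S (a + 1) x * V = S (a + 2) x := fun x => by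
    have := exp_conj_of_commutator (A := A) (X := S (a + 2) x) (Y := -S (a + 1) x)
      (by rw [neg_neg]; exact c2 x) (by
        have := c1 x
        rw [mul_neg, neg_mul, ← neg_sub', this, neg_neg])
    rw [mul_neg, neg_mul] at this
    exact neg_injective this
  have r0 : ∀ x, U * S a x * V = S a x := fun x => by
    have hc : Commute A (S a x) := by
      have := hcomm (spinMatrix N a) x
      rw [sub_self, smul_zero, map_zero] at this
      exact sub_eq_zero.1 this
    have hcV : Commute V (S a x) := by
      have : Commute ((Real.pi / 2) • A) (S a x) := hc.smul_left _
      exact this.exp_left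
    rw [mul_assoc, ← hcV.eq, ← mul_assoc, mul_eq_one_comm.1 hVU, one_mul]
  clear_value U V
  have hmul : ∀ X Y, U * (X * Y) * V = (U * X * V) * (U * Y * V) := fun X Y => by
    simp only [mul_assoc]; rw [← mul_assoc V U, hVU, one_mul]
  have q0 : ∀ x y, U * (S a x * S a y) * V = S a x * S a y := fun x y => by rw [hmul, r0, r0]
  have q1 : ∀ x y, U * (S (a + 1) x * S (a + 1) y) * V = S (a + 2) x * S (a + 2) y := fun x y => by
    rw [hmul, r1, r1]
  have q2 : ∀ x y, U * (S (a + 2) x * S (a + 2) y) * V = S (a + 1) x * S (a + 1) y := fun x y => by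
    rw [hmul, r2, r2, neg_mul_neg]
  have hsum : ∀ f : Fin 3 → Matrix (Λ → Fin (N + 1)) (Λ → Fin (N + 1)) ℂ,
      ∑ i, f i = f a + f (a + 1) + f (a + 2) := by
    intro f
    rw [Fin.sum_univ_three]
    fin_cases a
    · rfl
    · change f 0 + f 1 + f 2 = f 1 + f 2 + f 0; abel
    · change f 0 + f 1 + f 2 = f 2 + f 0 + f 1; abel
  have hE : U * spinEnergy N w J * V = spinEnergy N w J' := by
    unfold spinEnergy
    simp only [Finset.mul_sum, Finset.sum_mul, mul_smul_comm, smul_mul_assoc]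
    refine Finset.sum_congr rfl fun x _ => Finset.sum_congr rfl fun y _ => ?_
    congr 1
    rw [hsum, hsum, h0, h1, h2]
    have p0 : U * (siteOp x (spinMatrix N a) * siteOp y (spinMatrix N a)) * V = _ := q0 x y
    have p1 : U * (siteOp x (spinMatrix N (a + 1)) * siteOp y (spinMatrix N (a + 1))) * V = _ :=
      q1 x y
    have p2 : U * (siteOp x (spinMatrix N (a + 2)) * siteOp y (spinMatrix N (a + 2))) * V = _ :=
      q2 x y
    rw [p0, p1, p2]
    simp only [S]
    abel
  have htr : ∀ X, (X * exp (spinEnergy N w J)).trace =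
      (U * X * V * exp (spinEnergy N w J')).trace := by
    intro X
    rw [← hE, exp_conj_of_mul_eq_one hVU, ← hmul, Matrix.trace_mul_comm (U * _) V, ← mul_assoc, hVU,
      one_mul]
  refine ⟨?_, ?_, ?_⟩ <;> unfold twoPoint <;> rw [htr]
  · rw [show U * (siteOp x (spinMatrix N a) * siteOp y (spinMatrix N a)) * V = _ from q0 x y]
  · rw [show U * (siteOp x (spinMatrix N (a + 1)) * siteOp y (spinMatrix N (a + 1))) * V = _ from
      q1 x y]
  · rw [show U * (siteOp x (spinMatrix N (a + 2)) * siteOp y (spinMatrix N (a + 2))) * V = _ from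
      q2 x y]

/-- If `J₃ ≥ |J₁|` then `|⟨S_x⁽¹⁾ S_y⁽¹⁾⟩| ≤ ⟨S_x⁽³⁾ S_y⁽³⁾⟩`: permute the axes. -/
theorem abs_twoPoint_zero_le {w : Λ → Λ → ℝ} (hw0 : ∀ x y, 0 ≤ w x y) {J : Fin 3 → ℝ}
    (hJ : |J 0| ≤ J 2) (x y : Λ) : |twoPoint N w J 0 x y| ≤ twoPoint N w J 2 x y := by
  obtain ⟨-, e1, e2⟩ := twoPoint_rotate (N := N) w J ![J 2, J 1, J 0] 1 rfl rfl rfl x y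
  obtain ⟨e3, -, e4⟩ := twoPoint_rotate (N := N) w ![J 2, J 1, J 0] ![J 2, J 0, J 1] 0 rfl rfl rfl
    x y
  have h := abs_twoPoint_one_le (N := N) (J := ![J 2, J 0, J 1]) hw0 hJ x y
  have e1' : twoPoint N w J 2 x y = twoPoint N w ![J 2, J 1, J 0] 0 x y := e1
  have e2' : twoPoint N w J 0 x y = twoPoint N w ![J 2, J 1, J 0] 2 x y := e2
  have e3' : twoPoint N w ![J 2, J 1, J 0] 2 x y = twoPoint N w ![J 2, J 0, J 1] 1 x y := e4
  rw [e1', e2', e3', e3]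
  exact h

end correlation

/-! ### The double commutator -/

section commutator
variable {Λ : Type*} [Fintype Λ] [DecidableEq Λ] {N : ℕ}

theorem spinEnergy_isHermitian {w : Λ → Λ → ℝ} (hw : ∀ x y, w x y = w y x) (J : Fin 3 → ℝ) :
    (spinEnergy N w J).IsHermitian := by
  rw [Matrix.IsHermitian, spinEnergy]
  simp only [conjTranspose_sum, conjTranspose_smul, conjTranspose_mul, siteOp_conjTranspose,
    (spinMatrix_isHermitian N _).eq, star_trivial]
  rw [Finset.sum_comm]
  exact Finset.sum_congr rfl fun x _ => Finset.sum_congr rfl fun y _ => by rw [hw]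

/-- The mode `∑_x h_x S_x⁽³⁾`. -/
noncomputable def mode (N : ℕ) (h : Λ → ℝ) : Matrix (Λ → Fin (N + 1)) (Λ → Fin (N + 1)) ℂ :=
  ∑ x, h x • siteOp x (spinMatrix N 2)

theorem mode_isHermitian (h : Λ → ℝ) : (mode N h).IsHermitian := by
  rw [Matrix.IsHermitian, mode]
  simp only [conjTranspose_sum, conjTranspose_smul, siteOp_conjTranspose,
    (spinMatrix_isHermitian N _).eq, star_trivial]

theorem mode_commutator (h : Λ → ℝ) (x : Λ) (M : Matrix (Fin (N + 1)) (Fin (N + 1)) ℂ) :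
    mode N h * siteOp x M - siteOp x M * mode N h =
      h x • siteOp x (spinMatrix N 2 * M - M * spinMatrix N 2) := by
  simp only [mode, smul_mul_assoc, mul_smul_comm, Finset.sum_mul, Finset.mul_sum,
    ← Finset.sum_sub_distrib, ← smul_sub]
  rw [Finset.sum_eq_single x]
  · simp
  · intro z _ hz
    rw [sub_eq_zero.2 (siteOp_commute hz _ _), smul_zero]
  · simp

theorem mode_commutator_zero (h : Λ → ℝ) (x : Λ) :
    mode N h * siteOp x (spinMatrix N 0) - siteOp x (spinMatrix N 0) * mode N h =
      (Complex.I * h x) • siteOp x (spinMatrix N 1) := by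
  have := spin_commutator N 2
  rw [mode_commutator, show spinMatrix N 2 * spinMatrix N 0 - spinMatrix N 0 * spinMatrix N 2 =
    Complex.I • spinMatrix N 1 from this, map_smul, mul_comm, mul_smul, Complex.coe_smul]

theorem mode_commutator_one (h : Λ → ℝ) (x : Λ) :
    mode N h * siteOp x (spinMatrix N 1) - siteOp x (spinMatrix N 1) * mode N h =
      (-Complex.I * h x) • siteOp x (spinMatrix N 0) := by
  have := spin_commutator N 1
  rw [mode_commutator, ← neg_sub, show spinMatrix N 1 * spinMatrix N 2 -
    spinMatrix N 2 * spinMatrix N 1 = Complex.I • spinMatrix N 0 from this, map_neg, map_smul,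
    ← neg_smul, mul_comm, mul_smul, Complex.coe_smul]

theorem mode_commutator_two (h : Λ → ℝ) (x : Λ) :
    mode N h * siteOp x (spinMatrix N 2) - siteOp x (spinMatrix N 2) * mode N h = 0 := by
  rw [mode_commutator, sub_self, map_zero, smul_zero]

/-- The double commutator `[A, [A, X]]`. -/
def doubleComm {n : Type*} [Fintype n] (A : Matrix n n ℂ) : Matrix n n ℂ →ₗ[ℝ] Matrix n n ℂ where
  toFun X := A * A * X + X * A * A - 2 • (A * X * A)
  map_add' X Y := by simp only [mul_add, add_mul, smul_add]; abel
  map_smul' a X := by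
    simp only [mul_smul_comm, smul_mul_assoc, RingHom.id_apply, smul_sub, smul_add]
    rw [smul_comm]

theorem doubleComm_mul {n : Type*} [Fintype n] (A X Y X' Y' X'' Y'' : Matrix n n ℂ)
    (hX : A * X - X * A = X') (hY : A * Y - Y * A = Y') (hX' : A * X' - X' * A = X'')
    (hY' : A * Y' - Y' * A = Y'') :
    doubleComm A (X * Y) = X'' * Y + 2 • (X' * Y') + X * Y'' := by
  change A * A * (X * Y) + X * Y * A * A - 2 • (A * (X * Y) * A) = _
  subst hX' hY' hX hY
  noncomm_ring

theorem doubleComm_mode_zero (h : Λ → ℝ) (x y : Λ) :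
    doubleComm (mode N h) (siteOp x (spinMatrix N 0) * siteOp y (spinMatrix N 0)) =
      (h x ^ 2 + h y ^ 2) • (siteOp x (spinMatrix N 0) * siteOp y (spinMatrix N 0)) -
      (2 * h x * h y) • (siteOp x (spinMatrix N 1) * siteOp y (spinMatrix N 1)) := by
  have h2 : ∀ x : Λ, mode N h * ((Complex.I * h x) • siteOp x (spinMatrix N 1)) -
      ((Complex.I * h x) • siteOp x (spinMatrix N 1)) * mode N h =
      (h x ^ 2) • siteOp x (spinMatrix N 0) := by
    intro x
    rw [mul_smul_comm, smul_mul_assoc, ← smul_sub, mode_commutator_one, smul_smul,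
      ← Complex.coe_smul]
    congr 1
    have := Complex.I_mul_I
    push_cast
    linear_combination (-(h x : ℂ) ^ 2) * this
  rw [doubleComm_mul _ _ _ _ _ _ _ (mode_commutator_zero h x) (mode_commutator_zero h y)
    (h2 x) (h2 y), smul_mul_smul_comm]
  have : (Complex.I * h x * (Complex.I * h y)) = ((-(h x * h y) : ℝ) : ℂ) := by
    have := Complex.I_mul_I
    push_cast
    linear_combination ((h x : ℂ) * h y) * this
  rw [this, Complex.coe_smul, smul_mul_assoc, mul_smul_comm]
  module

theorem doubleComm_mode_one (h : Λ → ℝ) (x y : Λ) :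
    doubleComm (mode N h) (siteOp x (spinMatrix N 1) * siteOp y (spinMatrix N 1)) =
      (h x ^ 2 + h y ^ 2) • (siteOp x (spinMatrix N 1) * siteOp y (spinMatrix N 1)) -
      (2 * h x * h y) • (siteOp x (spinMatrix N 0) * siteOp y (spinMatrix N 0)) := by
  have h2 : ∀ x : Λ, mode N h * ((-Complex.I * h x) • siteOp x (spinMatrix N 0)) -
      ((-Complex.I * h x) • siteOp x (spinMatrix N 0)) * mode N h =
      (h x ^ 2) • siteOp x (spinMatrix N 1) := by
    intro x
    rw [mul_smul_comm, smul_mul_assoc, ← smul_sub, mode_commutator_zero, smul_smul,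
      ← Complex.coe_smul]
    congr 1
    have := Complex.I_mul_I
    push_cast
    linear_combination (-(h x : ℂ) ^ 2) * this
  rw [doubleComm_mul _ _ _ _ _ _ _ (mode_commutator_one h x) (mode_commutator_one h y)
    (h2 x) (h2 y), smul_mul_smul_comm]
  have : (-Complex.I * h x * (-Complex.I * h y)) = ((-(h x * h y) : ℝ) : ℂ) := by
    have := Complex.I_mul_I
    push_cast
    linear_combination ((h x : ℂ) * h y) * this
  rw [this, Complex.coe_smul, smul_mul_assoc, mul_smul_comm]
  module

theorem doubleComm_mode_two (h : Λ → ℝ) (x y : Λ) :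
    doubleComm (mode N h) (siteOp x (spinMatrix N 2) * siteOp y (spinMatrix N 2)) = 0 := by
  rw [doubleComm_mul _ _ _ _ _ _ _ (mode_commutator_two h x) (mode_commutator_two h y)
    (by rw [mul_zero, zero_mul, sub_zero]) (by rw [mul_zero, zero_mul, sub_zero])]
  simp

/-- The double commutator of a mode of `S⁽³⁾` with the energy turns `S_x⁽¹⁾S_y⁽¹⁾` and
`S_x⁽²⁾S_y⁽²⁾` into combinations of each other. -/
theorem trace_doubleComm_mode (w : Λ → Λ → ℝ) (J : Fin 3 → ℝ) (h : Λ → ℝ) :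
    (doubleComm (mode N h) (spinEnergy N w J) * exp (spinEnergy N w J)).trace.re =
      ∑ x, ∑ y, w x y *
        ((h x ^ 2 + h y ^ 2) * (J 0 * twoPoint N w J 0 x y + J 1 * twoPoint N w J 1 x y) -
        2 * (h x * h y) * (J 0 * twoPoint N w J 1 x y + J 1 * twoPoint N w J 0 x y)) := by
  have hE : doubleComm (mode N h) (spinEnergy N w J) = ∑ x, ∑ y, w x y • (
      J 0 • ((h x ^ 2 + h y ^ 2) • (siteOp x (spinMatrix N 0) * siteOp y (spinMatrix N 0)) -
      (2 * h x * h y) • (siteOp x (spinMatrix N 1) * siteOp y (spinMatrix N 1))) +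
      J 1 • ((h x ^ 2 + h y ^ 2) • (siteOp x (spinMatrix N 1) * siteOp y (spinMatrix N 1)) -
      (2 * h x * h y) • (siteOp x (spinMatrix N 0) * siteOp y (spinMatrix N 0)))) := by
    rw [spinEnergy]
    simp only [map_sum, map_smul, Fin.sum_univ_three, map_add, doubleComm_mode_zero,
      doubleComm_mode_one, doubleComm_mode_two, smul_zero, add_zero]
  rw [hE]
  simp only [Finset.sum_mul, trace_sum, Complex.re_sum]
  refine Finset.sum_congr rfl fun x _ => Finset.sum_congr rfl fun y _ => ?_
  simp only [smul_mul_assoc, add_mul, sub_mul, trace_smul, trace_add, trace_sub, Complex.add_re,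
    Complex.sub_re, Complex.real_smul, Complex.re_ofReal_mul, twoPoint]
  ring

/-! ### Sums of two-point functions and symmetries -/

theorem trace_mode_sq (w : Λ → Λ → ℝ) (J : Fin 3 → ℝ) (h : Λ → ℝ) :
    (mode N h * mode N h * exp (spinEnergy N w J)).trace.re =
      ∑ x, ∑ y, h x * h y * twoPoint N w J 2 x y := by
  rw [mode, Finset.sum_mul_sum]
  simp only [Finset.sum_mul, trace_sum, Complex.re_sum]
  refine Finset.sum_congr rfl fun x _ => Finset.sum_congr rfl fun y _ => ?_
  rw [smul_mul_smul_comm, smul_mul_assoc, trace_smul, Complex.real_smul, Complex.re_ofReal_mul]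
  rfl

theorem twoPoint_comm (w : Λ → Λ → ℝ) (J : Fin 3 → ℝ) (i : Fin 3) (x y : Λ) :
    twoPoint N w J i x y = twoPoint N w J i y x := by
  by_cases h : x = y
  · rw [h]
  · unfold twoPoint; rw [(siteOp_commute h _ _).eq]

/-- A permutation of the sites that preserves the couplings is a symmetry of the Gibbs state. -/
theorem twoPoint_perm (w : Λ → Λ → ℝ) (J : Fin 3 → ℝ) (i : Fin 3) (π : Λ ≃ Λ)
    (hπ : ∀ x y, w (π x) (π y) = w x y) (x y : Λ) :
    twoPoint N w J i (π x) (π y) = twoPoint N w J i x y := by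
  have hE : relabel (sitePerm (Fin (N + 1)) π) (spinEnergy N w J) = spinEnergy N w J := by
    unfold spinEnergy
    simp only [map_sum, relabel_real_smul, map_mul, relabel_sitePerm_siteOp]
    conv_rhs => rw [← π.sum_comp]
    refine Finset.sum_congr rfl fun x _ => ?_
    conv_rhs => rw [← π.sum_comp]
    exact Finset.sum_congr rfl fun y _ => by rw [hπ]
  unfold twoPoint
  rw [← relabel_sitePerm_siteOp π x, ← relabel_sitePerm_siteOp π y, ← map_mul]
  conv_lhs => rw [← hE, exp_relabel, ← map_mul, trace_relabel]

/-- The Casimir relation `∑_i (S_x⁽ⁱ⁾)² = S(S+1)`. -/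
theorem sum_twoPoint_self (w : Λ → Λ → ℝ) (J : Fin 3 → ℝ) (x : Λ) :
    ∑ i, twoPoint N w J i x x =
      spinValue N * (spinValue N + 1) * (exp (spinEnergy N w J)).trace.re := by
  unfold twoPoint
  simp only [← map_mul]
  rw [← Complex.re_sum, ← trace_sum, ← Finset.sum_mul, ← map_sum, spin_casimir, map_smul, map_one,
    smul_mul_assoc, one_mul, trace_smul, smul_eq_mul, Complex.re_ofReal_mul]

/-- Replacing `S⁽²⁾` by the real matrix `i S⁽²⁾` changes the sign of `J₂`, so that all three
couplings are nonnegative when `J₂ ≤ 0`. -/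
theorem spinEnergy_eq_fieldEnergy (w : Λ → Λ → ℝ) (W : ℝ) (J : Fin 3 → ℝ) :
    spinEnergy N w J = fieldEnergy w W ![J 0, -J 1, J 2] (realSpin N) 0 := by
  have h0 : ∀ i, shifted (realSpin N) 0 i = realSpin N i := fun i => by simp [shifted]
  unfold fieldEnergy spinEnergy
  simp only [Pi.zero_apply, h0, sub_self, map_zero, Finset.sum_const_zero, smul_zero, sub_zero]
  refine Finset.sum_congr rfl fun x _ => Finset.sum_congr rfl fun y _ => ?_
  congr 1
  rw [Fin.sum_univ_three, Fin.sum_univ_three]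
  change _ = J 0 • (siteOp x (spinMatrix N 0) * siteOp y (spinMatrix N 0)) +
    (-J 1) • (siteOp x (Complex.I • spinMatrix N 1) * siteOp y (Complex.I • spinMatrix N 1)) +
    J 2 • (siteOp x (spinMatrix N 2) * siteOp y (spinMatrix N 2))
  rw [map_smul, map_smul, smul_mul_smul_comm, Complex.I_mul_I, neg_one_smul, smul_neg, neg_smul,
    neg_neg]

/-- Gaussian domination for the modes of `S⁽³⁾` that are eigenvectors of the lattice Laplacian. -/
theorem duhamel_mode_le {w : Λ → Λ → ℝ} {W : ℝ} (hw : ∀ x y, w x y = w y x)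
    (hw0 : ∀ x y, 0 ≤ w x y) (hW : ∀ x, ∑ y, w x y = W)
    (hrefl : ∀ x y, 0 < w x y → ReflectsBond w x y) {J : Fin 3 → ℝ} (h0 : 0 ≤ J 0) (h1 : J 1 ≤ 0)
    (h2 : J 2 = 1) {h : Λ → ℝ} {lam : ℝ} (hlam : 0 < lam)
    (hh : ∀ x, laplacian w W h x = lam * h x) :
    duhamel (spinEnergy N w J) (mode N h) ≤
      (∑ x, h x ^ 2) / (2 * lam) * (exp (spinEnergy N w J)).trace.re := by
  rw [spinEnergy_eq_fieldEnergy w W J]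
  refine duhamel_le_of_laplacian_eq (c := ![J 0, -J 1, J 2]) (r := realSpin N) hw hw0 hW ?_ h2
    (realSpin_mem N) (realSpin_conjTranspose N) hrefl hlam hh
  intro i
  fin_cases i
  · exact h0
  · exact neg_nonneg.2 h1
  · change 0 ≤ J 2; rw [h2]; exact zero_le_one

end commutator

/-! ### Fourier modes on the torus -/

section fourier
variable {d ℓ : ℕ}

/-- The phase `k · x` of the mode with momentum `k = (2π/ℓ) n`. -/
noncomputable def phase (n : Fin d → ℤ) (x : Box d ℓ) : ℝ := ∑ i, momentum ℓ n i * ((x i : ℕ) : ℝ)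

/-- The Fourier transform of an even function on the torus. -/
noncomputable def cosTransform (F : Box d ℓ → ℝ) (n : Fin d → ℤ) : ℝ :=
  ∑ x, F x * Real.cos (phase n x)

theorem cosTransform_zero (F : Box d ℓ → ℝ) : cosTransform F 0 = ∑ x, F x := by
  simp [cosTransform, phase, momentum]

theorem card_box : (Fintype.card (Box d ℓ) : ℝ) = (ℓ : ℝ) ^ d := by
  simp

/-- `{-ℓ/2 + 1, …, ℓ/2}^d`, the labels of `Λ_ℓ^*`. -/
noncomputable def fullIndex (d ℓ : ℕ) : Finset (Fin d → ℤ) :=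
  Fintype.piFinset fun _ => Finset.Icc (-((ℓ : ℤ) / 2) + 1) ((ℓ : ℤ) / 2)

theorem mem_fullIndex {n : Fin d → ℤ} :
    n ∈ fullIndex d ℓ ↔ ∀ i, -((ℓ : ℤ) / 2) + 1 ≤ n i ∧ n i ≤ (ℓ : ℤ) / 2 := by
  simp [fullIndex]

theorem sum_cos_sq_add_sum_sin_sq (n : Fin d → ℤ) :
    ∑ x : Box d ℓ, Real.cos (phase n x) ^ 2 + ∑ x : Box d ℓ, Real.sin (phase n x) ^ 2 =
      (ℓ : ℝ) ^ d := by
  rw [← Finset.sum_add_distrib]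
  simp only [Real.cos_sq_add_sin_sq, Finset.sum_const, Finset.card_univ, nsmul_eq_mul, mul_one]
  exact card_box

theorem zero_mem_fullIndex (hℓ : 2 ≤ ℓ) : 0 ∈ fullIndex d ℓ := by
  rw [mem_fullIndex]; intro i
  simp only [Pi.zero_apply]
  omega

theorem sum_fullIndex (hℓ : 2 ≤ ℓ) (f : (Fin d → ℤ) → ℝ) :
    ∑ n ∈ fullIndex d ℓ, f n = f 0 + ∑ n ∈ dualIndex d ℓ, f n :=
  (Finset.add_sum_erase _ f (zero_mem_fullIndex hℓ)).symm

variable [NeZero ℓ]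

/-- The phase is additive modulo `2π`, although addition on the torus wraps around. -/
theorem phase_add (n : Fin d → ℤ) (x y : Box d ℓ) :
    (phase n (x + y) : Real.Angle) = phase n x + phase n y := by
  rw [← Real.Angle.coe_add, Real.Angle.angle_eq_iff_two_pi_dvd_sub]
  refine ⟨-∑ i, n i * ((((x i : ℕ) + (y i : ℕ)) / ℓ : ℕ) : ℤ), ?_⟩
  have hℓ : (ℓ : ℝ) ≠ 0 := by exact_mod_cast NeZero.ne ℓ
  have h : ∀ i, (((x + y) i : ℕ) : ℝ) =
      (x i : ℕ) + (y i : ℕ) - ℓ * ((((x i : ℕ) + (y i : ℕ)) / ℓ : ℕ) : ℝ) := by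
    intro i
    have := Nat.mod_add_div ((x i : ℕ) + (y i : ℕ)) ℓ
    rw [Pi.add_apply, Fin.val_add, eq_sub_iff_add_eq]
    exact_mod_cast this
  simp only [phase, h]
  generalize hq : (fun i => ((x i : ℕ) + (y i : ℕ)) / ℓ) = q
  simp only [fun i => congrFun hq i]
  push_cast
  rw [mul_neg, Finset.mul_sum, ← Finset.sum_neg_distrib, ← Finset.sum_add_distrib,
    ← Finset.sum_sub_distrib]
  refine Finset.sum_congr rfl fun i _ => ?_
  rw [momentum]
  field_simp
  ring

theorem phase_unitSite (hℓ : 2 ≤ ℓ) (n : Fin d → ℤ) (j : Fin d) :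
    phase n (unitSite d ℓ j) = momentum ℓ n j := by
  rw [phase, Finset.sum_eq_single j]
  · simp [unitSite, Nat.mod_eq_of_lt hℓ]
  · intro b _ hb
    simp [unitSite, hb]
  · simp

theorem phase_sub (n : Fin d → ℤ) (x y : Box d ℓ) :
    (phase n (x - y) : Real.Angle) = phase n x - phase n y := by
  rw [eq_sub_iff_add_eq, ← phase_add, sub_add_cancel]

theorem cos_phase_add (hℓ : 2 ≤ ℓ) (n : Fin d → ℤ) (x : Box d ℓ) (j : Fin d) :
    Real.cos (phase n (x + unitSite d ℓ j)) = Real.cos (phase n x + momentum ℓ n j) := by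
  rw [← Real.Angle.cos_coe, phase_add, ← Real.Angle.coe_add, Real.Angle.cos_coe, phase_unitSite hℓ]

theorem cos_phase_sub_unitSite (hℓ : 2 ≤ ℓ) (n : Fin d → ℤ) (x : Box d ℓ) (j : Fin d) :
    Real.cos (phase n (x - unitSite d ℓ j)) = Real.cos (phase n x - momentum ℓ n j) := by
  rw [← Real.Angle.cos_coe, phase_sub, ← Real.Angle.coe_sub, Real.Angle.cos_coe, phase_unitSite hℓ]

theorem sin_phase_add (hℓ : 2 ≤ ℓ) (n : Fin d → ℤ) (x : Box d ℓ) (j : Fin d) :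
    Real.sin (phase n (x + unitSite d ℓ j)) = Real.sin (phase n x + momentum ℓ n j) := by
  rw [← Real.Angle.sin_coe, phase_add, ← Real.Angle.coe_add, Real.Angle.sin_coe, phase_unitSite hℓ]

theorem sin_phase_sub_unitSite (hℓ : 2 ≤ ℓ) (n : Fin d → ℤ) (x : Box d ℓ) (j : Fin d) :
    Real.sin (phase n (x - unitSite d ℓ j)) = Real.sin (phase n x - momentum ℓ n j) := by
  rw [← Real.Angle.sin_coe, phase_sub, ← Real.Angle.coe_sub, Real.Angle.sin_coe, phase_unitSite hℓ]

theorem cos_phase_sub (n : Fin d → ℤ) (x y : Box d ℓ) :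
    Real.cos (phase n (y - x)) = Real.cos (phase n x) * Real.cos (phase n y) +
      Real.sin (phase n x) * Real.sin (phase n y) := by
  rw [← Real.Angle.cos_coe, phase_sub, ← Real.Angle.coe_sub, Real.Angle.cos_coe, Real.cos_sub]
  ring

theorem laplacian_smul_bondWeight (b : ℝ) (h : Box d ℓ → ℝ) (x : Box d ℓ) :
    laplacian (fun x y => b * bondWeight x y) (b * (2 * d)) h x =
      b * ∑ i, (2 * h x - (h (x - unitSite d ℓ i) + h (x + unitSite d ℓ i))) := by
  have := sum_bondWeight_mul x h
  simp only [laplacian, mul_assoc, ← Finset.mul_sum, this, Finset.sum_sub_distrib]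
  simp
  ring

/-- The dispersion relation `ε(k)` is the eigenvalue of the lattice Laplacian. -/
theorem laplacian_cos_phase (hℓ : 2 ≤ ℓ) (b : ℝ) (n : Fin d → ℤ) (x : Box d ℓ) :
    laplacian (fun x y => b * bondWeight x y) (b * (2 * d)) (fun x => Real.cos (phase n x)) x =
      b * eps (momentum ℓ n) * Real.cos (phase n x) := by
  rw [laplacian_smul_bondWeight, mul_assoc]
  congr 1
  rw [eps, mul_assoc, Finset.sum_mul, Finset.mul_sum]
  refine Finset.sum_congr rfl fun i _ => ?_
  rw [cos_phase_add hℓ, cos_phase_sub_unitSite hℓ, Real.cos_add, Real.cos_sub]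
  ring

theorem laplacian_sin_phase (hℓ : 2 ≤ ℓ) (b : ℝ) (n : Fin d → ℤ) (x : Box d ℓ) :
    laplacian (fun x y => b * bondWeight x y) (b * (2 * d)) (fun x => Real.sin (phase n x)) x =
      b * eps (momentum ℓ n) * Real.sin (phase n x) := by
  rw [laplacian_smul_bondWeight, mul_assoc]
  congr 1
  rw [eps, mul_assoc, Finset.sum_mul, Finset.mul_sum]
  refine Finset.sum_congr rfl fun i _ => ?_
  rw [sin_phase_add hℓ, sin_phase_sub_unitSite hℓ, Real.sin_add, Real.sin_sub]
  ring

theorem eps_pos {n : Fin d → ℤ} (hn : n ∈ dualIndex d ℓ) : 0 < eps (momentum ℓ n) := by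
  obtain ⟨hn0, hn⟩ := Finset.mem_erase.1 hn
  have hn := mem_fullIndex.1 hn
  obtain ⟨i, hi⟩ : ∃ i, n i ≠ 0 := by
    by_contra! h; exact hn0 (funext h)
  have hℓ : (0 : ℝ) < ℓ := by exact_mod_cast Nat.pos_of_ne_zero (NeZero.ne ℓ)
  refine mul_pos two_pos (Finset.sum_pos' (fun j _ => sub_nonneg.2 (Real.cos_le_one _))
    ⟨i, Finset.mem_univ _, sub_pos.2 (lt_of_le_of_ne (Real.cos_le_one _) fun h => ?_)⟩)
  obtain ⟨m, hm⟩ := (Real.cos_eq_one_iff _).1 h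
  rw [momentum] at hm
  have hm' : ((n i : ℤ) : ℝ) = m * ℓ := by
    have := Real.pi_pos
    field_simp at hm
    linarith
  have hm'' : n i = m * ℓ := by exact_mod_cast hm'
  obtain ⟨h1, h2⟩ := hn i
  have hℓ' : (0 : ℤ) < ℓ := by exact_mod_cast hℓ
  have hdiv := Int.mul_ediv_self_le (x := (ℓ : ℤ)) (k := 2) (by norm_num)
  have hm1 : m < 1 := by by_contra! hm1; nlinarith
  have hm2 : -1 < m := by by_contra! hm2; nlinarith
  have : m = 0 := by omega
  rw [this, zero_mul] at hm''
  exact hi hm''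

/-- The labels `-ℓ/2 + 1, …, ℓ/2` form a complete residue system modulo an even `ℓ`. -/
theorem sum_Icc_zpow (heven : Even ℓ) {ζ : ℂ} (h0 : ζ ≠ 0) (h1 : ζ ^ ℓ = 1) :
    ∑ m ∈ Finset.Icc (-((ℓ : ℤ) / 2) + 1) ((ℓ : ℤ) / 2), ζ ^ m = if ζ = 1 then (ℓ : ℂ) else 0 := by
  obtain ⟨m, rfl⟩ := heven
  have hm : ((m + m : ℕ) : ℤ) / 2 = m := by omega
  rw [hm]
  have : ∑ z ∈ Finset.Icc (-(m : ℤ) + 1) m, ζ ^ z =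
      ∑ k ∈ Finset.range (m + m), ζ ^ (-(m : ℤ) + 1) * ζ ^ k := by
    refine Finset.sum_nbij' (fun z => (z + m - 1).toNat) (fun k => (k : ℤ) - m + 1) ?_ ?_ ?_ ?_ ?_
    · intro z hz; simp only [Finset.mem_Icc, Finset.mem_range] at *; omega
    · intro z hz; simp only [Finset.mem_Icc, Finset.mem_range] at *; omega
    · intro z hz; simp only [Finset.mem_Icc] at *; omega
    · intro z hz; simp only [Finset.mem_range] at *; omega
    · intro z hz
      simp only [Finset.mem_Icc] at hz
      rw [← zpow_natCast, ← zpow_add₀ h0]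
      congr 1
      omega
  rw [this, ← Finset.mul_sum]
  split_ifs with h
  · subst h; simp
  · have hg := geom_sum_mul ζ (m + m)
    rw [h1, sub_self] at hg
    rcases mul_eq_zero.1 hg with hg | hg
    · rw [hg, mul_zero]
    · exact absurd (sub_eq_zero.1 hg) h

/-- Orthogonality of the Fourier modes. -/
theorem sum_cos_phase (heven : Even ℓ) (x : Box d ℓ) :
    ∑ n ∈ fullIndex d ℓ, Real.cos (phase n x) = if x = 0 then (ℓ : ℝ) ^ d else 0 := by
  have hℓ : (ℓ : ℂ) ≠ 0 := by exact_mod_cast NeZero.ne ℓ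
  let ζ : Fin d → ℂ := fun i => Complex.exp (2 * Real.pi * Complex.I * ((x i : ℕ) / ℓ))
  have hζ : ∀ i, ζ i = 1 ↔ x i = 0 := by
    intro i
    simp only [ζ]
    rw [Complex.exp_eq_one_iff]
    constructor
    · rintro ⟨m, hm⟩
      have h2 : (2 * Real.pi * Complex.I : ℂ) ≠ 0 := Complex.two_pi_I_ne_zero
      have h3 : ((x i : ℕ) : ℂ) = m * ℓ := by
        rw [mul_comm (m : ℂ)] at hm
        have := mul_left_cancel₀ h2 hm
        field_simp at this
        linear_combination this
      have h4 : ((x i : ℕ) : ℤ) = m * ℓ := by exact_mod_cast h3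
      have h5 := (x i).2
      have h6 : m < 1 := by by_contra! h; nlinarith
      have h7 : -1 < m := by by_contra! h; nlinarith
      have h8 : m = 0 := by omega
      rw [h8, zero_mul] at h4
      have h9 : (x i : ℕ) = 0 := by exact_mod_cast h4
      exact Fin.ext (by rw [h9, Fin.val_zero])
    · intro h; exact ⟨0, by simp [h]⟩
  have hpow : ∀ i, ζ i ^ ℓ = 1 := by
    intro i
    simp only [ζ]
    rw [← Complex.exp_nat_mul, Complex.exp_eq_one_iff]
    exact ⟨(x i : ℕ), by push_cast; field_simp⟩
  have hexp : ∀ n : Fin d → ℤ, Complex.exp (phase n x * Complex.I) = ∏ i, ζ i ^ n i := by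
    intro n
    simp only [ζ, ← Complex.exp_int_mul, ← Complex.exp_sum]
    congr 1
    rw [phase, Complex.ofReal_sum, Finset.sum_mul]
    refine Finset.sum_congr rfl fun i _ => ?_
    rw [momentum]
    push_cast
    ring
  have hC : ∑ n ∈ fullIndex d ℓ, Complex.exp (phase n x * Complex.I) =
      if x = 0 then (ℓ : ℂ) ^ d else 0 := by
    simp only [hexp]
    have hsum : ∀ i, ∑ m ∈ Finset.Icc (-((ℓ : ℤ) / 2) + 1) ((ℓ : ℤ) / 2), ζ i ^ m =
        if x i = 0 then (ℓ : ℂ) else 0 := fun i => by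
      rw [sum_Icc_zpow heven (Complex.exp_ne_zero _) (hpow i), if_congr (hζ i) rfl rfl]
    rw [fullIndex, ← Finset.prod_univ_sum, Finset.prod_congr rfl fun i _ => hsum i]
    split_ifs with h
    · subst h; simp
    · obtain ⟨i, hi⟩ : ∃ i, x i ≠ 0 := by
        by_contra! h'; exact h (funext h')
      exact Finset.prod_eq_zero (Finset.mem_univ i) (if_neg hi)
  have := congrArg Complex.re hC
  rw [Complex.re_sum] at this
  simp only [Complex.exp_ofReal_mul_I_re] at this
  rw [this]
  split_ifs
  · rw [← Complex.ofReal_natCast, ← Complex.ofReal_pow, Complex.ofReal_re]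
  · rfl

/-- Fourier inversion at the origin. -/
theorem sum_cosTransform (heven : Even ℓ) (F : Box d ℓ → ℝ) :
    ∑ n ∈ fullIndex d ℓ, cosTransform F n = (ℓ : ℝ) ^ d * F 0 := by
  simp only [cosTransform]
  rw [Finset.sum_comm]
  simp only [← Finset.mul_sum, sum_cos_phase heven]
  simp [mul_comm]

/-- Fourier inversion at a neighbour of the origin, for an even function. -/
theorem sum_cosTransform_mul_cos (heven : Even ℓ) (hℓ : 2 ≤ ℓ) {F : Box d ℓ → ℝ}
    (hF : ∀ x, F (-x) = F x) (j : Fin d) :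
    ∑ n ∈ fullIndex d ℓ, cosTransform F n * Real.cos (momentum ℓ n j) =
      (ℓ : ℝ) ^ d * F (unitSite d ℓ j) := by
  have h1 : ∀ n : Fin d → ℤ, cosTransform F n * Real.cos (momentum ℓ n j) =
      ∑ x, F x * (1 / 2) * (Real.cos (phase n (x + unitSite d ℓ j)) +
        Real.cos (phase n (x - unitSite d ℓ j))) := by
    intro n
    rw [cosTransform, Finset.sum_mul]
    refine Finset.sum_congr rfl fun x _ => ?_
    rw [cos_phase_add hℓ, cos_phase_sub_unitSite hℓ, Real.cos_add, Real.cos_sub]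
    ring
  simp only [h1]
  rw [Finset.sum_comm]
  simp only [← Finset.mul_sum, Finset.sum_add_distrib, sum_cos_phase heven]
  simp only [add_eq_zero_iff_eq_neg, sub_eq_zero, mul_add, Finset.sum_add_distrib, mul_ite,
    mul_zero, Finset.sum_ite_eq', Finset.mem_univ, if_true, hF]
  ring

theorem sum_sum_cos_phase_sub (F : Box d ℓ → ℝ) (n : Fin d → ℤ) :
    ∑ x : Box d ℓ, ∑ y : Box d ℓ, Real.cos (phase n (y - x)) * F (y - x) =
      (ℓ : ℝ) ^ d * cosTransform F n := by
  have h1 : ∀ x : Box d ℓ, ∑ y : Box d ℓ, Real.cos (phase n (y - x)) * F (y - x) =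
      cosTransform F n := by
    intro x
    rw [cosTransform, ← (Equiv.subRight x).sum_comp fun z => F z * Real.cos (phase n z)]
    exact Finset.sum_congr rfl fun y _ => mul_comm _ _
  simp only [h1, Finset.sum_const, Finset.card_univ, nsmul_eq_mul]
  rw [card_box]

end fourier

/-! ### The spin system on the torus -/

section gibbs
variable {N d ℓ : ℕ}

theorem spinAt_eq_siteOp (i : Fin 3) (x : Box d ℓ) :
    spinAt N d ℓ i x = siteOp x (spinMatrix N i) := by
  ext σ τ
  rw [siteOp_apply, spinAt, Matrix.of_apply]

variable [NeZero ℓ]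

theorem hamiltonian_eq (hℓ : 2 ≤ ℓ) (J : Fin 3 → ℝ) :
    hamiltonian N d ℓ J = -spinEnergy N (bondWeight (d := d) (ℓ := ℓ)) J := by
  rw [hamiltonian, spinEnergy, Finset.sum_comm]
  congr 1
  refine Finset.sum_congr rfl fun x _ => ?_
  rw [Finset.sum_comm]
  refine Finset.sum_congr rfl fun y _ => ?_
  rw [Finset.smul_sum]
  refine Finset.sum_congr rfl fun i _ => ?_
  rw [periodised_siteDiff hℓ, spinAt_eq_siteOp, spinAt_eq_siteOp, Complex.coe_smul, mul_smul]

theorem gibbsOp_eq (hℓ : 2 ≤ ℓ) (J : Fin 3 → ℝ) (β : ℝ) :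
    gibbsOp N d ℓ J β = exp (β • spinEnergy N (bondWeight (d := d) (ℓ := ℓ)) J) := by
  rw [gibbsOp, hamiltonian_eq hℓ, Complex.coe_smul, neg_smul_neg]

theorem smul_spinEnergy {Λ : Type*} [Fintype Λ] [DecidableEq Λ] (w : Λ → Λ → ℝ) (J : Fin 3 → ℝ)
    (b : ℝ) : b • spinEnergy N w J = spinEnergy N (fun x y => b * w x y) J := by
  simp only [spinEnergy, Finset.smul_sum, mul_smul]

/-- The partition function `Tr e^{-βH}`. -/
noncomputable def partition (N d ℓ : ℕ) [NeZero ℓ] (J : Fin 3 → ℝ) (β : ℝ) : ℝ :=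
  (exp (spinEnergy N (fun x y : Box d ℓ => β * bondWeight x y) J)).trace.re

theorem torus_isHermitian (J : Fin 3 → ℝ) (β : ℝ) :
    (spinEnergy N (fun x y : Box d ℓ => β * bondWeight x y) J).IsHermitian :=
  spinEnergy_isHermitian (fun x y => by rw [bondWeight_comm]) J

theorem partition_pos (J : Fin 3 → ℝ) (β : ℝ) : 0 < partition N d ℓ J β :=
  (trace_exp_pos (torus_isHermitian J β)).1

theorem corr_eq (hℓ : 2 ≤ ℓ) (J : Fin 3 → ℝ) (β : ℝ) (i : Fin 3) (x : Box d ℓ) :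
    corr N d ℓ J β i x =
      twoPoint N (fun x y : Box d ℓ => β * bondWeight x y) J i 0 x / partition N d ℓ J β := by
  rw [corr, expectation, gibbsOp_eq hℓ, smul_spinEnergy, spinAt_eq_siteOp, spinAt_eq_siteOp,
    ← Complex.re_add_im (exp (spinEnergy N (fun x y : Box d ℓ => β * bondWeight x y) J)).trace,
    (trace_exp_pos (torus_isHermitian J β)).2, Complex.ofReal_zero, zero_mul, add_zero,
    Complex.div_ofReal_re]
  rfl

theorem exists_tendsto_corr (hℓ : 2 ≤ ℓ) (J : Fin 3 → ℝ) (i : Fin 3) (x : Box d ℓ) :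
    ∃ L : ℝ, Tendsto (fun β : ℝ => corr N d ℓ J β i x) atTop (𝓝 L) := by
  obtain ⟨L, hL⟩ := exists_tendsto_trace_ratio
    (spinEnergy_isHermitian (N := N) (bondWeight_comm (d := d) (ℓ := ℓ)) J)
    (spinAt N d ℓ i 0 * spinAt N d ℓ i x)
  refine ⟨L.re, ?_⟩
  simp only [corr, expectation, gibbsOp_eq hℓ]
  exact (Complex.continuous_re.tendsto _).comp hL

end gibbs

/-! ### Symmetries of the two-point functions on the torus -/

section symmetry
variable {N d ℓ : ℕ} [NeZero ℓ] (J : Fin 3 → ℝ) (β : ℝ)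

theorem twoPoint_translate (i : Fin 3) (x y : Box d ℓ) :
    twoPoint N (fun x y : Box d ℓ => β * bondWeight x y) J i x y =
      twoPoint N (fun x y : Box d ℓ => β * bondWeight x y) J i 0 (y - x) := by
  rw [← twoPoint_perm _ J i (Equiv.addRight x) (fun a b => ?_) 0 (y - x)]
  · simp
  · simp only [Equiv.coe_addRight, bondWeight_add_right]

theorem twoPoint_neg (i : Fin 3) (x : Box d ℓ) :
    twoPoint N (fun x y : Box d ℓ => β * bondWeight x y) J i 0 (-x) =
      twoPoint N (fun x y : Box d ℓ => β * bondWeight x y) J i 0 x := by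
  rw [← zero_sub, ← twoPoint_translate, twoPoint_comm]

theorem unitSite_comp_perm (σ : Equiv.Perm (Fin d)) (k : Fin d) :
    unitSite d ℓ (σ k) ∘ σ = unitSite d ℓ k := by
  ext j
  by_cases h : j = k
  · subst h; simp [unitSite]
  · simp [unitSite, h]

theorem bondWeight_comp_perm (σ : Equiv.Perm (Fin d)) (x y : Box d ℓ) :
    bondWeight (x ∘ σ) (y ∘ σ) = bondWeight x y := by
  have h : ∀ (x y : Box d ℓ) (k : Fin d), x ∘ σ = y ∘ σ + unitSite d ℓ k ↔
      x = y + unitSite d ℓ (σ k) := by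
    intro x y k
    rw [← unitSite_comp_perm σ k]
    exact σ.surjective.injective_comp_right.eq_iff (a := x) (b := y + unitSite d ℓ (σ k))
  simp only [bondWeight, h]
  exact Equiv.sum_comp σ fun k => (if x = y + unitSite d ℓ k then (1 : ℝ) else 0) +
    if y = x + unitSite d ℓ k then 1 else 0

/-- Exchanging two coordinate axes: all neighbours of the origin are equally correlated
with it. -/
theorem twoPoint_unitSite (i : Fin 3) (j k : Fin d) :
    twoPoint N (fun x y : Box d ℓ => β * bondWeight x y) J i 0 (unitSite d ℓ j) =
      twoPoint N (fun x y : Box d ℓ => β * bondWeight x y) J i 0 (unitSite d ℓ k) := by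
  have h := twoPoint_perm (N := N) (fun x y : Box d ℓ => β * bondWeight x y) J i
    (Equiv.arrowCongr (Equiv.swap j k) (Equiv.refl _))
    (fun a b => congrArg (β * ·) (bondWeight_comp_perm (Equiv.swap j k).symm a b))
    0 (unitSite d ℓ k)
  rw [← h]
  have h1 : Equiv.arrowCongr (Equiv.swap j k) (Equiv.refl (Fin ℓ)) (unitSite d ℓ k) =
      unitSite d ℓ j := by
    have := unitSite_comp_perm (ℓ := ℓ) (Equiv.swap j k) j
    rw [Equiv.swap_apply_left] at this
    exact this
  rw [h1]
  rfl

end symmetry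

/-! ### Correlations of nearest neighbours -/

section neighbour
variable {N d ℓ : ℕ} [NeZero ℓ] {J : Fin 3 → ℝ} {β : ℝ}

theorem torus_weight_nonneg (hβ : 0 < β) (x y : Box d ℓ) : 0 ≤ β * bondWeight x y :=
  mul_nonneg hβ.le (bondWeight_nonneg x y)

theorem abs_corr_one_le (hℓ : 2 ≤ ℓ) (hβ : 0 < β) (hJ : |J 1| ≤ J 0) (x : Box d ℓ) :
    |corr N d ℓ J β 1 x| ≤ corr N d ℓ J β 0 x := by
  have hZ := partition_pos (N := N) (d := d) (ℓ := ℓ) J β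
  rw [corr_eq hℓ, corr_eq hℓ, abs_div, abs_of_pos hZ]
  gcongr
  exact abs_twoPoint_one_le (torus_weight_nonneg hβ) hJ 0 x

theorem abs_corr_zero_le (hℓ : 2 ≤ ℓ) (hβ : 0 < β) (hJ : |J 0| ≤ J 2) (x : Box d ℓ) :
    |corr N d ℓ J β 0 x| ≤ corr N d ℓ J β 2 x := by
  have hZ := partition_pos (N := N) (d := d) (ℓ := ℓ) J β
  rw [corr_eq hℓ, corr_eq hℓ, abs_div, abs_of_pos hZ]
  gcongr
  exact abs_twoPoint_zero_le (torus_weight_nonneg hβ) hJ 0 x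

/-- The third component has the largest share of `∑_i ⟨(S_0⁽ⁱ⁾)²⟩ = S(S+1)`. -/
theorem le_corr_two_zero (hℓ : 2 ≤ ℓ) (hβ : 0 < β) (hJ : |J 1| ≤ J 0) (hJ' : |J 0| ≤ J 2) :
    1 / 3 * spinValue N * (spinValue N + 1) ≤ corr N d ℓ J β 2 0 := by
  have hZ := partition_pos (N := N) (d := d) (ℓ := ℓ) J β
  have h := sum_twoPoint_self (N := N) (fun x y : Box d ℓ => β * bondWeight x y) J 0
  change _ = _ * partition N d ℓ J β at h
  have h1 := abs_corr_one_le (N := N) hℓ hβ hJ (0 : Box d ℓ)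
  have h2 := abs_corr_zero_le (N := N) hℓ hβ hJ' (0 : Box d ℓ)
  rw [eq_comm, ← eq_div_iff hZ.ne', Fin.sum_univ_three, add_div, add_div, ← corr_eq hℓ,
    ← corr_eq hℓ, ← corr_eq hℓ] at h
  have h3 := (le_abs_self _).trans h1
  have h4 := (le_abs_self _).trans h2
  linarith

theorem corr_neg (hℓ : 2 ≤ ℓ) (i : Fin 3) (x : Box d ℓ) :
    corr N d ℓ J β i (-x) = corr N d ℓ J β i x := by
  rw [corr_eq hℓ, corr_eq hℓ, twoPoint_neg]

theorem corr_unitSite [NeZero d] (hℓ : 2 ≤ ℓ) (i : Fin 3) (j : Fin d) :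
    corr N d ℓ J β i (unitSite d ℓ j) = corr N d ℓ J β i (e₁ d ℓ) := by
  rw [corr_eq hℓ, corr_eq hℓ, twoPoint_unitSite J β i j 0]
  rfl

end neighbour

/-! ### The infrared bound -/

section infrared
variable {N d ℓ : ℕ} [NeZero ℓ] {J : Fin 3 → ℝ} {β : ℝ}

open ComplexOrder in
theorem trace_mul_self_mul_exp_nonneg {n : Type*} [Fintype n] [DecidableEq n] {K A : Matrix n n ℂ}
    (hK : K.IsHermitian) (hA : A.IsHermitian) : 0 ≤ (A * A * exp K).trace.re := by
  have hE : ((1 / 2 : ℝ) • K).IsHermitian := by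
    rw [Matrix.IsHermitian, conjTranspose_smul, hK.eq, star_trivial]
  have h : exp K = exp ((1 / 2 : ℝ) • K) * exp ((1 / 2 : ℝ) • K) := by
    rw [← Matrix.exp_add_of_commute _ _ (Commute.refl _), ← add_smul]
    norm_num
  have h1 : A * A * exp K = A * (A * exp ((1 / 2 : ℝ) • K)) * exp ((1 / 2 : ℝ) • K) := by
    rw [h]; simp only [mul_assoc]
  have h2 : (A * exp ((1 / 2 : ℝ) • K))ᴴ = exp ((1 / 2 : ℝ) • K) * A := by
    rw [conjTranspose_mul, hA.eq, hE.exp.eq]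
  have h3 := (posSemidef_conjTranspose_mul_self (A * exp ((1 / 2 : ℝ) • K))).trace_nonneg
  rw [h1, trace_mul_comm, ← mul_assoc, ← h2]
  exact (Complex.le_def.1 h3).1

theorem sqrt_mul_add_sqrt_mul_le {a b c d : ℝ} (ha : 0 ≤ a) (hb : 0 ≤ b) (hc : 0 ≤ c)
    (hd : 0 ≤ d) : √(a * b) + √(c * d) ≤ √((a + c) * (b + d)) := by
  refine Real.le_sqrt_of_sq_le ?_
  have h1 := Real.sq_sqrt (mul_nonneg ha hb)
  have h2 := Real.sq_sqrt (mul_nonneg hc hd)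
  have h3 : √(a * b) * √(c * d) = √(a * d) * √(c * b) := by
    rw [← Real.sqrt_mul (mul_nonneg ha hb), ← Real.sqrt_mul (mul_nonneg ha hd)]
    congr 1; ring
  nlinarith [sq_nonneg (√(a * d) - √(c * b)), Real.sq_sqrt (mul_nonneg ha hd),
    Real.sq_sqrt (mul_nonneg hc hb)]

/-- The expectations of the squares of the cosine and the sine mode of a momentum add up to the
Fourier transform of the two-point function. -/
theorem sum_twoPoint_modes (hℓ : 2 ≤ ℓ) (n : Fin d → ℤ) :
    (∑ x : Box d ℓ, ∑ y, Real.cos (phase n x) * Real.cos (phase n y) *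
        twoPoint N (fun x y : Box d ℓ => β * bondWeight x y) J 2 x y) +
      (∑ x : Box d ℓ, ∑ y, Real.sin (phase n x) * Real.sin (phase n y) *
        twoPoint N (fun x y : Box d ℓ => β * bondWeight x y) J 2 x y) =
      (ℓ : ℝ) ^ d * (cosTransform (corr N d ℓ J β 2) n * partition N d ℓ J β) := by
  have hZ := partition_pos (N := N) (d := d) (ℓ := ℓ) J β
  rw [← mul_assoc, ← sum_sum_cos_phase_sub, Finset.sum_mul, ← Finset.sum_add_distrib]
  refine Finset.sum_congr rfl fun x _ => ?_
  rw [Finset.sum_mul, ← Finset.sum_add_distrib]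
  refine Finset.sum_congr rfl fun y _ => ?_
  rw [corr_eq hℓ, mul_assoc _ (_ / _), div_mul_cancel₀ _ hZ.ne', cos_phase_sub, twoPoint_translate]
  ring

variable [NeZero d]

/-- The off-diagonal counterpart `J⁽¹⁾⟨S_0⁽²⁾ S_{e₁}⁽²⁾⟩ + J⁽²⁾⟨S_0⁽¹⁾ S_{e₁}⁽¹⁾⟩` of `α`, which
multiplies `cos k_i` in the double commutator of a Fourier mode. -/
noncomputable def alphaDual (N d ℓ : ℕ) [NeZero d] [NeZero ℓ] (J : Fin 3 → ℝ) (β : ℝ) : ℝ :=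
  J 0 * corr N d ℓ J β 1 (e₁ d ℓ) + J 1 * corr N d ℓ J β 0 (e₁ d ℓ)

/-- The double commutators of the cosine and the sine mode of a momentum, added up. -/
theorem sum_doubleComm_modes (hℓ : 2 ≤ ℓ) (n : Fin d → ℤ) :
    (∑ x : Box d ℓ, ∑ y, β * bondWeight x y *
        ((Real.cos (phase n x) ^ 2 + Real.cos (phase n y) ^ 2) *
          (J 0 * twoPoint N (fun x y : Box d ℓ => β * bondWeight x y) J 0 x y +
            J 1 * twoPoint N (fun x y : Box d ℓ => β * bondWeight x y) J 1 x y) -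
        2 * (Real.cos (phase n x) * Real.cos (phase n y)) *
          (J 0 * twoPoint N (fun x y : Box d ℓ => β * bondWeight x y) J 1 x y +
            J 1 * twoPoint N (fun x y : Box d ℓ => β * bondWeight x y) J 0 x y))) +
      (∑ x : Box d ℓ, ∑ y, β * bondWeight x y *
        ((Real.sin (phase n x) ^ 2 + Real.sin (phase n y) ^ 2) *
          (J 0 * twoPoint N (fun x y : Box d ℓ => β * bondWeight x y) J 0 x y +
            J 1 * twoPoint N (fun x y : Box d ℓ => β * bondWeight x y) J 1 x y) -
        2 * (Real.sin (phase n x) * Real.sin (phase n y)) *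
          (J 0 * twoPoint N (fun x y : Box d ℓ => β * bondWeight x y) J 1 x y +
            J 1 * twoPoint N (fun x y : Box d ℓ => β * bondWeight x y) J 0 x y))) =
      (ℓ : ℝ) ^ d * (4 * β * partition N d ℓ J β *
        ∑ j, (alpha N d ℓ J β - alphaDual N d ℓ J β * Real.cos (momentum ℓ n j))) := by
  have hZ := partition_pos (N := N) (d := d) (ℓ := ℓ) J β
  set Z := partition N d ℓ J β with hZdef
  have htp : ∀ (i : Fin 3) (x y : Box d ℓ),
      twoPoint N (fun x y : Box d ℓ => β * bondWeight x y) J i x y =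
        Z * corr N d ℓ J β i (y - x) := by
    intro i x y
    rw [corr_eq hℓ, ← hZdef, mul_div_cancel₀ _ hZ.ne', twoPoint_translate]
  simp only [htp]
  rw [← Finset.sum_add_distrib, ← card_box, ← nsmul_eq_mul, ← Finset.card_univ,
    ← Finset.sum_const]
  refine Finset.sum_congr rfl fun x _ => ?_
  let f : Box d ℓ → ℝ := fun z => J 0 * corr N d ℓ J β 0 z + J 1 * corr N d ℓ J β 1 z -
    Real.cos (phase n z) * (J 0 * corr N d ℓ J β 1 z + J 1 * corr N d ℓ J β 0 z)
  have hfe : ∀ j, f (unitSite d ℓ j) =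
      alpha N d ℓ J β - alphaDual N d ℓ J β * Real.cos (momentum ℓ n j) := by
    intro j
    simp only [f, corr_unitSite hℓ, phase_unitSite hℓ, alpha, alphaDual]
    ring
  have hfe' : ∀ j, f (-unitSite d ℓ j) =
      alpha N d ℓ J β - alphaDual N d ℓ J β * Real.cos (momentum ℓ n j) := by
    intro j
    rw [← hfe]
    have : Real.cos (phase n (-unitSite d ℓ j)) = Real.cos (phase n (unitSite d ℓ j)) := by
      rw [← zero_sub, cos_phase_sub_unitSite hℓ, phase_unitSite hℓ]
      simp [phase]
    simp only [f, corr_neg hℓ, this]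
  have hb := sum_bondWeight_mul x fun y => f (y - x)
  simp only [sub_sub_cancel_left, add_sub_cancel_left, hfe, hfe'] at hb
  rw [← Finset.sum_add_distrib]
  calc _ = ∑ y, 2 * β * Z * (bondWeight x y * f (y - x)) := by
        refine Finset.sum_congr rfl fun y _ => ?_
        have h1 := Real.sin_sq_add_cos_sq (phase n x)
        have h2 := Real.sin_sq_add_cos_sq (phase n y)
        simp only [f, cos_phase_sub]
        linear_combination (β * bondWeight x y * Z * (J 0 * corr N d ℓ J β 0 (y - x) +
          J 1 * corr N d ℓ J β 1 (y - x))) * (h1 + h2)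
    _ = _ := by
        rw [← Finset.mul_sum, hb]
        simp only [← two_mul]
        rw [← Finset.mul_sum]
        ring

/-- Adding the Falk-Bruch inequalities of a cosine and a sine mode; `E`, `D`, `C` stand for the
expectation of the square, the Duhamel function and the double commutator of the two modes. -/
theorem le_of_falk_bruch_pair {L Z β ε Sc Ss Dc Ds Ec Es Cc Cs T A : ℝ} (hL : 0 < L) (hZ : 0 < Z)
    (hβ : 0 < β) (hε : 0 < ε) (hS : Sc + Ss = L) (hSc : 0 ≤ Sc) (hSs : 0 ≤ Ss)
    (hDc : Dc ≤ Sc / (2 * (β * ε)) * Z) (hDs : Ds ≤ Ss / (2 * (β * ε)) * Z) (hEc : 0 ≤ Ec)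
    (hEs : 0 ≤ Es) (hCc : 0 ≤ Cc) (hCs : 0 ≤ Cs) (fc : Ec ≤ Dc + 1 / 2 * √(Dc * Cc))
    (fs : Es ≤ Ds + 1 / 2 * √(Ds * Cs)) (hE : Ec + Es = L * (T * Z))
    (hC : Cc + Cs = L * (4 * β * Z * A)) :
    0 ≤ T ∧ T ≤ 1 / (2 * β * ε) + 1 / 2 * √(2 * A / ε) := by
  constructor
  · have : 0 ≤ T * (L * Z) := by linarith
    exact nonneg_of_mul_nonneg_left this (mul_pos hL hZ)
  · have hc : √(Dc * Cc) ≤ √(Sc / (2 * (β * ε)) * Z * Cc) :=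
      Real.sqrt_le_sqrt (mul_le_mul_of_nonneg_right hDc hCc)
    have hs : √(Ds * Cs) ≤ √(Ss / (2 * (β * ε)) * Z * Cs) :=
      Real.sqrt_le_sqrt (mul_le_mul_of_nonneg_right hDs hCs)
    have hcs := sqrt_mul_add_sqrt_mul_le (a := Sc / (2 * (β * ε)) * Z) (b := Cc)
      (c := Ss / (2 * (β * ε)) * Z) (d := Cs) (by positivity) hCc (by positivity) hCs
    have hsum : Sc / (2 * (β * ε)) * Z + Ss / (2 * (β * ε)) * Z = L * Z * (1 / (2 * β * ε)) := by
      rw [← hS]; field_simp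
    have hprod : L * Z * (1 / (2 * β * ε)) * (Cc + Cs) = (L * Z) ^ 2 * (2 * A / ε) := by
      rw [hC]; field_simp; ring
    rw [hsum, hprod, Real.sqrt_mul (sq_nonneg _), Real.sqrt_sq (mul_pos hL hZ).le] at hcs
    have h : L * Z * T ≤ L * Z * (1 / (2 * β * ε) + 1 / 2 * √(2 * A / ε)) := by
      nlinarith
    exact le_of_mul_le_mul_left h (mul_pos hL hZ)

/-- The infrared bound on a Fourier mode of `⟨S_0⁽³⁾ S_x⁽³⁾⟩`: Gaussian domination controls the
Duhamel two-point function, the Falk-Bruch inequality turns this into a bound on the usual one. -/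
theorem infrared_bound (heven : Even ℓ) (hℓ : 2 ≤ ℓ) (hβ : 0 < β) (h0 : 0 ≤ J 0) (h1 : J 1 ≤ 0)
    (h2 : J 2 = 1) {n : Fin d → ℤ} (hn : n ∈ dualIndex d ℓ) :
    0 ≤ cosTransform (corr N d ℓ J β 2) n ∧
    cosTransform (corr N d ℓ J β 2) n ≤ 1 / (2 * β * eps (momentum ℓ n)) +
      1 / 2 * √(2 * (∑ j, (alpha N d ℓ J β - alphaDual N d ℓ J β * Real.cos (momentum ℓ n j))) /
        eps (momentum ℓ n)) := by
  have hε := eps_pos hn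
  have hZ := partition_pos (N := N) (d := d) (ℓ := ℓ) J β
  have hK := torus_isHermitian (N := N) (d := d) (ℓ := ℓ) J β
  have hL : (0 : ℝ) < (ℓ : ℝ) ^ d := pow_pos (by exact_mod_cast Nat.pos_of_ne_zero (NeZero.ne ℓ)) _
  have hlam : 0 < β * eps (momentum ℓ n) := mul_pos hβ hε
  have hdom : ∀ h : Box d ℓ → ℝ,
      (∀ x, laplacian (fun x y => β * bondWeight x y) (β * (2 * d)) h x =
        β * eps (momentum ℓ n) * h x) →
      duhamel (spinEnergy N (fun x y : Box d ℓ => β * bondWeight x y) J) (mode N h) ≤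
        (∑ x, h x ^ 2) / (2 * (β * eps (momentum ℓ n))) * partition N d ℓ J β := fun h hh =>
    duhamel_mode_le (fun x y => by rw [bondWeight_comm]) (torus_weight_nonneg hβ)
      (fun x => by rw [← Finset.mul_sum, sum_bondWeight])
      (fun x y hxy => reflectsBond_torus heven hℓ hβ hxy) h0 h1 h2 hlam hh
  have hdc := hdom _ (laplacian_cos_phase hℓ β n)
  have hds := hdom _ (laplacian_sin_phase hℓ β n)
  have fc := falk_bruch hK (mode_isHermitian fun x : Box d ℓ => Real.cos (phase n x))
  have fs := falk_bruch hK (mode_isHermitian fun x : Box d ℓ => Real.sin (phase n x))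
  have tc := trace_doubleComm_mode (N := N) (fun x y : Box d ℓ => β * bondWeight x y) J
    fun x => Real.cos (phase n x)
  have ts := trace_doubleComm_mode (N := N) (fun x y : Box d ℓ => β * bondWeight x y) J
    fun x => Real.sin (phase n x)
  have hE := sum_twoPoint_modes (N := N) (J := J) (β := β) hℓ n
  have hC := sum_doubleComm_modes (N := N) (J := J) (β := β) hℓ n
  rw [← trace_mode_sq _ _ fun x : Box d ℓ => Real.cos (phase n x),
    ← trace_mode_sq _ _ fun x : Box d ℓ => Real.sin (phase n x)] at hE
  rw [← tc, ← ts] at hC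
  have ec0 := trace_mul_self_mul_exp_nonneg hK
    (mode_isHermitian (N := N) fun x : Box d ℓ => Real.cos (phase n x))
  have es0 := trace_mul_self_mul_exp_nonneg hK
    (mode_isHermitian (N := N) fun x : Box d ℓ => Real.sin (phase n x))
  have hsq := sum_cos_sq_add_sum_sin_sq (d := d) (ℓ := ℓ) n
  have hc0 : 0 ≤ ∑ x : Box d ℓ, Real.cos (phase n x) ^ 2 :=
    Finset.sum_nonneg fun _ _ => sq_nonneg _
  have hs0 : 0 ≤ ∑ x : Box d ℓ, Real.sin (phase n x) ^ 2 :=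
    Finset.sum_nonneg fun _ _ => sq_nonneg _
  obtain ⟨-, cc0, fc⟩ := fc
  obtain ⟨-, cs0, fs⟩ := fs
  exact le_of_falk_bruch_pair hL hZ hβ hε hsq hc0 hs0 hdc hds ec0 es0 cc0 cs0 fc fs hE hC

end infrared

/-! ### The involution `k ↦ k + π` and the lattice sums -/

section dual
variable {d ℓ : ℕ}

/-- The involution of the labels that corresponds to `k ↦ k + π` modulo `2π`. -/
def shiftPi (ℓ : ℕ) (n : Fin d → ℤ) : Fin d → ℤ :=
  fun i => if n i ≤ 0 then n i + (ℓ : ℤ) / 2 else n i - (ℓ : ℤ) / 2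

theorem shiftPi_mem {n : Fin d → ℤ} (hn : n ∈ fullIndex d ℓ) : shiftPi ℓ n ∈ fullIndex d ℓ := by
  rw [mem_fullIndex] at *
  intro i
  have := hn i
  simp only [shiftPi]
  split_ifs <;> omega

theorem shiftPi_shiftPi {n : Fin d → ℤ} (hn : n ∈ fullIndex d ℓ) :
    shiftPi ℓ (shiftPi ℓ n) = n := by
  rw [mem_fullIndex] at hn
  ext i
  have := hn i
  simp only [shiftPi]
  split_ifs <;> omega

theorem sum_shiftPi (f : (Fin d → ℤ) → ℝ) :
    ∑ n ∈ fullIndex d ℓ, f (shiftPi ℓ n) = ∑ n ∈ fullIndex d ℓ, f n :=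
  Finset.sum_nbij' (shiftPi ℓ) (shiftPi ℓ) (fun _ => shiftPi_mem) (fun _ => shiftPi_mem)
    (fun _ => shiftPi_shiftPi) (fun _ => shiftPi_shiftPi) fun _ _ => rfl

/-- The sum `∑_i cos k_i` at `k = (2π/ℓ) n`. -/
noncomputable def cosSum (ℓ : ℕ) (n : Fin d → ℤ) : ℝ := ∑ i, Real.cos (momentum ℓ n i)

theorem abs_cosSum_le (n : Fin d → ℤ) : |cosSum ℓ n| ≤ d := by
  refine (Finset.abs_sum_le_sum_abs _ _).trans ?_
  refine (Finset.sum_le_sum fun i _ => Real.abs_cos_le_one _).trans ?_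
  simp

theorem eps_momentum (n : Fin d → ℤ) : eps (momentum ℓ n) = 2 * (d - cosSum ℓ n) := by
  simp [eps, cosSum]

theorem eps_momentum_add_pi (n : Fin d → ℤ) :
    eps (fun i => momentum ℓ n i + Real.pi) = 2 * (d + cosSum ℓ n) := by
  simp [eps, cosSum, Finset.sum_add_distrib]

theorem cosSum_shiftPi [NeZero ℓ] (heven : Even ℓ) (n : Fin d → ℤ) :
    cosSum ℓ (shiftPi ℓ n) = -cosSum ℓ n := by
  rw [cosSum, cosSum, ← Finset.sum_neg_distrib]
  refine Finset.sum_congr rfl fun i _ => ?_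
  obtain ⟨m, hm⟩ := heven
  have h2 : ((ℓ : ℤ) / 2) = m := by omega
  have hm0 : (m : ℝ) ≠ 0 := by
    have := NeZero.ne ℓ
    exact_mod_cast (by omega : m ≠ 0)
  have hℓ : (ℓ : ℝ) = 2 * m := by rw [hm]; push_cast; ring
  simp only [momentum, shiftPi, h2, hℓ]
  split_ifs
  · rw [← Real.cos_add_pi]
    congr 1
    push_cast
    field_simp
  · rw [← Real.cos_sub_pi]
    congr 1
    push_cast
    field_simp

/-- For `X, Y ≥ 0` with `X + Y = (a + b) α`, the Cauchy-Schwarz inequality compares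
`√(X/a) + √(Y/b)` with the case `X = b α`, `Y = a α`. -/
theorem sqrt_div_add_sqrt_div_le {X Y a b α : ℝ} (hX : 0 ≤ X) (hY : 0 ≤ Y) (ha : 0 < a)
    (hb : 0 < b) (hα : 0 ≤ α) (h : X + Y = (a + b) * α) :
    √(X / a) + √(Y / b) ≤ √α * (√(b / a) + √(a / b)) := by
  have h1 := sqrt_mul_add_sqrt_mul_le hX (inv_nonneg.2 ha.le) hY (inv_nonneg.2 hb.le)
  rw [← div_eq_mul_inv, ← div_eq_mul_inv] at h1
  refine h1.trans (Real.sqrt_le_iff.2 ⟨by positivity, le_of_eq ?_⟩)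
  have h2 : √(b / a) * √(a / b) = 1 := by
    rw [← Real.sqrt_mul (by positivity), div_mul_div_comm, mul_comm b a, div_self (by positivity),
      Real.sqrt_one]
  have h3 := Real.sq_sqrt (div_nonneg hb.le ha.le)
  have h4 := Real.sq_sqrt (div_nonneg ha.le hb.le)
  rw [mul_pow, Real.sq_sqrt hα, add_sq, h3, h4, mul_assoc 2, h2, h]
  field_simp
  ring

/-- The terms of `k` and `k + π` are estimated together; the term of `k = π`, whose partner `k = 0`
is missing, accounts for the summand `√2`. -/
theorem sum_sqrt_le [NeZero d] [NeZero ℓ] (heven : Even ℓ) (hℓ : 2 ≤ ℓ) {α c : ℝ} (hc : |c| ≤ α) :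
    ∑ n ∈ dualIndex d ℓ, √(2 * (∑ j, (α - c * Real.cos (momentum ℓ n j))) / eps (momentum ℓ n)) ≤
      √α * (∑ n ∈ dualIndex d ℓ,
        √(eps (fun i => momentum ℓ n i + Real.pi) / eps (momentum ℓ n)) + √2) := by
  have hα : 0 ≤ α := (abs_nonneg c).trans hc
  have hd : (0 : ℝ) < d := by exact_mod_cast Nat.pos_of_ne_zero (NeZero.ne d)
  let g : (Fin d → ℤ) → ℝ := fun n => √((d * α - c * cosSum ℓ n) / (d - cosSum ℓ n))
  let h : (Fin d → ℤ) → ℝ := fun n => √((d + cosSum ℓ n) / (d - cosSum ℓ n))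
  have hg : ∀ n : Fin d → ℤ,
      √(2 * (∑ j, (α - c * Real.cos (momentum ℓ n j))) / eps (momentum ℓ n)) = g n := by
    intro n
    simp only [g]
    rw [eps_momentum, mul_div_mul_left _ _ two_ne_zero, Finset.sum_sub_distrib, ← Finset.mul_sum]
    simp [cosSum]
  have hh : ∀ n : Fin d → ℤ,
      √(eps (fun i => momentum ℓ n i + Real.pi) / eps (momentum ℓ n)) = h n := by
    intro n
    simp only [h]
    rw [eps_momentum_add_pi, eps_momentum, mul_div_mul_left _ _ two_ne_zero]
  simp only [hg, hh]
  have hc0 : cosSum ℓ (0 : Fin d → ℤ) = d := by simp [cosSum, momentum]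
  have hg0 : g 0 = 0 := by simp [g, hc0]
  have hh0 : h 0 = 0 := by simp [h, hc0]
  have hgs := sum_fullIndex (d := d) hℓ g
  have hhs := sum_fullIndex (d := d) hℓ h
  rw [hg0, zero_add] at hgs
  rw [hh0, zero_add] at hhs
  rw [← hgs, ← hhs]
  let e : (Fin d → ℤ) → ℝ := fun n => if n = 0 then √α * √2 else 0
  have hesum : ∑ n ∈ fullIndex d ℓ, e n = √α * √2 := by
    simp [e, zero_mem_fullIndex hℓ]
  have he0 : ∀ n, 0 ≤ e n := fun n => by simp only [e]; split_ifs <;> positivity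
  have hα2 : √α ≤ √α * √2 :=
    le_mul_of_one_le_right (Real.sqrt_nonneg _) (Real.one_le_sqrt.2 one_le_two)
  have hpair : ∀ n ∈ fullIndex d ℓ, g n + g (shiftPi ℓ n) ≤
      √α * h n + √α * h (shiftPi ℓ n) + (e n + e (shiftPi ℓ n)) := by
    -- a vanishing denominator occurs at `k = 0` only
    have hzero : ∀ n ∈ fullIndex d ℓ, d - cosSum ℓ n = 0 → e n = √α * √2 := by
      intro n hn h0
      refine if_pos (by_contra fun hne => ?_)
      have := eps_pos (Finset.mem_erase.2 ⟨hne, hn⟩)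
      rw [eps_momentum, h0, mul_zero] at this
      exact lt_irrefl _ this
    intro n hn
    have hn' := shiftPi_mem hn
    have hs := cosSum_shiftPi heven n
    have hC := abs_le.1 (abs_cosSum_le (ℓ := ℓ) n)
    have hz := hzero n hn
    have hz' := hzero _ hn'
    have hh1 : 0 ≤ √α * h n := by positivity
    have hh2 : 0 ≤ √α * h (shiftPi ℓ n) := by positivity
    have he1 := he0 n
    have he2 := he0 (shiftPi ℓ n)
    have hcl := abs_le.1 hc
    simp only [g, h, hs, sub_neg_eq_add, mul_neg] at *
    set C := cosSum ℓ n
    rcases eq_or_lt_of_le hC.2 with h1 | h1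
    · rw [hz (by linarith), h1]
      have h2 : √((d * α + c * d) / (d + d)) ≤ √α := by
        refine Real.sqrt_le_sqrt ((div_le_iff₀ (by positivity)).2 ?_)
        nlinarith
      have h3 : √((d * α - c * d) / (d - d)) = 0 := by simp
      rw [h1] at hh1 hh2
      linarith
    · rcases eq_or_lt_of_le hC.1 with h2 | h2
      · rw [hz' (by linarith), ← h2]
        have h3 : √((d * α - c * -d) / (d - -d)) ≤ √α := by
          refine Real.sqrt_le_sqrt ((div_le_iff₀ (by linarith)).2 ?_)
          nlinarith
        have h4 : √((d * α + c * -d) / (d + -d)) = 0 := by simp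
        rw [← h2] at hh1 hh2
        linarith
      · have hcC : |c * C| ≤ d * α := by
          rw [abs_mul, mul_comm]
          exact mul_le_mul (abs_cosSum_le n) hc (abs_nonneg _) hd.le
        have hcC' := abs_le.1 hcC
        have := sqrt_div_add_sqrt_div_le (X := d * α - c * C) (Y := d * α + c * C) (a := d - C)
          (b := d + C) (α := α) (by linarith) (by linarith) (by linarith) (by linarith) hα
          (by ring)
        rw [← sub_eq_add_neg (d : ℝ) C]
        linarith
  have hsum := Finset.sum_le_sum hpair
  simp only [Finset.sum_add_distrib, sum_shiftPi, sum_shiftPi (fun n => √α * h n),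
    hesum, ← Finset.mul_sum] at hsum
  linarith

end dual

/-! ### From the infrared bound to the order parameter -/

section order
variable {d ℓ : ℕ} [NeZero d] [NeZero ℓ] {F : Box d ℓ → ℝ} {α c β : ℝ}

/-- The infrared bound inserted in the Fourier sum for `F 0`. -/
theorem le_order_of_infrared_bound (heven : Even ℓ) (hℓ : 2 ≤ ℓ) (hc : |c| ≤ α)
    (hF : ∀ n ∈ dualIndex d ℓ, cosTransform F n ≤ 1 / (2 * β * eps (momentum ℓ n)) +
      1 / 2 * √(2 * (∑ j, (α - c * Real.cos (momentum ℓ n j))) / eps (momentum ℓ n))) :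
    F 0 - 1 / 2 * (latticeI d ℓ + √2 / (ℓ : ℝ) ^ d) * √α -
        1 / (2 * β * (ℓ : ℝ) ^ d) * sumDual d ℓ (fun k => 1 / eps k) ≤
      1 / (ℓ : ℝ) ^ d * ∑ x, F x := by
  have hL : (0 : ℝ) < (ℓ : ℝ) ^ d := pow_pos (by exact_mod_cast Nat.pos_of_ne_zero (NeZero.ne ℓ)) _
  have h1 := sum_cosTransform heven F
  rw [sum_fullIndex hℓ, cosTransform_zero] at h1
  have h2 := Finset.sum_le_sum hF
  rw [Finset.sum_add_distrib, ← Finset.mul_sum] at h2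
  have h3 := sum_sqrt_le (d := d) heven hℓ hc
  have h4 : ∑ n ∈ dualIndex d ℓ, 1 / (2 * β * eps (momentum ℓ n)) =
      1 / (2 * β) * sumDual d ℓ fun k => 1 / eps k := by
    rw [sumDual, Finset.mul_sum]
    exact Finset.sum_congr rfl fun n _ => by rw [div_mul_div_comm, one_mul]
  rw [h4] at h2
  have h5 : (ℓ : ℝ) ^ d * F 0 ≤ ∑ x, F x + (1 / (2 * β) * sumDual d ℓ (fun k => 1 / eps k) +
      1 / 2 * (√α * (sumDual d ℓ (fun k => √(eps (fun i => k i + Real.pi) / eps k)) + √2))) := by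
    rw [← h1]
    refine add_le_add le_rfl (h2.trans (add_le_add le_rfl ?_))
    exact mul_le_mul_of_nonneg_left h3 (by norm_num)
  have h6 := mul_le_mul_of_nonneg_left h5 (one_div_pos.2 hL).le
  rw [← mul_assoc, one_div_mul_cancel hL.ne', one_mul] at h6
  rw [latticeI]
  refine le_of_eq_of_le ?_ (sub_le_iff_le_add.2 (h6.trans_eq (mul_add _ _ _)))
  rw [mul_comm 2 β, mul_assoc, one_div_mul_eq_div]
  ring

/-- The infrared bound inserted in the Fourier sum for `F e₁`, where the mode of momentum `k` has
the weight `d⁻¹ ∑_i cos k_i`; momenta of negative weight are dropped, as the transform is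
nonnegative. -/
theorem le_order_of_infrared_bound_neighbour (heven : Even ℓ) (hℓ : 2 ≤ ℓ) (hc : |c| ≤ α)
    (hneg : ∀ x, F (-x) = F x) (hunit : ∀ j, F (unitSite d ℓ j) = F (e₁ d ℓ))
    (hF : ∀ n ∈ dualIndex d ℓ, 0 ≤ cosTransform F n ∧
      cosTransform F n ≤ 1 / (2 * β * eps (momentum ℓ n)) +
        1 / 2 * √(2 * (∑ j, (α - c * Real.cos (momentum ℓ n j))) / eps (momentum ℓ n))) :
    F (e₁ d ℓ) - 1 / 2 * latticeITilde d ℓ * √α -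
        1 / (2 * β * (ℓ : ℝ) ^ d) * sumDual d ℓ (fun k => 1 / eps k * cosAvgPos k) ≤
      1 / (ℓ : ℝ) ^ d * ∑ x, F x := by
  have hL : (0 : ℝ) < (ℓ : ℝ) ^ d := pow_pos (by exact_mod_cast Nat.pos_of_ne_zero (NeZero.ne ℓ)) _
  have hd : (0 : ℝ) < d := by exact_mod_cast Nat.pos_of_ne_zero (NeZero.ne d)
  have hα : 0 ≤ α := (abs_nonneg c).trans hc
  have h1 : ∑ n ∈ fullIndex d ℓ, cosTransform F n * (1 / d * cosSum ℓ n) =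
      (ℓ : ℝ) ^ d * F (e₁ d ℓ) := by
    have h := Finset.sum_congr rfl fun (j : Fin d) (_ : j ∈ Finset.univ) =>
      sum_cosTransform_mul_cos heven hℓ hneg j
    rw [Finset.sum_comm] at h
    simp only [hunit, Finset.sum_const, Finset.card_univ, Fintype.card_fin, nsmul_eq_mul,
      ← Finset.mul_sum] at h
    calc _ = 1 / d * ∑ n ∈ fullIndex d ℓ, cosTransform F n * cosSum ℓ n := by
          rw [Finset.mul_sum]
          exact Finset.sum_congr rfl fun n _ => by ring
      _ = _ := by
          simp only [cosSum]
          rw [h, ← mul_assoc, one_div_mul_cancel hd.ne', one_mul]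
  have h0 : cosSum ℓ (0 : Fin d → ℤ) = d := by simp [cosSum, momentum]
  rw [sum_fullIndex hℓ, cosTransform_zero, h0, one_div_mul_cancel hd.ne', mul_one] at h1
  have h2 : ∀ n ∈ dualIndex d ℓ, cosTransform F n * (1 / d * cosSum ℓ n) ≤
      1 / (2 * β) * (1 / eps (momentum ℓ n) * cosAvgPos (momentum ℓ n)) +
      1 / 2 * √α * (√(eps (fun i => momentum ℓ n i + Real.pi) / eps (momentum ℓ n)) *
        cosAvgPos (momentum ℓ n)) := by
    intro n hn
    obtain ⟨hn0, hn1⟩ := hF n hn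
    have hε := eps_pos hn
    have hq : cosAvgPos (momentum ℓ n) = max (1 / (d : ℝ) * cosSum ℓ n) 0 := rfl
    rw [hq]
    rcases le_total (1 / (d : ℝ) * cosSum ℓ n) 0 with hs | hs
    · rw [max_eq_right hs]
      simpa using mul_nonpos_of_nonneg_of_nonpos hn0 hs
    · rw [max_eq_left hs]
      have hC : 0 ≤ cosSum ℓ n := nonneg_of_mul_nonneg_right hs (one_div_pos.2 hd)
      have h3 : √(2 * (∑ j, (α - c * Real.cos (momentum ℓ n j))) / eps (momentum ℓ n)) ≤
          √α * √(eps (fun i => momentum ℓ n i + Real.pi) / eps (momentum ℓ n)) := by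
        rw [← Real.sqrt_mul hα, ← mul_div_assoc]
        refine Real.sqrt_le_sqrt (div_le_div_of_nonneg_right ?_ hε.le)
        rw [eps_momentum_add_pi, Finset.sum_sub_distrib, ← Finset.mul_sum]
        simp only [Finset.sum_const, Finset.card_univ, Fintype.card_fin, nsmul_eq_mul]
        have := neg_le_of_abs_le hc
        change 2 * (d * α - c * cosSum ℓ n) ≤ _
        nlinarith
      calc _ ≤ (1 / (2 * β * eps (momentum ℓ n)) + 1 / 2 * (√α *
            √(eps (fun i => momentum ℓ n i + Real.pi) / eps (momentum ℓ n)))) *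
            (1 / d * cosSum ℓ n) := mul_le_mul_of_nonneg_right (by linarith) hs
        _ = _ := by
          rw [← one_div_mul_one_div]
          ring
  have h3 := Finset.sum_le_sum h2
  rw [Finset.sum_add_distrib, ← Finset.mul_sum, ← Finset.mul_sum] at h3
  have h5 : (ℓ : ℝ) ^ d * F (e₁ d ℓ) ≤ ∑ x, F x +
      (1 / (2 * β) * sumDual d ℓ (fun k => 1 / eps k * cosAvgPos k) + 1 / 2 * √α *
        sumDual d ℓ (fun k => √(eps (fun i => k i + Real.pi) / eps k) * cosAvgPos k)) := by
    rw [← h1]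
    exact add_le_add le_rfl h3
  have h6 := mul_le_mul_of_nonneg_left h5 (one_div_pos.2 hL).le
  rw [← mul_assoc, one_div_mul_cancel hL.ne', one_mul] at h6
  rw [latticeITilde]
  refine le_of_eq_of_le ?_ (sub_le_iff_le_add.2 (h6.trans_eq (mul_add _ _ _)))
  rw [← one_div_mul_one_div (2 * β)]
  ring

end order

/-! ### The bounds at positive temperature -/

section final
variable {N d ℓ : ℕ} [NeZero d] [NeZero ℓ] {J : Fin 3 → ℝ} {β : ℝ}

theorem abs_alphaDual_le (hℓ : 2 ≤ ℓ) (hβ : 0 < β) (hJ : |J 1| ≤ J 0) :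
    |alphaDual N d ℓ J β| ≤ alpha N d ℓ J β := by
  have h := abs_le.1 (abs_corr_one_le (N := N) hℓ hβ hJ (e₁ d ℓ))
  have hJ := abs_le.1 hJ
  rw [abs_le, alphaDual, alpha]
  constructor <;> nlinarith

/-- `α ≤ (J₁ - J₂) ⟨S_0⁽¹⁾S_{e₁}⁽¹⁾⟩ ≤ (1 - J₂/J₁) ⟨S_0⁽³⁾S_{e₁}⁽³⁾⟩`, as `0 < J₁ ≤ 1`. -/
theorem alpha_div_le (hℓ : 2 ≤ ℓ) (hβ : 0 < β) (hJ : |J 1| ≤ J 0) (h0 : 0 < J 0) (h01 : J 0 ≤ 1)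
    (h1 : J 1 ≤ 0) (h2 : J 2 = 1) :
    alpha N d ℓ J β / (1 - J 1 / J 0) ≤ corr N d ℓ J β 2 (e₁ d ℓ) := by
  have h3 := abs_corr_one_le (N := N) hℓ hβ hJ (e₁ d ℓ)
  have h4 := abs_corr_zero_le (N := N) (J := J) hℓ hβ (by rw [h2, abs_of_pos h0]; exact h01)
    (e₁ d ℓ)
  have h5 := (abs_nonneg _).trans h3
  have h6 := (le_abs_self _).trans h4
  have h7 : 0 ≤ -(J 1 / J 0) := neg_nonneg.2 (div_nonpos_of_nonpos_of_nonneg h1 h0.le)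
  rw [div_le_iff₀ (by linarith), alpha]
  have h8 : -corr N d ℓ J β 0 (e₁ d ℓ) ≤ corr N d ℓ J β 1 (e₁ d ℓ) := neg_le_of_abs_le h3
  have h9 : J 1 / J 0 ≤ J 1 := by
    rw [div_le_iff₀ h0]; nlinarith
  nlinarith

theorem order_bounds (heven : Even ℓ) (hℓ : 2 ≤ ℓ) (hβ : 0 < β) (h01 : J 0 ≤ 1)
    (hJ : -J 1 ≤ J 0) (h1 : J 1 ≤ 0) (h2 : J 2 = 1) :
    0 ≤ alpha N d ℓ J β ∧
      1 / 3 * spinValue N * (spinValue N + 1)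
          - 1 / 2 * (latticeI d ℓ + √2 / (ℓ : ℝ) ^ d) * √(alpha N d ℓ J β)
          - 1 / (2 * β * (ℓ : ℝ) ^ d) * sumDual d ℓ (fun k => 1 / eps k)
        ≤ orderParameter N d ℓ J β ∧
      (0 < J 0 →
        √(alpha N d ℓ J β) *
            (√(alpha N d ℓ J β) / (1 - J 1 / J 0) - 1 / 2 * latticeITilde d ℓ)
          - 1 / (2 * β * (ℓ : ℝ) ^ d) * sumDual d ℓ (fun k => 1 / eps k * cosAvgPos k)
        ≤ orderParameter N d ℓ J β) := by
  have h0 : 0 ≤ J 0 := by linarith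
  have hJ1 : |J 1| ≤ J 0 := by rwa [abs_of_nonpos h1]
  have hJ0 : |J 0| ≤ J 2 := by rwa [abs_of_nonneg h0, h2]
  have hc := abs_alphaDual_le (N := N) (d := d) hℓ hβ hJ1
  have hα := (abs_nonneg _).trans hc
  have hF := fun n (hn : n ∈ dualIndex d ℓ) => infrared_bound (N := N) heven hℓ hβ h0 h1 h2 hn
  refine ⟨hα, ?_, fun hpos => ?_⟩
  · have := le_order_of_infrared_bound heven hℓ hc fun n hn => (hF n hn).2
    have h3 := le_corr_two_zero (N := N) (d := d) hℓ hβ hJ1 hJ0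
    rw [orderParameter]
    linarith
  · have := le_order_of_infrared_bound_neighbour heven hℓ hc (corr_neg hℓ 2)
      (corr_unitSite hℓ 2) hF
    have h3 := alpha_div_le (N := N) (d := d) hℓ hβ hJ1 hpos h01 h1 h2
    have h4 : √(alpha N d ℓ J β) * (√(alpha N d ℓ J β) / (1 - J 1 / J 0) -
        1 / 2 * latticeITilde d ℓ) = alpha N d ℓ J β / (1 - J 1 / J 0) -
        1 / 2 * latticeITilde d ℓ * √(alpha N d ℓ J β) := by
      rw [mul_sub, ← mul_div_assoc, Real.mul_self_sqrt hα]
      ring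
    rw [orderParameter, h4]
    linarith

end final

end SpinLRO


theorem theorem3p2 (d ℓ N : ℕ) [NeZero d] [NeZero ℓ] (hℓ : Even ℓ) (hN : 1 ≤ N)
    (J₁ J₂ J₃ : ℝ) (h₃ : J₃ = 1) (h₁ : J₁ ≤ 1) (h₁₂ : -J₂ ≤ J₁) (h₂ : 0 ≤ -J₂) :
    (∀ β : ℝ, 0 < β →
      0 ≤ alpha N d ℓ ![J₁, J₂, J₃] β ∧
      1 / 3 * spinValue N * (spinValue N + 1)
          - 1 / 2 * (latticeI d ℓ + √2 / (ℓ : ℝ) ^ d) * √(alpha N d ℓ ![J₁, J₂, J₃] β)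
          - 1 / (2 * β * (ℓ : ℝ) ^ d) * sumDual d ℓ (fun k => 1 / eps k)
        ≤ orderParameter N d ℓ ![J₁, J₂, J₃] β ∧
      (0 < J₁ →
        √(alpha N d ℓ ![J₁, J₂, J₃] β) *
            (√(alpha N d ℓ ![J₁, J₂, J₃] β) / (1 - J₂ / J₁) - 1 / 2 * latticeITilde d ℓ)
          - 1 / (2 * β * (ℓ : ℝ) ^ d) * sumDual d ℓ (fun k => 1 / eps k * cosAvgPos k)
        ≤ orderParameter N d ℓ ![J₁, J₂, J₃] β)) ∧
    -- the case `β = ∞`, where the states are the limits of the states as `β → ∞`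
    (∃ m a : ℝ,
      Tendsto (fun β : ℝ => orderParameter N d ℓ ![J₁, J₂, J₃] β) atTop (𝓝 m) ∧
      Tendsto (fun β : ℝ => alpha N d ℓ ![J₁, J₂, J₃] β) atTop (𝓝 a) ∧
      0 ≤ a ∧
      1 / 3 * spinValue N * (spinValue N + 1)
          - 1 / 2 * (latticeI d ℓ + √2 / (ℓ : ℝ) ^ d) * √a ≤ m ∧
      (0 < J₁ → √a * (√a / (1 - J₂ / J₁) - 1 / 2 * latticeITilde d ℓ) ≤ m)) := by
  have hℓ2 : 2 ≤ ℓ := by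
    have := NeZero.ne ℓ
    obtain ⟨m, hm⟩ := hℓ
    omega
  have main := fun (β : ℝ) (hβ : 0 < β) =>
    order_bounds (N := N) (d := d) (J := ![J₁, J₂, J₃]) hℓ hℓ2 hβ h₁ h₁₂ (neg_nonneg.1 h₂) h₃
  refine ⟨main, ?_⟩
  choose L hL using exists_tendsto_corr (N := N) (d := d) hℓ2 ![J₁, J₂, J₃]
  have hm : Tendsto (fun β : ℝ => orderParameter N d ℓ ![J₁, J₂, J₃] β) atTop
      (𝓝 (1 / (ℓ : ℝ) ^ d * ∑ x : Box d ℓ, L 2 x)) :=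
    (tendsto_finsetSum _ fun x _ => hL 2 x).const_mul _
  have ha : Tendsto (fun β : ℝ => alpha N d ℓ ![J₁, J₂, J₃] β) atTop
      (𝓝 (J₁ * L 0 (e₁ d ℓ) + J₂ * L 1 (e₁ d ℓ))) :=
    ((hL 0 _).const_mul _).add ((hL 1 _).const_mul _)
  have hs := (Real.continuous_sqrt.tendsto _).comp ha
  have hβ0 : ∀ C : ℝ, Tendsto (fun β : ℝ => 1 / (2 * β * (ℓ : ℝ) ^ d) * C) atTop (𝓝 0) := by
    intro C
    have h : Tendsto (fun β : ℝ => 1 / (2 * (ℓ : ℝ) ^ d) * C * β⁻¹) atTop (𝓝 0) := by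
      simpa using tendsto_inv_atTop_zero.const_mul (1 / (2 * (ℓ : ℝ) ^ d) * C)
    refine h.congr fun β => ?_
    rw [mul_right_comm 2 β, ← one_div_mul_one_div _ β]
    ring
  refine ⟨_, _, hm, ha, ge_of_tendsto ha ?_, ?_, fun hJ => ?_⟩
  · filter_upwards [eventually_gt_atTop 0] with β hβ using (main β hβ).1
  · have := ((hs.const_mul (1 / 2 * (latticeI d ℓ + √2 / (ℓ : ℝ) ^ d))).const_sub
      (1 / 3 * spinValue N * (spinValue N + 1))).sub (hβ0 (sumDual d ℓ fun k => 1 / eps k))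
    rw [sub_zero] at this
    refine le_of_tendsto_of_tendsto this hm ?_
    filter_upwards [eventually_gt_atTop 0] with β hβ using (main β hβ).2.1
  · have := (hs.mul ((hs.div_const (1 - J₂ / J₁)).sub_const (1 / 2 * latticeITilde d ℓ))).sub
      (hβ0 (sumDual d ℓ fun k => 1 / eps k * cosAvgPos k))
    rw [sub_zero] at this
    refine le_of_tendsto_of_tendsto this hm ?_
    filter_upwards [eventually_gt_atTop 0] with β hβ using (main β hβ).2.2 hJ
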